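/- Let $f\colon Y\to X$ be a finite étale morphism of adic spaces (in the sense of Huber) of degree $d$. That is, $X$ is covered by affinoid open subsets $V$ such that $f^{-1}(V)$ is affinoid, the ring homomorphism $\mathcal{O}_X(V)\to\mathcal{O}_Y(f^{-1}(V))$ is finite étale of constant rank $d$, $\mathcal{O}_Y(f^{-1}(V))$ carries the natural topology of a finite $\mathcal{O}_X(V)$-module, and $\mathcal{O}_Y^+(f^{-1}(V))$ is the integral closure of $\mathcal{O}_X^+(V)$ in $\mathcal{O}_Y(f^{-1}(V))$. Then $\mathcal{F}=f_*\mathcal{O}_Y$ is a locally free $\mathcal{O}_X$-module of rank $d$, and there is an isomorphism of $\mathcal{O}_X$-modules \[ \Bigl(\bigwedge\nolimits^{d}\mathcal{F}\Bigr)^{\otimes 2}\;\cong\;\mathcal{O}_X . \] Here the exterior power and the tensor product are those of sheaves of $\mathcal{O}_X$-modules. -/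

import Mathlib

open CategoryTheory TopologicalSpace Opposite Topology

universe u

noncomputable section

namespace Adic

/-! ### Huber pairs -/

/-- A Huber ring (also called f-adic ring): a topological ring with an open subring `A₀` whose
subspace topology is the `I`-adic one, for some finitely generated ideal `I` of `A₀`. -/
class IsHuberRing (A : Type u) [CommRing A] [TopologicalSpace A] : Prop
    extends IsTopologicalRing A where
  exists_ringOfDefinition : ∃ (A₀ : Subring A) (I : Ideal A₀),
    IsOpen (A₀ : Set A) ∧ I.FG ∧ IsAdic I

/-- `a` is power-bounded: the set of its powers is bounded. -/
def IsPowerBounded {A : Type u} [CommRing A] [TopologicalSpace A] (a : A) : Prop :=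
  ∀ U ∈ 𝓝 (0 : A), ∃ V ∈ 𝓝 (0 : A), ∀ v ∈ V, ∀ n : ℕ, v * a ^ n ∈ U

/-- A Huber pair (affinoid ring) `(A, A⁺)`. -/
structure HuberPair : Type (u + 1) where
  carrier : Type u
  [commRing : CommRing carrier]
  [topology : TopologicalSpace carrier]
  [isHuberRing : IsHuberRing carrier]
  /-- The ring of integral elements `A⁺`. -/
  plus : Subring carrier
  isOpen_plus : IsOpen (plus : Set carrier)
  mem_plus_of_isIntegral : ∀ a : carrier, IsIntegral plus a → a ∈ plus
  isPowerBounded_of_mem_plus : ∀ a ∈ plus, IsPowerBounded a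

attribute [instance] HuberPair.commRing HuberPair.topology HuberPair.isHuberRing

instance : CoeSort HuberPair.{u} (Type u) := ⟨HuberPair.carrier⟩

/-- `(A, A⁺)` is complete: `A` is complete and Hausdorff. -/
def HuberPair.IsComplete (A : HuberPair.{u}) : Prop :=
  T2Space A ∧ @CompleteSpace A (IsTopologicalAddGroup.rightUniformSpace A)

section HuberRing

variable {A : Type u} [CommRing A] [TopologicalSpace A] [IsHuberRing A]

/-- The neighbourhoods `J n = Iⁿ` of zero in a Huber ring. -/
theorem exists_basis_nhds_zero (A : Type u) [CommRing A] [TopologicalSpace A] [IsHuberRing A] :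
    ∃ J : ℕ → AddSubgroup A, (∀ n, IsOpen (J n : Set A)) ∧
      (∀ U ∈ 𝓝 (0 : A), ∃ n, (J n : Set A) ⊆ U) ∧
      ∀ n, ∃ G : Finset A, (G : Set A) ⊆ J n ∧ (J n : Set A) ⊆ Ideal.span (G : Set A) ∧
        ∀ m, J (m + n) ≤ AddSubgroup.closure
          (Set.image2 (· * ·) (J m : Set A) (G : Set A)) := by
  obtain ⟨A₀, I, hA₀, hI, hadic⟩ := IsHuberRing.exists_ringOfDefinition (A := A)
  rw [isAdic_iff] at hadic
  obtain ⟨h1, h2⟩ := hadic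
  let J : ℕ → AddSubgroup A := fun n => ((I ^ n).toAddSubgroup).map A₀.subtype.toAddMonoidHom
  have memJ : ∀ n (a : A₀), a ∈ I ^ n → (a : A) ∈ J n := fun n a ha => ⟨a, ha, rfl⟩
  have key : ∀ n, ∃ G : Finset A, (G : Set A) ⊆ J n ∧ ∀ m, J (m + n) ≤ AddSubgroup.closure
          (Set.image2 (· * ·) (J m : Set A) (G : Set A)) := by
    classical
    intro n
    obtain ⟨G, hG⟩ : (I ^ n).FG := hI.pow
    refine ⟨G.image A₀.subtype, ?_, ?_⟩
    · intro a ha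
      obtain ⟨g, hg, rfl⟩ := Finset.mem_image.1 (Finset.mem_coe.1 ha)
      exact memJ n g (hG ▸ Ideal.subset_span hg)
    · rintro m _ ⟨b, hb, rfl⟩
      change b ∈ I ^ (m + n) at hb
      rw [pow_add] at hb
      refine Submodule.mul_induction_on hb ?_ ?_
      · intro p hp q hq
        rw [← hG] at hq
        change (p * q : A₀).1 ∈ _
        clear hb b
        induction hq using Submodule.span_induction generalizing p with
        | mem x hx =>
          exact AddSubgroup.subset_closure ⟨p, memJ m p hp, x,
            Finset.mem_coe.2 (Finset.mem_image_of_mem _ hx), rfl⟩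
        | zero => simp
        | add x y _ _ hx hy =>
          rw [mul_add]
          exact add_mem (hx p hp) (hy p hp)
        | smul c x _ hx =>
          have := hx (p * c) (Ideal.mul_mem_right c _ hp)
          rwa [mul_assoc] at this
      · intro x y hx hy
        exact add_mem hx hy
  refine ⟨J, ?_, ?_, ?_⟩
  · intro n
    exact hA₀.isOpenMap_subtype_val _ (h1 n)
  · intro U hU
    have : (A₀.subtype ⁻¹' U) ∈ 𝓝 (0 : A₀) :=
      continuous_subtype_val.continuousAt.preimage_mem_nhds (by simpa using hU)
    obtain ⟨n, hn⟩ := h2 _ this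
    refine ⟨n, ?_⟩
    rintro _ ⟨b, hb, rfl⟩
    exact hn hb
  · intro n
    obtain ⟨G, hG, h⟩ := key n
    refine ⟨G, hG, fun a ha => ?_, h⟩
    have := h 0 (by simpa using ha)
    refine (AddSubgroup.closure_le (K := (Ideal.span (G : Set A)).toAddSubgroup)).2 ?_ this
    rintro _ ⟨x, _, g, hg, rfl⟩
    exact Ideal.mul_mem_left _ _ (Ideal.subset_span hg)

instance instNonarchimedeanRing : NonarchimedeanRing A where
  is_nonarchimedean U hU := by
    obtain ⟨J, hJ, h, -⟩ := exists_basis_nhds_zero A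
    obtain ⟨n, hn⟩ := h U hU
    exact ⟨⟨J n, hJ n⟩, hn⟩

/-- If the ideal generated by `T` is open, then so is the additive subgroup `T · U` for every
open additive subgroup `U`. -/
theorem exists_subset_closure_mul (T : Set A) (hT : IsOpen (Ideal.span T : Set A))
    (U : OpenAddSubgroup A) :
    ∃ V : OpenAddSubgroup A,
      (V : Set A) ⊆ AddSubgroup.closure (Set.image2 (· * ·) T (U : Set A)) := by
  obtain ⟨J, hJ, hsub, hG⟩ := exists_basis_nhds_zero A
  obtain ⟨n, hn⟩ := hsub _ (hT.mem_nhds (zero_mem _))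
  have claim : ∀ g ∈ Ideal.span T, ∃ W ∈ 𝓝 (0 : A), ∀ x ∈ W,
      x * g ∈ AddSubgroup.closure (Set.image2 (· * ·) T (U : Set A)) := by
    intro g hg
    induction hg using Submodule.span_induction with
    | mem t ht =>
      refine ⟨U, U.mem_nhds_zero, fun x hx => ?_⟩
      rw [mul_comm]
      exact AddSubgroup.subset_closure ⟨t, ht, x, hx, rfl⟩
    | zero => exact ⟨Set.univ, Filter.univ_mem, fun x _ => by simp⟩
    | add a b _ _ ha hb =>
      obtain ⟨W, hW, h⟩ := ha
      obtain ⟨W', hW', h'⟩ := hb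
      refine ⟨W ∩ W', Filter.inter_mem hW hW', fun x hx => ?_⟩
      rw [mul_add]
      exact add_mem (h x hx.1) (h' x hx.2)
    | smul c a _ ha =>
      obtain ⟨W, hW, h⟩ := ha
      refine ⟨(· * c) ⁻¹' W, ?_, fun x hx => ?_⟩
      · exact (continuous_mul_const c).continuousAt.preimage_mem_nhds (by simpa using hW)
      · have := h _ hx
        rwa [smul_eq_mul, ← mul_assoc]
  obtain ⟨G, hGJ, -, hGmul⟩ := hG n
  choose! W hW hWmul using claim
  have hinter : (⋂ g ∈ G, W g) ∈ 𝓝 (0 : A) :=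
    (Filter.biInter_finset_mem G).2 fun g hg => hW g (hn (hGJ hg))
  obtain ⟨m, hm⟩ := hsub _ hinter
  refine ⟨⟨J (m + n), hJ _⟩, fun a ha => ?_⟩
  refine (AddSubgroup.closure_le _).2 ?_ (hGmul m ha)
  rintro _ ⟨x, hx, g, hg, rfl⟩
  exact hWmul g (hn (hGJ hg)) x (Set.mem_iInter₂.1 (hm hx) g hg)

theorem isOpen_ideal_of_subset {H : AddSubgroup A} (hH : IsOpen (H : Set A)) {I : Ideal A}
    (h : (H : Set A) ⊆ I) : IsOpen (I : Set A) :=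
  AddSubgroup.isOpen_mono (H₁ := H) (H₂ := I.toAddSubgroup) h hH

end HuberRing

/-! ### Rational localizations `A⟨T/s⟩` -/

/-- A rational datum: a finite set `T` generating an open ideal of `A`, and an element `s`. -/
structure RatData (A : HuberPair.{u}) : Type u where
  T : Finset A
  s : A
  isOpen_span : IsOpen (Ideal.span (T : Set A) : Set A)

namespace RatData

variable {A : HuberPair.{u}} (ρ : RatData A)

/-- The ring `A[1/s]`, to be topologized as `A(T/s)`. -/
def Loc : Type u := Localization.Away ρ.s

instance : CommRing ρ.Loc := inferInstanceAs (CommRing (Localization.Away ρ.s))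
instance : Algebra A ρ.Loc := inferInstanceAs (Algebra A (Localization.Away ρ.s))
instance : IsLocalization.Away ρ.s ρ.Loc :=
  inferInstanceAs (IsLocalization.Away ρ.s (Localization.Away ρ.s))

/-- The inverse of `s` in `A[1/s]`. -/
def sInv : ρ.Loc := IsLocalization.Away.invSelf ρ.s

theorem s_mul_sInv : algebraMap A ρ.Loc ρ.s * ρ.sInv = 1 := IsLocalization.Away.mul_invSelf ρ.s

/-- The subring of `A[1/s]` generated by the fractions `t / s`, `t ∈ T`. -/
def fracSubring : Subring ρ.Loc :=
  Subring.closure ((fun t => algebraMap A ρ.Loc t * ρ.sInv) '' (ρ.T : Set A))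

/-- For an open subgroup `U` of `A`, the subgroup of `A[1/s]` generated by the products `d * u`
with `d` in the subring generated by the `t / s` and `u ∈ U`. -/
def basicSubgroup (U : OpenAddSubgroup A) : AddSubgroup ρ.Loc :=
  AddSubgroup.closure
    (Set.image2 (fun d u => d * algebraMap A ρ.Loc u) (ρ.fracSubring : Set ρ.Loc) (U : Set A))

variable {ρ} in
theorem mul_mem_basicSubgroup {U : OpenAddSubgroup A} {d : ρ.Loc} (hd : d ∈ ρ.fracSubring)
    {a : A} (ha : a ∈ U) : d * algebraMap A ρ.Loc a ∈ ρ.basicSubgroup U :=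
  AddSubgroup.subset_closure ⟨d, hd, a, ha, rfl⟩

variable {ρ} in
theorem basicSubgroup_le {U : OpenAddSubgroup A} {K : AddSubgroup ρ.Loc}
    (h : ∀ d ∈ ρ.fracSubring, ∀ a ∈ U, d * algebraMap A ρ.Loc a ∈ K) :
    ρ.basicSubgroup U ≤ K := by
  refine (AddSubgroup.closure_le _).2 ?_
  rintro _ ⟨d, hd, a, ha, rfl⟩
  exact h d hd a ha

variable {ρ} in
theorem mul_mem_of_forall {U : OpenAddSubgroup A} {K : AddSubgroup ρ.Loc} (x : ρ.Loc)
    (h : ∀ d ∈ ρ.fracSubring, ∀ a ∈ U, x * (d * algebraMap A ρ.Loc a) ∈ K)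
    {y : ρ.Loc} (hy : y ∈ ρ.basicSubgroup U) : x * y ∈ K :=
  basicSubgroup_le (K := K.comap (AddMonoidHom.mulLeft x)) h hy

theorem exists_mul_algebraMap_mem (a : A) (U : OpenAddSubgroup A) :
    ∃ V : OpenAddSubgroup A, ∀ y ∈ ρ.basicSubgroup V,
      algebraMap A ρ.Loc a * y ∈ ρ.basicSubgroup U := by
  obtain ⟨V, hV⟩ := NonarchimedeanRing.is_nonarchimedean ((a * ·) ⁻¹' (U : Set A))
    ((continuous_const_mul a).continuousAt.preimage_mem_nhds (by simpa using U.mem_nhds_zero))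
  refine ⟨V, fun y hy => mul_mem_of_forall _ (fun d hd b hb => ?_) hy⟩
  have : algebraMap A ρ.Loc a * (d * algebraMap A ρ.Loc b) = d * algebraMap A ρ.Loc (a * b) := by
    rw [map_mul]; ring
  rw [this]
  exact mul_mem_basicSubgroup hd (hV hb)

theorem exists_sInv_mul_mem (U : OpenAddSubgroup A) :
    ∃ V : OpenAddSubgroup A, ∀ y ∈ ρ.basicSubgroup V, ρ.sInv * y ∈ ρ.basicSubgroup U := by
  obtain ⟨V, hV⟩ := exists_subset_closure_mul (ρ.T : Set A) ρ.isOpen_span U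
  refine ⟨V, fun y hy => mul_mem_of_forall _ (fun d hd b hb => ?_) hy⟩
  have hle : AddSubgroup.closure (Set.image2 (· * ·) (ρ.T : Set A) (U : Set A)) ≤
      (ρ.basicSubgroup U).comap
        ((AddMonoidHom.mulLeft (ρ.sInv * d)).comp (algebraMap A ρ.Loc).toAddMonoidHom) := by
    refine (AddSubgroup.closure_le _).2 ?_
    rintro _ ⟨t, ht, u, hu, rfl⟩
    change ρ.sInv * d * algebraMap A ρ.Loc (t * u) ∈ ρ.basicSubgroup U
    have : ρ.sInv * d * algebraMap A ρ.Loc (t * u) =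
        (d * (algebraMap A ρ.Loc t * ρ.sInv)) * algebraMap A ρ.Loc u := by
      rw [map_mul]; ring
    rw [this]
    exact mul_mem_basicSubgroup (mul_mem hd (Subring.subset_closure ⟨t, ht, rfl⟩)) hu
  have := hle (hV hb)
  change ρ.sInv * d * algebraMap A ρ.Loc b ∈ ρ.basicSubgroup U at this
  rwa [mul_assoc] at this

theorem ringSubgroupsBasis : RingSubgroupsBasis ρ.basicSubgroup := by
  refine RingSubgroupsBasis.of_comm _ ?_ ?_ ?_
  · intro U V
    exact ⟨U ⊓ V, le_inf
      (basicSubgroup_le fun d hd a ha => mul_mem_basicSubgroup hd (OpenAddSubgroup.mem_inf.1 ha).1)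
      (basicSubgroup_le fun d hd a ha => mul_mem_basicSubgroup hd (OpenAddSubgroup.mem_inf.1 ha).2)⟩
  · intro U
    obtain ⟨V, hV⟩ := NonarchimedeanRing.mul_subset U
    refine ⟨V, ?_⟩
    rintro _ ⟨x, hx, y, hy, rfl⟩
    refine mul_mem_of_forall x (fun d hd a ha => ?_) hy
    rw [mul_comm]
    refine mul_mem_of_forall _ (fun d' hd' a' ha' => ?_) hx
    have : d * algebraMap A ρ.Loc a * (d' * algebraMap A ρ.Loc a') =
      (d * d') * algebraMap A ρ.Loc (a * a') := by rw [map_mul]; ring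
    rw [this]
    exact mul_mem_basicSubgroup (mul_mem hd hd') (hV (Set.mul_mem_mul ha ha'))
  · intro x U
    obtain ⟨n, a, ha⟩ := IsLocalization.Away.surj ρ.s x
    have hx : x = algebraMap A ρ.Loc a * ρ.sInv ^ n := by
      rw [← ha, mul_assoc, ← mul_pow, s_mul_sInv, one_pow, mul_one]
    suffices ∃ V : OpenAddSubgroup A, ∀ y ∈ ρ.basicSubgroup V, x * y ∈ ρ.basicSubgroup U from
      this
    rw [hx]
    clear hx ha
    induction n generalizing U with
    | zero => simpa using ρ.exists_mul_algebraMap_mem a U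
    | succ n ih =>
      obtain ⟨V, hV⟩ := ih U
      obtain ⟨W, hW⟩ := ρ.exists_sInv_mul_mem V
      refine ⟨W, fun y hy => ?_⟩
      rw [pow_succ, ← mul_assoc, mul_assoc]
      exact hV _ (hW y hy)

/-- The topological ring `A(T/s)`: the open subgroups `D · U` form a basis of neighbourhoods of
zero, where `D` is the subring generated by the `t / s` and `U` runs through the open subgroups
of `A`. -/
instance : TopologicalSpace ρ.Loc := ρ.ringSubgroupsBasis.topology

instance : IsTopologicalRing ρ.Loc :=
  ρ.ringSubgroupsBasis.toRingFilterBasis.isTopologicalRing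

instance : UniformSpace ρ.Loc := IsTopologicalAddGroup.rightUniformSpace ρ.Loc
instance : IsUniformAddGroup ρ.Loc := isUniformAddGroup_of_addCommGroup

theorem hasBasis_nhds_zero :
    (𝓝 (0 : ρ.Loc)).HasBasis (fun _ => True) fun U => (ρ.basicSubgroup U : Set ρ.Loc) :=
  ρ.ringSubgroupsBasis.hasBasis_nhds_zero

/-- The complete topological ring `A⟨T/s⟩`, the completion of `A(T/s)`. -/
abbrev Compl : Type u := UniformSpace.Completion ρ.Loc

/-- The canonical homomorphism `A → A⟨T/s⟩`. -/
def toCompl : A →+* ρ.Compl := UniformSpace.Completion.coeRingHom.comp (algebraMap A ρ.Loc)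

variable {ρ} in
/-- A ring homomorphism out of `A(T/s)` is continuous as soon as it is so on `A` and maps the
fractions `t / s` into a bounded subring. -/
theorem continuous_of_forall {B : Type*} [CommRing B] [TopologicalSpace B] [IsTopologicalRing B]
    (f : ρ.Loc →+* B)
    (h : ∀ W ∈ 𝓝 (0 : B), ∃ K : AddSubgroup B, (K : Set B) ⊆ W ∧ ∃ U : OpenAddSubgroup A,
      ∀ d ∈ ρ.fracSubring, ∀ a ∈ U, f d * f (algebraMap A ρ.Loc a) ∈ K) :
    Continuous f := by
  refine continuous_of_continuousAt_zero f ?_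
  rw [ContinuousAt, map_zero, ρ.hasBasis_nhds_zero.tendsto_left_iff]
  intro W hW
  obtain ⟨K, hK, U, hU⟩ := h W hW
  refine ⟨U, trivial, fun y hy => hK ?_⟩
  refine basicSubgroup_le (K := K.comap f.toAddMonoidHom) (fun d hd a ha => ?_) hy
  change f (d * _) ∈ K
  rw [map_mul]
  exact hU d hd a ha

/-- Two continuous homomorphisms from `A⟨T/s⟩` to a Hausdorff ring which agree on `A` are equal. -/
theorem hom_ext {B : Type*} [CommRing B] [TopologicalSpace B] [T2Space B]
    {f g : ρ.Compl →+* B} (hf : Continuous f) (hg : Continuous g)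
    (h : f.comp ρ.toCompl = g.comp ρ.toCompl) : f = g := by
  have key : f.comp UniformSpace.Completion.coeRingHom =
      g.comp (UniformSpace.Completion.coeRingHom : ρ.Loc →+* ρ.Compl) :=
    IsLocalization.ringHom_ext (Submonoid.powers ρ.s) h
  ext x
  induction x using UniformSpace.Completion.induction_on with
  | hp => exact isClosed_eq hf hg
  | ih a => exact RingHom.congr_fun key a

end RatData

/-! ### The adic spectrum -/

/-- A valuation (up to equivalence) `|·|` on a topological ring is continuous if `{a | |a| < γ}`
is open for all `γ ≠ 0` in its value group. -/
def IsContinuousVal {A : Type u} [CommRing A] [TopologicalSpace A] (r : ValuativeRel A) : Prop :=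
  letI := r
  ∀ γ : ValuativeRel.ValueGroupWithZero A, γ ≠ 0 → IsOpen {a | ValuativeRel.valuation A a < γ}

/-- The points of `Spa(A, A⁺)`: equivalence classes of continuous valuations on `A` which are
at most `1` on `A⁺`. -/
structure Spa (A : HuberPair.{u}) : Type u where
  rel : ValuativeRel A
  isContinuousVal : IsContinuousVal rel
  vle_one : ∀ a ∈ A.plus, rel.vle a 1

namespace Spa

variable {A : HuberPair.{u}}

/-- The topology of `Spa(A, A⁺)` is generated by the sets `{x | |f(x)| ≤ |s(x)| ≠ 0}`. -/
instance : TopologicalSpace (Spa A) :=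
  generateFrom {W | ∃ f s : A, W = {x | x.rel.vle f s ∧ ¬ x.rel.vle s 0}}

theorem isOpen_setOf_vle (f s : A) : IsOpen {x : Spa A | x.rel.vle f s ∧ ¬ x.rel.vle s 0} :=
  isOpen_generateFrom_of_mem ⟨f, s, rfl⟩

variable (x : Spa A)

/-- The value group with zero of a point. -/
abbrev Γ₀ : Type u := @ValuativeRel.ValueGroupWithZero A _ x.rel

/-- The valuation `a ↦ |a(x)|`. -/
def v : Valuation A x.Γ₀ := @ValuativeRel.valuation A _ x.rel

theorem v_le_iff {a b : A} : x.v a ≤ x.v b ↔ x.rel.vle a b :=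
  (@Valuation.Compatible.vle_iff_le _ _ _ _ x.v x.rel
    (@ValuativeRel.instCompatibleValueGroupWithZeroValuation A _ x.rel) a b).symm

theorem v_eq_zero_iff {a : A} : x.v a = 0 ↔ x.rel.vle a 0 := by
  rw [← x.v_le_iff, map_zero, le_zero_iff]

theorem isOpen_v_lt {γ : x.Γ₀} (hγ : γ ≠ 0) : IsOpen {a | x.v a < γ} := x.isContinuousVal γ hγ

/-- The field `Frac(A / supp x)`. -/
def Residue : Type u := FractionRing (A ⧸ x.v.supp)

instance : Field x.Residue := inferInstanceAs (Field (FractionRing (A ⧸ x.v.supp)))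
instance : Algebra (A ⧸ x.v.supp) x.Residue :=
  inferInstanceAs (Algebra (A ⧸ x.v.supp) (FractionRing (A ⧸ x.v.supp)))
instance : IsFractionRing (A ⧸ x.v.supp) x.Residue :=
  inferInstanceAs (IsFractionRing (A ⧸ x.v.supp) (FractionRing (A ⧸ x.v.supp)))

theorem nonZeroDivisors_le :
    nonZeroDivisors (A ⧸ x.v.supp) ≤ (x.v.onQuot le_rfl).supp.primeCompl := by
  intro a ha h
  have h' : a ∈ (x.v.onQuot le_rfl).supp := h
  rw [Valuation.supp_quot_supp] at h'
  exact nonZeroDivisors.ne_zero ha (by simpa using h')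

/-- The valuation induced by `x` on `Frac(A / supp x)`. -/
def residueVal : Valuation x.Residue x.Γ₀ :=
  (x.v.onQuot le_rfl).extendToLocalization (S := nonZeroDivisors (A ⧸ x.v.supp))
    x.nonZeroDivisors_le x.Residue

/-- The topology defined by the valuation. -/
instance : Valued x.Residue x.Γ₀ := Valued.mk' x.residueVal

/-- The homomorphism `A → Frac(A / supp x)`. -/
def toResidue : A →+* x.Residue := (algebraMap (A ⧸ x.v.supp) x.Residue).comp (Ideal.Quotient.mk _)

theorem v_toResidue (a : A) : Valued.v (x.toResidue a) = x.v a :=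
  (x.v.onQuot le_rfl).extendToLocalization_apply_map_apply x.nonZeroDivisors_le x.Residue _

theorem exists_ltAddSubgroup {W : Set x.Residue} (hW : W ∈ 𝓝 (0 : x.Residue)) :
    ∃ γ : x.Γ₀ˣ, {y : x.Residue | Valued.v y < (γ : x.Γ₀)} ⊆ W := by
  obtain ⟨γ, hγ⟩ := Valued.mem_nhds_zero.1 hW
  refine ⟨Units.map (MonoidWithZeroHom.ValueGroup₀.embedding (f := .ofClass _)).toMonoidHom γ,
    fun y hy => hγ ?_⟩
  exact (Valuation.restrict_lt_iff_lt_embedding _).2 hy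

/-- The completed residue field of `x`. -/
abbrev ComplResidue : Type u := UniformSpace.Completion x.Residue

/-- The valuation on the completed residue field. -/
def complVal : Valuation x.ComplResidue x.Γ₀ := Valued.extensionValuation

theorem complVal_coe (y : x.Residue) : x.complVal (y : x.ComplResidue) = Valued.v y :=
  Valued.extensionValuation_apply_coe y

end Spa

namespace RatData

variable {A : HuberPair.{u}} (ρ : RatData A)

/-- The rational subset `{x | |t(x)| ≤ |s(x)| ≠ 0 for all t ∈ T}`. -/
def subset : Set (Spa A) := {x | (∀ t ∈ ρ.T, x.rel.vle t ρ.s) ∧ ¬ x.rel.vle ρ.s 0}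

variable {ρ} in
theorem toResidue_s_ne_zero {x : Spa A} (hx : x ∈ ρ.subset) : x.toResidue ρ.s ≠ 0 := by
  intro h
  have := x.v_toResidue ρ.s
  rw [h, map_zero, eq_comm, x.v_eq_zero_iff] at this
  exact hx.2 this

/-- For a point `x` of the rational subset, the homomorphism `A(T/s) → Frac(A / supp x)`. -/
def locToResidue {x : Spa A} (hx : x ∈ ρ.subset) : ρ.Loc →+* x.Residue :=
  IsLocalization.Away.lift ρ.s (g := x.toResidue) (toResidue_s_ne_zero hx).isUnit

theorem locToResidue_algebraMap {x : Spa A} (hx : x ∈ ρ.subset) (a : A) :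
    ρ.locToResidue hx (algebraMap A ρ.Loc a) = x.toResidue a :=
  IsLocalization.Away.lift_eq _ _ _

theorem v_locToResidue_le_one {x : Spa A} (hx : x ∈ ρ.subset) {d : ρ.Loc}
    (hd : d ∈ ρ.fracSubring) : Valued.v (ρ.locToResidue hx d) ≤ 1 := by
  have hle : ρ.fracSubring ≤ ((Valued.v (R := x.Residue)).integer).comap (ρ.locToResidue hx) := by
    refine Subring.closure_le.2 ?_
    rintro _ ⟨t, ht, rfl⟩
    change Valued.v (ρ.locToResidue hx (algebraMap A ρ.Loc t * ρ.sInv)) ≤ 1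
    have hs := toResidue_s_ne_zero hx
    have h1 : Valued.v (x.toResidue ρ.s) * Valued.v (ρ.locToResidue hx ρ.sInv) = 1 := by
      rw [← map_mul, ← ρ.locToResidue_algebraMap hx, ← map_mul, s_mul_sInv, map_one, map_one]
    rw [map_mul, map_mul, locToResidue_algebraMap, ← h1, x.v_toResidue, x.v_toResidue]
    gcongr
    exact x.v_le_iff.2 (hx.1 t ht)
  exact hle hd

theorem continuous_locToResidue {x : Spa A} (hx : x ∈ ρ.subset) :
    Continuous (ρ.locToResidue hx) := by
  refine continuous_of_forall _ fun W hW => ?_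
  obtain ⟨γ, hγ⟩ := x.exists_ltAddSubgroup hW
  refine ⟨(Valued.v (R := x.Residue)).ltAddSubgroup γ, hγ,
    ⟨x.v.ltAddSubgroup γ, x.isOpen_v_lt γ.ne_zero⟩, fun d hd a ha => ?_⟩
  change Valued.v _ < (γ : x.Γ₀)
  change x.v a < γ at ha
  rw [locToResidue_algebraMap, map_mul, x.v_toResidue]
  exact (mul_le_of_le_one_left' (ρ.v_locToResidue_le_one hx hd)).trans_lt ha

/-- The evaluation `f ↦ f(x)` from `A⟨T/s⟩` to the completed residue field of a point `x` of the
rational subset: the continuous extension of `A → Frac(A / supp x)`. -/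
def eval {x : Spa A} (hx : x ∈ ρ.subset) : ρ.Compl →+* x.ComplResidue :=
  UniformSpace.Completion.mapRingHom (ρ.locToResidue hx) (ρ.continuous_locToResidue hx)

theorem continuous_eval {x : Spa A} (hx : x ∈ ρ.subset) : Continuous (ρ.eval hx) :=
  UniformSpace.Completion.continuous_map

theorem eval_toCompl {x : Spa A} (hx : x ∈ ρ.subset) (a : A) :
    ρ.eval hx (ρ.toCompl a) = (x.toResidue a : x.ComplResidue) := by
  rw [← ρ.locToResidue_algebraMap hx]
  exact UniformSpace.Completion.mapRingHom_coe (ρ.continuous_locToResidue hx) _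

theorem eval_comp {ρ ρ' : RatData A} {x : Spa A} (hx : x ∈ ρ.subset) (hx' : x ∈ ρ'.subset)
    {φ : ρ.Compl →+* ρ'.Compl} (hφ : Continuous φ) (h : φ.comp ρ.toCompl = ρ'.toCompl)
    (f : ρ.Compl) : ρ'.eval hx' (φ f) = ρ.eval hx f := by
  have : (ρ'.eval hx').comp φ = ρ.eval hx := by
    refine hom_ext ρ ((ρ'.continuous_eval hx').comp hφ) (ρ.continuous_eval hx) ?_
    rw [RingHom.comp_assoc, h]
    ext a
    exact (ρ'.eval_toCompl hx' a).trans (ρ.eval_toCompl hx a).symm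
  exact RingHom.congr_fun this f

/-! #### Rational subsets form a basis -/

theorem isOpen_subset : IsOpen ρ.subset := by
  have : ρ.subset = {x : Spa A | x.rel.vle 0 ρ.s ∧ ¬ x.rel.vle ρ.s 0} ∩
      ⋂ t ∈ ρ.T, {x | x.rel.vle t ρ.s ∧ ¬ x.rel.vle ρ.s 0} := by
    ext x
    have h0 : x.rel.vle 0 ρ.s := by rw [← x.v_le_iff, map_zero]; exact zero_le
    simp only [subset, Set.mem_inter_iff, Set.mem_iInter, Set.mem_ofPred_eq]
    grind
  rw [this]
  exact (Spa.isOpen_setOf_vle _ _).inter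
    (isOpen_biInter_finset fun t _ => Spa.isOpen_setOf_vle _ _)

/-- The rational subset as an open subset. -/
def opens : Opens (Spa A) := ⟨ρ.subset, ρ.isOpen_subset⟩

open Classical in
/-- A rational datum defining the intersection of two rational subsets. -/
def inter (ρ ρ' : RatData A) : RatData A where
  T := Finset.image₂ (· * ·) (insert ρ.s ρ.T) (insert ρ'.s ρ'.T)
  s := ρ.s * ρ'.s
  isOpen_span := by
    obtain ⟨V, hV⟩ := exists_subset_closure_mul (ρ.T : Set A) ρ.isOpen_span
      ⟨(Ideal.span (ρ'.T : Set A)).toAddSubgroup, ρ'.isOpen_span⟩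
    refine isOpen_ideal_of_subset (H := V.toAddSubgroup) V.isOpen ?_
    refine (show (V : Set A) ⊆ _ from hV).trans ?_
    intro a ha
    refine (AddSubgroup.closure_le (K := (Ideal.span (α := A) _).toAddSubgroup)).2 ?_ ha
    rintro _ ⟨t, ht, u, hu, rfl⟩
    change u ∈ Ideal.span (ρ'.T : Set A) at hu
    change t * u ∈ Ideal.span _
    induction hu using Submodule.span_induction with
    | mem t' ht' =>
      refine Ideal.subset_span (Finset.mem_coe.2 (Finset.mem_image₂_of_mem ?_ ?_))
      · exact Finset.mem_insert_of_mem ht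
      · exact Finset.mem_insert_of_mem ht'
    | zero => simp
    | add a b _ _ ha hb => rw [mul_add]; exact add_mem ha hb
    | smul c a _ ha =>
      rw [smul_eq_mul, mul_left_comm]
      exact Ideal.mul_mem_left _ _ ha

theorem mul_mem_T_inter {ρ ρ' : RatData A} {t t' : A} (ht : t = ρ.s ∨ t ∈ ρ.T)
    (ht' : t' = ρ'.s ∨ t' ∈ ρ'.T) : t * t' ∈ (inter ρ ρ').T := by
  classical
  exact Finset.mem_image₂_of_mem (Finset.mem_insert.2 ht) (Finset.mem_insert.2 ht')

theorem subset_inter (ρ ρ' : RatData A) : (inter ρ ρ').subset = ρ.subset ∩ ρ'.subset := by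
  ext x
  simp only [subset, Set.mem_inter_iff, Set.mem_ofPred_eq, ← x.v_le_iff, map_zero, le_zero_iff]
  constructor
  · rintro ⟨h, h0⟩
    change x.v (ρ.s * ρ'.s) ≠ 0 at h0
    rw [map_mul, mul_ne_zero_iff] at h0
    refine ⟨⟨fun t ht => ?_, h0.1⟩, fun t ht => ?_, h0.2⟩
    · have := h (t * ρ'.s) (mul_mem_T_inter (.inr ht) (.inl rfl))
      change x.v _ ≤ x.v (ρ.s * ρ'.s) at this
      rw [map_mul, map_mul] at this
      exact le_of_mul_le_mul_right this (zero_lt_iff.2 h0.2)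
    · have := h (ρ.s * t) (mul_mem_T_inter (.inl rfl) (.inr ht))
      change x.v _ ≤ x.v (ρ.s * ρ'.s) at this
      rw [map_mul, map_mul] at this
      exact le_of_mul_le_mul_left this (zero_lt_iff.2 h0.1)
  · rintro ⟨⟨h, h0⟩, h', h0'⟩
    refine ⟨fun t ht => ?_, ?_⟩
    · classical
      obtain ⟨a, ha, b, hb, rfl⟩ := Finset.mem_image₂.1 ht
      change x.v (a * b) ≤ x.v (ρ.s * ρ'.s)
      rw [map_mul, map_mul]
      gcongr
      · rcases Finset.mem_insert.1 ha with rfl | ha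
        exacts [le_rfl, h a ha]
      · rcases Finset.mem_insert.1 hb with rfl | hb
        exacts [le_rfl, h' b hb]
    · change x.v (ρ.s * ρ'.s) ≠ 0
      rw [map_mul]
      exact mul_ne_zero h0 h0'

/-- The rational datum defining the whole space. -/
def univ (A : HuberPair.{u}) : RatData A where
  T := {1}
  s := 1
  isOpen_span := by simp

theorem subset_univ : (univ A).subset = Set.univ := by
  ext x
  simp [subset, univ]

theorem exists_mem_subset {x : Spa A} {W : Set (Spa A)} (hW : IsOpen W) (hx : x ∈ W) :
    ∃ ρ : RatData A, x ∈ ρ.subset ∧ ρ.subset ⊆ W := by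
  classical
  induction hW with
  | basic W hW =>
    obtain ⟨f, s, rfl⟩ := hW
    have hs : x.v s ≠ 0 := fun h => hx.2 (x.v_eq_zero_iff.1 h)
    obtain ⟨J, hJ, hJs, hG⟩ := exists_basis_nhds_zero A
    obtain ⟨n, hn⟩ := hJs _ ((x.isOpen_v_lt hs).mem_nhds
      (by simpa [zero_lt_iff] using hs))
    obtain ⟨G, hGn, hGs, -⟩ := hG n
    refine ⟨⟨insert f G, s, ?_⟩, ⟨fun t ht => ?_, hx.2⟩, fun y hy => ⟨hy.1 f (by simp), hy.2⟩⟩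
    · refine isOpen_ideal_of_subset (hJ n) ?_
      intro a ha
      exact Ideal.span_mono (by simp) (hGs ha)
    · rcases Finset.mem_insert.1 ht with rfl | ht
      · exact hx.1
      · exact x.v_le_iff.1 (le_of_lt (hn (hGn ht)))
  | univ => exact ⟨univ A, by simp [subset_univ], by simp⟩
  | inter U V _ _ hU hV =>
    obtain ⟨ρ, h, h'⟩ := hU hx.1
    obtain ⟨ρ', k, k'⟩ := hV hx.2
    refine ⟨inter ρ ρ', ?_, ?_⟩ <;> rw [subset_inter]
    exacts [⟨h, k⟩, Set.inter_subset_inter h' k']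
  | sUnion S _ hS =>
    obtain ⟨U, hU, hxU⟩ := hx
    obtain ⟨ρ, h, h'⟩ := hS U hU hxU
    exact ⟨ρ, h, h'.trans (Set.subset_sUnion_of_mem hU)⟩

/-! #### Restriction to the intersection of two rational subsets -/

theorem exists_hom_of_forall {ρ ρ' : RatData A} (b : A) (hs : ρ'.s = ρ.s * b)
    (hT : ∀ t ∈ ρ.T, t * b ∈ ρ'.T) :
    ∃ φ : ρ.Compl →+* ρ'.Compl, Continuous φ ∧ φ.comp ρ.toCompl = ρ'.toCompl := by
  have hinv : algebraMap A ρ'.Loc ρ.s * (algebraMap A ρ'.Loc b * ρ'.sInv) = 1 := by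
    rw [← mul_assoc, ← map_mul, ← hs, s_mul_sInv]
  let ψ : ρ.Loc →+* ρ'.Loc :=
    IsLocalization.Away.lift ρ.s (g := algebraMap A ρ'.Loc) (IsUnit.of_mul_eq_one _ hinv)
  have hψ : ∀ a, ψ (algebraMap A ρ.Loc a) = algebraMap A ρ'.Loc a :=
    fun a => IsLocalization.Away.lift_eq _ _ _
  have hψs : ψ ρ.sInv = algebraMap A ρ'.Loc b * ρ'.sInv := by
    have h1 : algebraMap A ρ'.Loc ρ.s * ψ ρ.sInv = 1 := by
      rw [← hψ, ← map_mul, s_mul_sInv, map_one]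
    calc ψ ρ.sInv = ψ ρ.sInv * (algebraMap A ρ'.Loc ρ.s *
          (algebraMap A ρ'.Loc b * ρ'.sInv)) := by rw [hinv, mul_one]
      _ = (algebraMap A ρ'.Loc ρ.s * ψ ρ.sInv) * (algebraMap A ρ'.Loc b * ρ'.sInv) := by ring
      _ = _ := by rw [h1, one_mul]
  have hD : ρ.fracSubring ≤ ρ'.fracSubring.comap ψ := by
    refine Subring.closure_le.2 ?_
    rintro _ ⟨t, ht, rfl⟩
    change ψ (algebraMap A ρ.Loc t * ρ.sInv) ∈ ρ'.fracSubring
    rw [map_mul, hψ, hψs, ← mul_assoc, ← map_mul]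
    exact Subring.subset_closure ⟨t * b, hT t ht, rfl⟩
  have hcont : Continuous ψ := by
    refine continuous_of_forall ψ fun W hW => ?_
    obtain ⟨U, -, hU⟩ := ρ'.hasBasis_nhds_zero.mem_iff.1 hW
    refine ⟨ρ'.basicSubgroup U, hU, U, fun d hd a ha => ?_⟩
    rw [hψ]
    exact mul_mem_basicSubgroup (hD hd) ha
  refine ⟨UniformSpace.Completion.mapRingHom ψ hcont, UniformSpace.Completion.continuous_map, ?_⟩
  ext a
  change UniformSpace.Completion.mapRingHom ψ hcont (algebraMap A ρ.Loc a : ρ.Compl) = _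
  rw [UniformSpace.Completion.mapRingHom_coe, hψ]
  rfl

theorem exists_hom_inter_left (ρ ρ' : RatData A) :
    ∃ φ : ρ.Compl →+* (inter ρ ρ').Compl,
      Continuous φ ∧ φ.comp ρ.toCompl = (inter ρ ρ').toCompl :=
  exists_hom_of_forall ρ'.s rfl fun _ ht => mul_mem_T_inter (.inr ht) (.inl rfl)

theorem exists_hom_inter_right (ρ ρ' : RatData A) :
    ∃ φ : ρ'.Compl →+* (inter ρ ρ').Compl,
      Continuous φ ∧ φ.comp ρ'.toCompl = (inter ρ ρ').toCompl :=
  exists_hom_of_forall ρ.s (mul_comm _ _) fun t ht => by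
    rw [mul_comm]; exact mul_mem_T_inter (.inl rfl) (.inr ht)

end RatData

section Stalk

variable {X : TopCat.{u}} (F : TopCat.Presheaf CommRingCat.{u} X) (x : X) (R : CommRingCat.{u})
  (φ : ∀ U : Opens X, x ∈ U → (F.obj (op U) ⟶ R))
  (h : ∀ (U V : Opens X) (i : U ⟶ V) (hx : x ∈ U), F.map i.op ≫ φ U hx = φ V (i.le hx))

/-- The cocone on the diagram defining a stalk given by compatible morphisms `φ`. -/
def stalkCocone : Limits.Cocone ((OpenNhds.inclusion x).op ⋙ F) where
  pt := R
  ι :=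
    { app := fun W => φ W.unop.1 W.unop.2
      naturality := fun V W i =>
        (h W.unop.1 V.unop.1 ((OpenNhds.inclusion x).map i.unop) W.unop.2).trans
          (Category.comp_id _).symm }

/-- The morphism from a stalk given by compatible morphisms `φ` from the rings of sections. -/
def stalkDesc : F.stalk x ⟶ R :=
  Limits.colimit.desc ((OpenNhds.inclusion x).op ⋙ F) (stalkCocone F x R φ h)

theorem germ_stalkDesc (U : Opens X) (hx : x ∈ U) :
    F.germ U x hx ≫ stalkDesc F x R φ h = φ U hx :=
  Limits.colimit.ι_desc (stalkCocone F x R φ h) (op (⟨U, hx⟩ : OpenNhds x))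

end Stalk

/-! ### The structure presheaf of `Spa(A, A⁺)` -/

namespace Spa

variable {A : HuberPair.{u}}

/-- The index set of the limit defining `𝒪(W)`: rational data whose rational subset is contained
in `W`. -/
abbrev RatIn (W : Opens (Spa A)) : Type u := {ρ : RatData A // ρ.opens ≤ W}

/-- `𝒪(W)` is the limit of the rings `A⟨T/s⟩` over the rational subsets contained in `W`. The
transition map for an inclusion of rational subsets is the continuous homomorphism
`A⟨T/s⟩ → A⟨T'/s'⟩` under `A` (there is at most one). -/
def sections (W : Opens (Spa A)) : Subring (∀ ρ : RatIn W, ρ.1.Compl) where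
  carrier := {f | ∀ (ρ ρ' : RatIn W) (φ : ρ.1.Compl →+* ρ'.1.Compl), ρ'.1.opens ≤ ρ.1.opens →
    Continuous φ → φ.comp ρ.1.toCompl = ρ'.1.toCompl → φ (f ρ) = f ρ'}
  mul_mem' hf hg ρ ρ' φ h hφ hφ' := by
    rw [Pi.mul_apply, Pi.mul_apply, map_mul, hf ρ ρ' φ h hφ hφ', hg ρ ρ' φ h hφ hφ']
  one_mem' ρ ρ' φ _ _ _ := map_one φ
  add_mem' hf hg ρ ρ' φ h hφ hφ' := by
    rw [Pi.add_apply, Pi.add_apply, map_add, hf ρ ρ' φ h hφ hφ', hg ρ ρ' φ h hφ hφ']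
  zero_mem' ρ ρ' φ _ _ _ := map_zero φ
  neg_mem' hf ρ ρ' φ h hφ hφ' := by
    rw [Pi.neg_apply, Pi.neg_apply, map_neg, hf ρ ρ' φ h hφ hφ']

/-- Restriction of sections. -/
def restrictSections {V W : Opens (Spa A)} (h : V ≤ W) : sections W →+* sections V where
  toFun f := ⟨fun ρ => f.1 ⟨ρ.1, ρ.2.trans h⟩, fun ρ ρ' φ hρ hφ hφ' =>
    f.2 ⟨ρ.1, ρ.2.trans h⟩ ⟨ρ'.1, ρ'.2.trans h⟩ φ hρ hφ hφ'⟩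
  map_one' := rfl
  map_mul' _ _ := rfl
  map_zero' := rfl
  map_add' _ _ := rfl

theorem continuous_restrictSections {V W : Opens (Spa A)} (h : V ≤ W) :
    Continuous (restrictSections h) :=
  Continuous.subtype_mk (p := (· ∈ sections V))
    (f := fun f : sections W => fun ρ : RatIn V => f.1 ⟨ρ.1, ρ.2.trans h⟩)
    (continuous_pi fun _ => (continuous_apply _).comp continuous_subtype_val) _

variable (A) in
/-- The structure presheaf, as a presheaf of rings. -/
def structurePresheaf : TopCat.Presheaf CommRingCat.{u} (TopCat.of (Spa A)) where
  obj W := CommRingCat.of (sections W.unop)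
  map i := CommRingCat.ofHom (restrictSections i.unop.le)

/-- A rational neighbourhood of `x` in an open subset `W` containing `x`. -/
theorem exists_ratIn {W : Opens (Spa A)} {x : Spa A} (hx : x ∈ W) :
    ∃ ρ : RatIn W, x ∈ ρ.1.subset :=
  let ⟨ρ, h, h'⟩ := RatData.exists_mem_subset W.isOpen hx
  ⟨⟨ρ, h'⟩, h⟩

/-- The evaluation `f ↦ f(x)` of sections over a neighbourhood of `x`, with values in the
completed residue field of `x`. -/
def evalSections {W : Opens (Spa A)} {x : Spa A} (hx : x ∈ W) : sections W →+* x.ComplResidue :=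
  ((exists_ratIn hx).choose.1.eval (exists_ratIn hx).choose_spec).comp
    ((Pi.evalRingHom _ (exists_ratIn hx).choose).comp (sections W).subtype)

/-- The value `f(x)` may be computed on any rational neighbourhood of `x`. -/
theorem evalSections_eq {W : Opens (Spa A)} {x : Spa A} (hx : x ∈ W) (f : sections W)
    (ρ : RatIn W) (hρ : x ∈ ρ.1.subset) : evalSections hx f = ρ.1.eval hρ (f.1 ρ) := by
  set σ := (exists_ratIn hx).choose with hσ
  have hσx : x ∈ σ.1.subset := (exists_ratIn hx).choose_spec
  change σ.1.eval hσx (f.1 σ) = _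
  have hle : (RatData.inter ρ.1 σ.1).opens ≤ ρ.1.opens := by
    intro y hy
    exact ((RatData.subset_inter ρ.1 σ.1).subset hy).1
  have hle' : (RatData.inter ρ.1 σ.1).opens ≤ σ.1.opens := by
    intro y hy
    exact ((RatData.subset_inter ρ.1 σ.1).subset hy).2
  let τ : RatIn W := ⟨RatData.inter ρ.1 σ.1, hle.trans ρ.2⟩
  have hτ : x ∈ τ.1.subset := (RatData.subset_inter ρ.1 σ.1).superset ⟨hρ, hσx⟩
  obtain ⟨φ, hφ, hφ'⟩ := RatData.exists_hom_inter_left ρ.1 σ.1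
  obtain ⟨ψ, hψ, hψ'⟩ := RatData.exists_hom_inter_right ρ.1 σ.1
  rw [← RatData.eval_comp hρ hτ hφ hφ', ← RatData.eval_comp hσx hτ hψ hψ',
    f.2 ρ τ φ hle hφ hφ', f.2 σ τ ψ hle' hψ hψ']

theorem evalSections_restrict {V W : Opens (Spa A)} (h : V ≤ W) {x : Spa A} (hx : x ∈ V)
    (f : sections W) : evalSections hx (restrictSections h f) = evalSections (h hx) f := by
  obtain ⟨ρ, hρ⟩ := exists_ratIn hx
  rw [evalSections_eq hx _ ρ hρ, evalSections_eq (h hx) _ ⟨ρ.1, ρ.2.trans h⟩ hρ]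
  rfl

/-- The evaluation of germs at `x`. -/
def evalStalk (x : TopCat.of (Spa A)) :
    (structurePresheaf A).stalk x ⟶ CommRingCat.of (ComplResidue x) :=
  stalkDesc (structurePresheaf A) x _ (fun _ hx => CommRingCat.ofHom (evalSections hx))
    fun V W i hx => by
      ext f
      exact evalSections_restrict i.le hx f

theorem evalStalk_germ (x : TopCat.of (Spa A)) (W : Opens (TopCat.of (Spa A))) (hx : x ∈ W) (f : sections W) :
    evalStalk x ((structurePresheaf A).germ W x hx f) =
      evalSections hx f := by
  have : (structurePresheaf A).germ W x hx ≫ evalStalk x = CommRingCat.ofHom (evalSections hx) :=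
    germ_stalkDesc _ _ _ _ _ W hx
  exact ConcreteCategory.congr_hom this f

/-- The valuation `f ↦ |f(x)|` on the stalk at `x`. -/
def stalkVal (x : TopCat.of (Spa A)) :
    Valuation ((structurePresheaf A).stalk x) (Γ₀ x) :=
  (complVal x).comap (evalStalk x).hom

end Spa

/-! ### Adic spaces -/

/-- The valuation (up to equivalence) obtained by pulling back along a ring homomorphism. -/
abbrev comapRel {R S : Type u} [CommRing R] [CommRing S] (φ : R →+* S) (r : ValuativeRel S) :
    ValuativeRel R where
  vle a b := r.vle (φ a) (φ b)
  vle_total a b := r.vle_total _ _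
  vle_trans := r.vle_trans
  vle_add h h' := by rw [map_add]; exact r.vle_add h h'
  mul_vle_mul_left h z := by rw [map_mul, map_mul]; exact r.mul_vle_mul_left h _
  vle_mul_cancel h h' := by
    rw [map_zero] at h
    rw [map_mul, map_mul] at h'
    exact r.vle_mul_cancel h h'
  not_vle_one_zero := by rw [map_one, map_zero]; exact r.not_vle_one_zero
  vle_mul_comm {a b} := by rw [map_mul, map_mul]; exact r.vle_mul_comm

/-- A topological space with a presheaf of topological rings and, for each point, a valuation (up
to equivalence) on the stalk. -/
structure PreAdicSpace : Type (u + 1) extends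
    AlgebraicGeometry.PresheafedSpace.{u, u + 1, u} CommRingCat.{u} where
  topology (U : Opens carrier) : TopologicalSpace (presheaf.obj (op U))
  isTopologicalRing (U : Opens carrier) : IsTopologicalRing (presheaf.obj (op U))
  continuous_map {U V : Opens carrier} (i : U ⟶ V) : Continuous (presheaf.map i.op)
  val (x : carrier) : ValuativeRel (presheaf.stalk x)

namespace PreAdicSpace

attribute [instance] topology isTopologicalRing

instance : CoeSort PreAdicSpace.{u} (Type u) := ⟨fun X => X.carrier⟩

/-- A morphism: a continuous map `f : X → Y` with a morphism `𝒪_Y → f_* 𝒪_X` of presheaves of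
topological rings which is compatible with the valuations on the stalks. -/
structure Hom (X Y : PreAdicSpace.{u}) : Type u extends
    X.toPresheafedSpace.Hom Y.toPresheafedSpace where
  continuous_app (V : Opens Y) :
    @Continuous _ _ (Y.topology V) (X.topology ((Opens.map toHom.base).obj V))
      (toHom.c.app (op V))
  comap_val (x : X) : comapRel (toHom.stalkMap x).hom (X.val x) = Y.val (toHom.base x)

theorem Hom.ext {X Y : PreAdicSpace.{u}} {f g : Hom X Y} (h : f.toHom = g.toHom) : f = g := by
  cases f; cases g; cases h; rfl

/-- The identity morphism. -/
def Hom.id (X : PreAdicSpace.{u}) : Hom X X where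
  toHom := 𝟙 X.toPresheafedSpace
  continuous_app V := by
    have h : ((𝟙 X.toPresheafedSpace :) : X.toPresheafedSpace ⟶ X.toPresheafedSpace).c.app (op V) =
        X.presheaf.map (𝟙 V).op := by
      simp
      rfl
    exact h ▸ X.continuous_map (𝟙 V)
  comap_val x := by
    rw [AlgebraicGeometry.PresheafedSpace.stalkMap.id]
    rfl

/-- Composition of morphisms. -/
def Hom.comp {X Y Z : PreAdicSpace.{u}} (f : Hom X Y) (g : Hom Y Z) : Hom X Z where
  toHom := CategoryStruct.comp (obj := AlgebraicGeometry.PresheafedSpace CommRingCat.{u})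
    f.toHom g.toHom
  continuous_app V :=
    (f.continuous_app ((Opens.map g.base).obj V)).comp (g.continuous_app V)
  comap_val x := by
    rw [AlgebraicGeometry.PresheafedSpace.stalkMap.comp]
    refine Eq.trans ?_ (g.comap_val (f.base x))
    rw [← f.comap_val x]
    rfl

instance : Category PreAdicSpace.{u} where
  Hom := Hom
  id := Hom.id
  comp := Hom.comp
  id_comp f := Hom.ext
    (Category.id_comp (obj := AlgebraicGeometry.PresheafedSpace CommRingCat.{u}) f.toHom)
  comp_id f := Hom.ext
    (Category.comp_id (obj := AlgebraicGeometry.PresheafedSpace CommRingCat.{u}) f.toHom)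
  assoc f g h := Hom.ext
    (Category.assoc (obj := AlgebraicGeometry.PresheafedSpace CommRingCat.{u})
      f.toHom g.toHom h.toHom)

/-- `Spa(A, A⁺)` with its structure presheaf and valuations. -/
def ofHuberPair (A : HuberPair.{u}) : PreAdicSpace.{u} where
  carrier := TopCat.of (Spa A)
  presheaf := Spa.structurePresheaf A
  topology U := inferInstanceAs (TopologicalSpace (Spa.sections U))
  isTopologicalRing U := inferInstanceAs (IsTopologicalRing (Spa.sections U))
  continuous_map i := Spa.continuous_restrictSections i.le
  val x := ValuativeRel.ofValuation (Spa.stalkVal x)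

/-- The restriction to an open subset. -/
def restrictOpen (X : PreAdicSpace.{u}) (U : Opens X) : PreAdicSpace.{u} where
  toPresheafedSpace := X.toPresheafedSpace.restrict U.isOpenEmbedding
  topology _ := X.topology _
  isTopologicalRing _ := X.isTopologicalRing _
  continuous_map _ := X.continuous_map _
  val (x : U) :=
    comapRel (X.toPresheafedSpace.restrictStalkIso U.isOpenEmbedding x).hom.hom (X.val x.1)

end PreAdicSpace

/-- A presheaf of topological rings is a sheaf of topological rings if it is a sheaf of rings and
the topology of the sections over a union is the one induced by the restrictions. -/
structure PreAdicSpace.IsSheaf (X : PreAdicSpace.{u}) : Prop where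
  isSheaf : X.presheaf.IsSheaf
  topology_iSup {ι : Type u} (U : ι → Opens X) : X.topology (iSup U) =
    ⨅ i, (X.topology (U i)).induced (X.presheaf.map (Opens.leSupr U i).op)

/-- An adic space: a topological space with a sheaf of topological rings and valuations on the
stalks which is locally isomorphic to `Spa(A, A⁺)` for Huber pairs `(A, A⁺)`. (Such pairs are
automatically sheafy.) -/
structure AdicSpace : Type (u + 1) extends PreAdicSpace.{u} where
  isSheaf : toPreAdicSpace.IsSheaf
  exists_affinoid (x : carrier) : ∃ (U : Opens carrier) (A : HuberPair.{u}), x ∈ U ∧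
    Nonempty (toPreAdicSpace.restrictOpen U ≅ PreAdicSpace.ofHuberPair A)

namespace AdicSpace

/-- Morphisms of adic spaces. -/
abbrev Hom (Y X : AdicSpace.{u}) : Type u := PreAdicSpace.Hom Y.toPreAdicSpace X.toPreAdicSpace

/-- The subring `𝒪⁺(U)` of the sections `f ∈ 𝒪(U)` with `|f(x)| ≤ 1` for all `x ∈ U`. -/
def plus (X : AdicSpace.{u}) (U : Opens X.carrier) : Subring (X.presheaf.obj (op U)) where
  carrier := {f | ∀ (x : X.carrier) (hx : x ∈ U), (X.val x).vle (X.presheaf.germ U x hx f) 1}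
  mul_mem' {f g} hf hg x hx := by
    rw [map_mul]
    refine (X.val x).vle_trans ((X.val x).mul_vle_mul_left (hf x hx) _) ?_
    rw [one_mul]
    exact hg x hx
  one_mem' x hx := by
    rw [map_one]
    exact ((X.val x).vle_total 1 1).elim id id
  add_mem' {f g} hf hg x hx := by
    rw [map_add]
    exact (X.val x).vle_add (hf x hx) (hg x hx)
  zero_mem' x hx := by
    rw [map_zero]
    exact ((X.val x).vle_total 0 1).resolve_right (X.val x).not_vle_one_zero
  neg_mem' {f} hf x hx := by
    let _ := X.val x
    rw [map_neg]
    have h := hf x hx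
    change ValuativeRel.vle _ _ at h ⊢
    rw [Valuation.Compatible.vle_iff_le (v := ValuativeRel.valuation _)] at h ⊢
    rwa [Valuation.map_neg]

/-- An open subset `U` is affinoid if it is isomorphic to `Spa(A, A⁺)` for a complete Huber pair
`(A, A⁺)`; the latter is then `(𝒪(U), 𝒪⁺(U))`. -/
def IsAffinoidOpen (X : AdicSpace.{u}) (U : Opens X.carrier) : Prop :=
  ∃ A : HuberPair.{u}, A.IsComplete ∧
    Nonempty (X.toPreAdicSpace.restrictOpen U ≅ PreAdicSpace.ofHuberPair A)

variable {X Y : AdicSpace.{u}} (f : Hom Y X)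

/-- The homomorphism `𝒪_X(V) → 𝒪_Y(f⁻¹ V)`. -/
def Hom.appHom (V : Opens X.carrier) :
    X.presheaf.obj (op V) →+* Y.presheaf.obj (op ((Opens.map f.base).obj V)) :=
  (f.c.app (op V)).hom

/-- `V` and `f⁻¹ V` are affinoid, and
`(𝒪_X(V), 𝒪_X⁺(V)) → (𝒪_Y(f⁻¹ V), 𝒪_Y⁺(f⁻¹ V))` is a finite étale morphism of Huber pairs of
constant rank `d`: the ring homomorphism is finite étale of rank `d`, the target has the natural
topology of a finite module over the source, and `𝒪_Y⁺(f⁻¹ V)` is the integral closure of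
`𝒪_X⁺(V)` in `𝒪_Y(f⁻¹ V)`. -/
structure IsFiniteEtaleOver (V : Opens X.carrier) (d : ℕ) : Prop where
  isAffinoidOpen : X.IsAffinoidOpen V
  isAffinoidOpen_preimage : Y.IsAffinoidOpen ((Opens.map f.base).obj V)
  finite : (f.appHom V).Finite
  etale : (f.appHom V).Etale
  rank : letI := (f.appHom V).toAlgebra
    ∀ p : PrimeSpectrum (X.presheaf.obj (op V)),
      Module.rankAtStalk (Y.presheaf.obj (op ((Opens.map f.base).obj V))) p = d
  isModuleTopology : letI := (f.appHom V).toAlgebra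
    IsModuleTopology (X.presheaf.obj (op V)) (Y.presheaf.obj (op ((Opens.map f.base).obj V)))
  mem_plus_iff (b) : b ∈ Y.plus ((Opens.map f.base).obj V) ↔
    ((f.appHom V).comp (X.plus V).subtype).IsIntegralElem b

/-- `f : Y → X` is finite étale of degree `d`: there is a cover of `X` by affinoid open subsets `V`
such that `f⁻¹ V` is affinoid and finite étale of rank `d` over `V`. -/
def IsFiniteEtaleOfDegree (d : ℕ) : Prop :=
  ∀ x : X.carrier, ∃ V : Opens X.carrier, x ∈ V ∧ IsFiniteEtaleOver f V d

/-! ### Sheaves of modules on adic spaces -/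

/-- The structure sheaf. -/
abbrev sheaf (X : AdicSpace.{u}) : TopCat.Sheaf CommRingCat.{u} X.carrier :=
  ⟨X.presheaf, X.isSheaf.isSheaf⟩

/-- The structure sheaf as a sheaf of (not necessarily commutative) rings. -/
abbrev ringCatSheaf (X : AdicSpace.{u}) : TopCat.Sheaf RingCat.{u} X.carrier :=
  (sheafCompose (Opens.grothendieckTopology X.carrier) (forget₂ CommRingCat RingCat)).obj X.sheaf

/-- The category of `𝒪_X`-modules. -/
abbrev Modules (X : AdicSpace.{u}) := SheafOfModules.{u} X.ringCatSheaf

/-- The morphism `𝒪_X → f_* 𝒪_Y`. -/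
def Hom.toRingCatSheafHom : X.ringCatSheaf ⟶
    ((Opens.map f.base).sheafPushforwardContinuous _ _ _).obj Y.ringCatSheaf where
  hom := Functor.whiskerRight f.c _

/-- The structure sheaf as a module over itself. -/
abbrev structureModule (X : AdicSpace.{u}) : X.Modules := SheafOfModules.unit X.ringCatSheaf

/-- The `𝒪_X`-module `f_* 𝒪_Y`. -/
def pushforwardStructure : X.Modules :=
  (SheafOfModules.pushforward (Hom.toRingCatSheafHom f)).obj Y.structureModule

/-- The sheaf of modules associated with a presheaf of modules. -/
abbrev sheafify (M : PresheafOfModules.{u} (X.presheaf ⋙ forget₂ CommRingCat RingCat)) :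
    X.Modules :=
  (PresheafOfModules.sheafification (R := X.ringCatSheaf) (𝟙 X.ringCatSheaf.obj)).obj M

/-- The underlying presheaf of modules. -/
abbrev Modules.toPresheaf (M : X.Modules) :
    PresheafOfModules.{u} (X.presheaf ⋙ forget₂ CommRingCat RingCat) := M.val

/-- The tensor product of `𝒪_X`-modules, the sheaf associated with
`U ↦ M(U) ⊗ N(U)`. -/
def tensor (M N : X.Modules) : X.Modules :=
  sheafify (MonoidalCategory.tensorObj (Modules.toPresheaf M) (Modules.toPresheaf N))

end AdicSpace

/-! ### Exterior powers -/

section ExteriorPower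

variable {R S : Type u} [CommRing R] [CommRing S] (σ : R →+* S) {M N : Type u} [AddCommGroup M]
  [AddCommGroup N] [Module R M] [Module S N] (g : M →ₛₗ[σ] N) (n : ℕ)

/-- The map induced on exterior powers by a semilinear map:
`m₁ ∧ ⋯ ∧ mₙ ↦ g m₁ ∧ ⋯ ∧ g mₙ`. -/
def exteriorPowerMap : ⋀[R]^n M →ₛₗ[σ] ⋀[S]^n N :=
  letI : Module R (⋀[S]^n N) := Module.compHom _ σ
  let φ : M [⋀^Fin n]→ₗ[R] ⋀[S]^n N :=
    { toFun := fun m => exteriorPower.ιMulti S n (fun i => g (m i))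
      map_update_add' := fun m i x y => by
        classical
        have h : ∀ z, (fun j => g (Function.update m i z j)) =
            Function.update (fun j => g (m j)) i (g z) := fun z => by
          ext j; by_cases hj : j = i
          · subst hj; simp
          · simp [hj]
        have := (exteriorPower.ιMulti S n (M := N)).map_update_add (fun j => g (m j)) i (g x) (g y)
        rw [← map_add, ← h, ← h, ← h] at this
        convert this
      map_update_smul' := fun m i c x => by
        classical
        have h : ∀ z, (fun j => g (Function.update m i z j)) =
            Function.update (fun j => g (m j)) i (g z) := fun z => by
          ext j; by_cases hj : j = i
          · subst hj; simp
          · simp [hj]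
        have := (exteriorPower.ιMulti S n (M := N)).map_update_smul (fun j => g (m j)) i (σ c) (g x)
        rw [← map_smulₛₗ, ← h, ← h] at this
        convert this
        rfl
      map_eq_zero_of_eq' := fun m i j h hij =>
        (exteriorPower.ιMulti S n (M := N)).map_eq_zero_of_eq _ (congrArg g h) hij }
  let ψ : ⋀[R]^n M →ₗ[R] ⋀[S]^n N := exteriorPower.alternatingMapLinearEquiv φ
  { toFun := ψ
    map_add' := map_add ψ
    map_smul' := fun c x => ψ.map_smul c x }

theorem exteriorPowerMap_ιMulti (m : Fin n → M) :
    exteriorPowerMap σ g n (exteriorPower.ιMulti R n m) =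
      exteriorPower.ιMulti S n (fun i => g (m i)) := by
  let _ : Module R (⋀[S]^n N) := Module.compHom _ σ
  exact exteriorPower.alternatingMapLinearEquiv_apply_ιMulti _ m

theorem exteriorPower_induction {P : ⋀[R]^n M → Prop} (h0 : P 0)
    (hadd : ∀ x y, P x → P y → P (x + y)) (hsmul : ∀ (c : R) x, P x → P (c • x))
    (h : ∀ m, P (exteriorPower.ιMulti R n m)) (x : ⋀[R]^n M) : P x := by
  have hx : x ∈ Submodule.span R (Set.range (exteriorPower.ιMulti R n (M := M))) := by
    rw [exteriorPower.ιMulti_span]; trivial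
  induction hx using Submodule.span_induction with
  | mem x hx => obtain ⟨m, rfl⟩ := hx; exact h m
  | zero => exact h0
  | add x y _ _ hx hy => exact hadd x y hx hy
  | smul c x _ hx => exact hsmul c x hx

end ExteriorPower

/-- The presheaf of modules `U ↦ ⋀ⁿ M(U)`. -/
def presheafExteriorPower {C : Type u} [Category.{u} C] {R : Cᵒᵖ ⥤ CommRingCat.{u}}
    (M : PresheafOfModules.{u} (R ⋙ forget₂ CommRingCat RingCat)) (n : ℕ) :
    PresheafOfModules.{u} (R ⋙ forget₂ CommRingCat RingCat) where
  obj U := ModuleCat.of (R.obj U) (⋀[R.obj U]^n (M.obj U))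
  map {U V} i := ModuleCat.ofHom
    (Y := (ModuleCat.restrictScalars (R.map i).hom).obj
      (ModuleCat.of (R.obj V) (⋀[R.obj V]^n (M.obj V))))
    { toFun := exteriorPowerMap (R.map i).hom (M.restrictₛₗ i) n
      map_add' := map_add _
      map_smul' := fun c x => map_smulₛₗ (exteriorPowerMap (R.map i).hom (M.restrictₛₗ i) n) c x }
  map_id U := by
    refine ModuleCat.hom_ext (LinearMap.ext fun x => ?_)
    change exteriorPowerMap (R.map (𝟙 U)).hom (M.restrictₛₗ (𝟙 U)) n x = x
    induction x using exteriorPower_induction with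
    | h0 => exact map_zero _
    | hadd x y hx hy => rw [map_add, hx, hy]
    | hsmul c x hx =>
      rw [map_smulₛₗ, hx, R.map_id]
      rfl
    | h m =>
      rw [exteriorPowerMap_ιMulti]
      congr 1
      ext i
      rw [M.restrictₛₗ_apply, M.map_id]
      rfl
  map_comp {U V W} i j := by
    refine ModuleCat.hom_ext (LinearMap.ext fun x => ?_)
    change exteriorPowerMap (R.map (i ≫ j)).hom (M.restrictₛₗ (i ≫ j)) n x =
      exteriorPowerMap (R.map j).hom (M.restrictₛₗ j) n
        (exteriorPowerMap (R.map i).hom (M.restrictₛₗ i) n x)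
    induction x using exteriorPower_induction with
    | h0 => simp only [map_zero]
    | hadd x y hx hy => simp only [map_add, hx, hy]
    | hsmul c x hx =>
      rw [map_smulₛₗ, hx, map_smulₛₗ, map_smulₛₗ, R.map_comp]
      rfl
    | h m =>
      rw [exteriorPowerMap_ιMulti, exteriorPowerMap_ιMulti, exteriorPowerMap_ιMulti]
      congr 1
      ext k
      exact M.map_comp_apply i j (m k)

namespace AdicSpace

/-- The exterior power `⋀ⁿ M` of an `𝒪_X`-module, the sheaf associated with `U ↦ ⋀ⁿ M(U)`. -/
def exteriorPower {X : AdicSpace.{u}} (M : X.Modules) (n : ℕ) : X.Modules :=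
  sheafify (presheafExteriorPower (Modules.toPresheaf M) n)

/-- `M` is locally free of rank `d`: it is locally isomorphic to `𝒪_X^d`. -/
def IsLocallyFreeOfRank {X : AdicSpace.{u}} (M : X.Modules) (d : ℕ) : Prop :=
  ∃ q : SheafOfModules.LocalGeneratorsData.{u} M, q.IsLocallyFreeData ∧
    ∀ i, Nonempty ((q.generators i).I ≃ Fin d)

end AdicSpace

end Adic

end

/-!
# The discriminant of a finite étale morphism of adic spaces

The isomorphism `(⋀ᵈ f_* 𝒪_Y)^{⊗ 2} ≅ 𝒪_X` is given by the discriminant of the trace form. If `b` is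
a basis of `f_* 𝒪_Y` over an open subset `U`, then `(b₁ ∧ ⋯ ∧ b_d)^{⊗ 2}` generates the left-hand
side over `U`. Under a change of basis both this section and `disc(b)` are multiplied by the square
of the determinant. Hence, if the discriminants are units, the sections
`disc(b)⁻¹ (b₁ ∧ ⋯ ∧ b_d)^{⊗ 2}` do not depend on `b` and glue to a global generator (`exists_global_generator`). The
discriminant of a basis of an étale algebra is a unit, because at a geometric point the algebra is a
product of copies of an algebraically closed field (`isUnit_discr_of_etale`). So it remains to find
local bases of `f_* 𝒪_Y` for which `𝒪_X(U) → 𝒪_Y(f⁻¹ U)` is étale (`HasLocalEtaleBases`); these show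
at the same time that `f_* 𝒪_Y` is locally free.

Over an affinoid open subset `V = Spa(A, A⁺)` with `f⁻¹ V = Spa(B, B⁺)`, the algebra `B` is a finite
projective `A`-module, hence has a dual basis `e i`, `c i` with `x = ∑ i, c i x * e i`
(`exists_dualBasis_of_etale`). The `c i` are continuous because `B` has the module topology. The
inverse image of the rational subset given by `(T, s)` is the one given by `(φ(T), φ(s))`, and the
coordinates extend to the localizations and their completions
(`RatData.exists_dualBasis_compl`), then to the functions on all open subsets of `V`
(`exists_dualBasis_of_isOpenImmersionOnto`). This yields
`𝒪_Y(f⁻¹ W) = 𝒪_X(W) ⊗_A B` for every open `W ⊆ V` without any discussion of completed tensor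
products. Near a given point some element of `A` becomes invertible after which `B` is free of rank
`d`, and the base change of a basis of `B` is the required basis.

The passage between the structure presheaf, whose sections over `W` are the compatible families
indexed by rational data, and the rings `A⟨T/s⟩` rests on Huber's universal property
(`RatData.exists_hom_of_subset`): an inclusion of rational subsets induces a continuous homomorphism
of the completed localizations. If `s` vanishes nowhere on the rational subset of `τ`, it is a unit
up to a topologically nilpotent element, and if moreover `|t| ≤ |s|` there, then `t / s` is
approximated by elements which are integral over the integral elements of `A(T/s)`. In both cases,
failure would produce a valuation ring by a choice of prime ideals (`exists_valuationSubring`), and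
the continuous quotient `RatData.contVal` of its valuation would be a point of the rational subset
violating the assumption.
-/

noncomputable section

namespace Adic

/-! ### Sheaves of modules and local generators -/

theorem toSheafify_isLocallyBijective {C : Type*} [Category C] (J : GrothendieckTopology C)
    [HasWeakSheafify J AddCommGrpCat.{u}] [J.WEqualsLocallyBijective AddCommGrpCat.{u}]
    (P : Cᵒᵖ ⥤ AddCommGrpCat.{u}) :
    Presheaf.IsLocallyInjective J (toSheafify J P) ∧
      Presheaf.IsLocallySurjective J (toSheafify J P) :=
  ⟨inferInstance, inferInstance⟩

namespace AdicSpace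

/-- Presheaves of `𝒪_X`-modules. -/
abbrev PMod (X : AdicSpace.{u}) : Type (u + 1) :=
  PresheafOfModules.{u} (X.presheaf ⋙ forget₂ CommRingCat RingCat)

/-- The ring of sections `𝒪_X(U)`. -/
abbrev O (X : AdicSpace.{u}) (U : Opens X.carrier) : Type u := X.presheaf.obj (op U)

variable {X : AdicSpace.{u}}

/-- The sections of a presheaf of modules over `U`, as an `𝒪_X(U)`-module. -/
def Sec (M : PMod X) (U : Opens X.carrier) : Type u := M.obj (op U)

instance (M : PMod X) (U : Opens X.carrier) : AddCommGroup (Sec M U) :=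
  (M.obj (op U)).isAddCommGroup

instance (M : PMod X) (U : Opens X.carrier) : Module (O X U) (Sec M U) :=
  (M.obj (op U)).isModule

/-- Restriction of functions. -/
def resO (X : AdicSpace.{u}) {V U : Opens X.carrier} (h : V ≤ U) : O X U →+* O X V :=
  (X.presheaf.map (homOfLE h).op).hom

/-- Restriction of sections of a presheaf of modules. -/
def res (M : PMod X) {V U : Opens X.carrier} (h : V ≤ U) : Sec M U →ₛₗ[resO X h] Sec M V :=
  M.restrictₛₗ (homOfLE h).op

theorem res_smul (M : PMod X) {V U : Opens X.carrier} (h : V ≤ U) (c : O X U)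
    (m : Sec M U) : res M h (c • m) = resO X h c • res M h m :=
  map_smulₛₗ (res M h) c m

theorem res_res (M : PMod X) {W V U : Opens X.carrier} (h : V ≤ U) (h' : W ≤ V)
    (m : Sec M U) : res M h' (res M h m) = res M (h'.trans h) m :=
  (M.map_comp_apply (homOfLE h).op (homOfLE h').op m).symm

theorem res_self (M : PMod X) {U : Opens X.carrier} (m : Sec M U) :
    res M le_rfl m = m := by
  change M.presheaf.map (𝟙 (op U)) m = m
  rw [M.presheaf.map_id]; rfl

theorem resO_resO {W V U : Opens X.carrier} (h : V ≤ U) (h' : W ≤ V)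
    (m : O X U) : resO X h' (resO X h m) = resO X (h'.trans h) m :=
  (ConcreteCategory.congr_hom (X.presheaf.map_comp (homOfLE h).op (homOfLE h').op) m).symm

/-- A presheaf of modules is a sheaf. -/
def IsSheafMod (M : PMod X) : Prop :=
  Presheaf.IsSheaf (Opens.grothendieckTopology X.carrier) M.presheaf

theorem Modules.isSheafMod (M : X.Modules) : IsSheafMod (Modules.toPresheaf M) := M.isSheaf

theorem IsSheafMod.eq_of_locally_eq {M : PMod X} (hM : IsSheafMod M) {U : Opens X.carrier}
    {s t : Sec M U}
    (h : ∀ x ∈ U, ∃ (V : Opens X.carrier) (hV : V ≤ U), x ∈ V ∧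
      res M hV s = res M hV t) : s = t := by
  choose V hV hx h using h
  exact TopCat.Sheaf.eq_of_locally_eq' (⟨M.presheaf, hM⟩ : TopCat.Sheaf Ab X.carrier)
    (fun x : U => V x.1 x.2) U (fun x => homOfLE (hV x.1 x.2))
    (fun x hxU => Opens.mem_iSup.2 ⟨⟨x, hxU⟩, hx x hxU⟩) s t fun x => h x.1 x.2

theorem IsSheafMod.exists_glue {M : PMod X} (hM : IsSheafMod M) {U : Opens X.carrier} {ι : Type u}
    (V : ι → Opens X.carrier) (hV : ∀ i, V i ≤ U) (hcov : ∀ x ∈ U, ∃ i, x ∈ V i)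
    (s : ∀ i, Sec M (V i))
    (hs : ∀ i j, res M (inf_le_left : V i ⊓ V j ≤ _) (s i) =
      res M (inf_le_right : V i ⊓ V j ≤ _) (s j)) :
    ∃ t : Sec M U, ∀ i, res M (hV i) t = s i := by
  obtain ⟨t, ht, -⟩ := TopCat.Sheaf.existsUnique_gluing'
    (⟨M.presheaf, hM⟩ : TopCat.Sheaf Ab X.carrier)
    V U (fun i => homOfLE (hV i)) (fun x hxU => Opens.mem_iSup.2 (hcov x hxU)) s
    fun i j => hs i j
  exact ⟨t, ht⟩

theorem O_eq_of_locally_eq {U : Opens X.carrier} {s t : O X U}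
    (h : ∀ x ∈ U, ∃ (V : Opens X.carrier) (hV : V ≤ U), x ∈ V ∧
      resO X hV s = resO X hV t) : s = t :=
  (Modules.isSheafMod X.structureModule).eq_of_locally_eq (s := s) (t := t) h

theorem O_exists_glue {U : Opens X.carrier} {ι : Type u}
    (V : ι → Opens X.carrier) (hV : ∀ i, V i ≤ U) (hcov : ∀ x ∈ U, ∃ i, x ∈ V i)
    (s : ∀ i, O X (V i))
    (hs : ∀ i j, resO X (inf_le_left : V i ⊓ V j ≤ _) (s i) =
      resO X (inf_le_right : V i ⊓ V j ≤ _) (s j)) :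
    ∃ t : O X U, ∀ i, resO X (hV i) t = s i :=
  (Modules.isSheafMod X.structureModule).exists_glue V hV hcov s hs

/-- `e` freely generates the presheaf of modules `M` over `U`. -/
def IsGeneratorOn (M : PMod X) (U : Opens X.carrier) (e : Sec M U) : Prop :=
  ∀ (W : Opens X.carrier) (h : W ≤ U), Function.Bijective fun c : O X W => c • res M h e

/-- A criterion for freely generating a sheaf of modules: scalars act freely on `e` and every
section is locally a multiple of `e`. -/
theorem IsGeneratorOn.of_locally {M : PMod X} (hM : IsSheafMod M) {U : Opens X.carrier}
    {e : Sec M U}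
    (hinj : ∀ (W : Opens X.carrier) (h : W ≤ U) (c c' : O X W),
      c • res M h e = c' • res M h e → c = c')
    (hsurj : ∀ (W : Opens X.carrier) (h : W ≤ U) (m : Sec M W), ∀ x ∈ W,
      ∃ (V : Opens X.carrier) (hV : V ≤ W), x ∈ V ∧ ∃ c : O X V,
        c • res M (hV.trans h) e = res M hV m) :
    IsGeneratorOn M U e := by
  intro W h
  refine ⟨fun c c' hc => hinj W h c c' hc, fun m => ?_⟩
  choose V hV hx c hc using hsurj W h m
  obtain ⟨t, ht⟩ := O_exists_glue (fun x : W => V x.1 x.2) (fun x => hV x.1 x.2)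
    (fun x hxW => ⟨⟨x, hxW⟩, hx x hxW⟩) (fun x => c x.1 x.2) fun i j => by
      refine hinj _ (inf_le_left.trans ((hV _ _).trans h)) _ _ ?_
      rw [← res_res M ((hV i.1 i.2).trans h) inf_le_left, ← res_smul, hc, res_res,
        res_res M ((hV i.1 i.2).trans h) inf_le_left,
        ← res_res M ((hV j.1 j.2).trans h) inf_le_right, ← res_smul, hc, res_res]
  refine ⟨t, hM.eq_of_locally_eq fun x hxW => ⟨V x hxW, hV x hxW, hx x hxW, ?_⟩⟩
  dsimp only
  rw [res_smul, ht ⟨x, hxW⟩, res_res, hc]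

/-- Freely generating a sheaf of modules is a local property. -/
theorem IsGeneratorOn.of_forall_exists {M : PMod X} (hM : IsSheafMod M) {U : Opens X.carrier}
    {e : Sec M U} (he : ∀ x ∈ U, ∃ (V : Opens X.carrier) (hV : V ≤ U), x ∈ V ∧
      IsGeneratorOn M V (res M hV e)) : IsGeneratorOn M U e := by
  refine .of_locally hM (fun W h c c' hc => ?_) (fun W h m x hx => ?_)
  · refine O_eq_of_locally_eq fun x hx => ?_
    obtain ⟨V, hV, hxV, hgen⟩ := he x (h hx)
    refine ⟨V ⊓ W, inf_le_right, ⟨hxV, hx⟩, (hgen (V ⊓ W) inf_le_left).1 ?_⟩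
    have := congrArg (res M (inf_le_right : V ⊓ W ≤ W)) hc
    rw [res_smul, res_smul, res_res] at this
    simpa only [res_res] using this
  · obtain ⟨V, hV, hxV, hgen⟩ := he x (h hx)
    obtain ⟨c, hc⟩ := (hgen (V ⊓ W) inf_le_left).2 (res M inf_le_right m)
    refine ⟨V ⊓ W, inf_le_right, ⟨hxV, hx⟩, c, ?_⟩
    simpa only [res_res] using hc

/-! ### Sheafification -/

/-- The presheaf of modules underlying the sheaf associated with `M`. -/
def sheafified (M : PMod X) : PMod X := Modules.toPresheaf (sheafify M)

theorem isSheafMod_sheafified (M : PMod X) : IsSheafMod (sheafified M) :=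
  Modules.isSheafMod (sheafify M)

/-- The canonical map from sections of a presheaf of modules to sections of the associated
sheaf. -/
def toSheafified (M : PMod X) (U : Opens X.carrier) : Sec M U →ₗ[O X U] Sec (sheafified M) U :=
  let φ := ((PresheafOfModules.sheafificationAdjunction (R := X.ringCatSheaf)
    (𝟙 X.ringCatSheaf.obj)).unit.app M).app (op U)
  { toFun := φ
    map_add' := map_add φ.hom
    map_smul' := φ.hom.map_smul }

theorem res_toSheafified (M : PMod X) {V U : Opens X.carrier} (h : V ≤ U) (m : Sec M U) :
    res (sheafified M) h (toSheafified M U m) = toSheafified M V (res M h m) :=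
  (ConcreteCategory.congr_hom ((CategoryTheory.toSheafify (Opens.grothendieckTopology X.carrier)
    M.presheaf).naturality (homOfLE h).op) m).symm

theorem toSheafified_locally_injective (M : PMod X) {U : Opens X.carrier} (m m' : Sec M U)
    (h : toSheafified M U m = toSheafified M U m') (x : X.carrier) (hx : x ∈ U) :
    ∃ (V : Opens X.carrier) (hV : V ≤ U), x ∈ V ∧ res M hV m = res M hV m' := by
  have := (toSheafify_isLocallyBijective (Opens.grothendieckTopology X.carrier) M.presheaf).1
  obtain ⟨V, f, hf, hxV⟩ := Presheaf.equalizerSieve_mem (Opens.grothendieckTopology X.carrier)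
    (CategoryTheory.toSheafify (Opens.grothendieckTopology X.carrier) M.presheaf) m m' h x hx
  exact ⟨V, f.le, hxV, hf⟩

theorem toSheafified_locally_surjective (M : PMod X) {U : Opens X.carrier}
    (m : Sec (sheafified M) U) (x : X.carrier) (hx : x ∈ U) :
    ∃ (V : Opens X.carrier) (hV : V ≤ U), x ∈ V ∧ ∃ n : Sec M V, toSheafified M V n =
      res (sheafified M) hV m := by
  have := (toSheafify_isLocallyBijective (Opens.grothendieckTopology X.carrier) M.presheaf).2
  obtain ⟨V, f, ⟨n, hn⟩, hxV⟩ := Presheaf.imageSieve_mem (Opens.grothendieckTopology X.carrier)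
    (CategoryTheory.toSheafify (Opens.grothendieckTopology X.carrier) M.presheaf) (U := op U) m x hx
  exact ⟨V, f.le, hxV, n, hn⟩

theorem IsGeneratorOn.sheafified {M : PMod X} {U : Opens X.carrier} {e : Sec M U}
    (he : IsGeneratorOn M U e) :
    IsGeneratorOn (sheafified M) U (toSheafified M U e) := by
  refine .of_locally (isSheafMod_sheafified M) (fun W h c c' hc => ?_) (fun W h m x hx => ?_)
  · rw [res_toSheafified, ← (toSheafified M W).map_smul, ← (toSheafified M W).map_smul] at hc
    refine O_eq_of_locally_eq fun x hx => ?_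
    obtain ⟨V, hV, hxV, hr⟩ := toSheafified_locally_injective M _ _ hc x hx
    refine ⟨V, hV, hxV, (he V (hV.trans h)).1 ?_⟩
    rw [res_smul, res_smul] at hr
    simpa only [res_res] using hr
  · obtain ⟨V, hV, hxV, n, hn⟩ := toSheafified_locally_surjective M m x hx
    obtain ⟨c, rfl⟩ := (he V (hV.trans h)).2 n
    refine ⟨V, hV, hxV, c, ?_⟩
    rw [← hn, res_toSheafified, map_smul]

/-! ### Tensor products -/

/-- The tensor product presheaf `U ↦ M(U) ⊗ N(U)`. -/
def tensorPresheaf (M N : PMod X) : PMod X := MonoidalCategory.tensorObj M N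

open TensorProduct in
/-- The sections of the tensor product presheaf (this is the identity map). -/
def tensorSec (M N : PMod X) (U : Opens X.carrier) :
    (Sec M U ⊗[O X U] Sec N U) ≃ₗ[O X U] Sec (tensorPresheaf M N) U :=
  LinearEquiv.refl _ _

open TensorProduct in
theorem res_tensorSec_tmul (M N : PMod X) {V U : Opens X.carrier} (h : V ≤ U) (m : Sec M U)
    (n : Sec N U) : res (tensorPresheaf M N) h (tensorSec M N U (m ⊗ₜ n)) =
      tensorSec M N V (res M h m ⊗ₜ res N h n) := rfl

open TensorProduct in
theorem IsGeneratorOn.tensor {M N : PMod X} {U : Opens X.carrier} {e : Sec M U}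
    {e' : Sec N U} (he : IsGeneratorOn M U e) (he' : IsGeneratorOn N U e') :
    IsGeneratorOn (tensorPresheaf M N) U (tensorSec M N U (e ⊗ₜ[O X U] e')) := by
  intro W h
  rw [res_tensorSec_tmul]
  let f := LinearEquiv.ofBijective ((LinearMap.id (R := O X W)).smulRight (res M h e)) (he W h)
  let g := LinearEquiv.ofBijective ((LinearMap.id (R := O X W)).smulRight (res N h e')) (he' W h)
  have := (((TensorProduct.lid (O X W) (O X W)).symm ≪≫ₗ TensorProduct.congr f g) ≪≫ₗ
    tensorSec M N W).bijective
  convert this using 2 with c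
  change _ = tensorSec M N W (TensorProduct.congr f g ((TensorProduct.lid _ _).symm c))
  rw [TensorProduct.lid_symm_apply, TensorProduct.congr_tmul, ← map_smul, ← TensorProduct.tmul_smul]
  congr 2
  exact (one_smul (O X W) (res M h e)).symm

/-! ### Exterior powers -/

/-- The presheaf `U ↦ ⋀ⁿ M(U)`. -/
def extPresheaf (M : PMod X) (n : ℕ) : PMod X := presheafExteriorPower M n

/-- The sections of the exterior power presheaf (this is the identity map). -/
def extSec (M : PMod X) (n : ℕ) (U : Opens X.carrier) :
    (⋀[O X U]^n (Sec M U)) ≃ₗ[O X U] Sec (extPresheaf M n) U :=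
  LinearEquiv.refl (O X U) (Sec (extPresheaf M n) U)

theorem res_extSec_ιMulti (M : PMod X) (n : ℕ) {V U : Opens X.carrier} (h : V ≤ U)
    (m : Fin n → Sec M U) :
    res (extPresheaf M n) h (extSec M n U (exteriorPower.ιMulti (O X U) n m)) =
      extSec M n V (exteriorPower.ιMulti (O X V) n fun i => res M h (m i)) :=
  exteriorPowerMap_ιMulti (X.presheaf.map (homOfLE h).op).hom (M.restrictₛₗ (homOfLE h).op) n m

end AdicSpace

/-- The top exterior power of a free module is freely generated by the exterior product of a
basis. -/
theorem bijective_smul_ιMulti_basis {R M : Type*} [CommRing R] [AddCommGroup M] [Module R M]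
    {n : ℕ} (b : Module.Basis (Fin n) R M) :
    Function.Bijective fun c : R => c • exteriorPower.ιMulti R n b := by
  have h1 : exteriorPower.alternatingMapLinearEquiv b.det (exteriorPower.ιMulti R n b) = 1 := by
    rw [exteriorPower.alternatingMapLinearEquiv_apply_ιMulti, b.det_self]
  refine ⟨fun c c' h => ?_, fun x => ⟨exteriorPower.alternatingMapLinearEquiv b.det x, ?_⟩⟩
  · have := congrArg (exteriorPower.alternatingMapLinearEquiv b.det) h
    simpa [h1] using this
  · suffices h : ((LinearMap.id (R := R)).smulRight (exteriorPower.ιMulti R n b)) ∘ₗ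
      exteriorPower.alternatingMapLinearEquiv b.det = LinearMap.id from LinearMap.congr_fun h x
    refine exteriorPower.linearMap_ext (Module.Basis.ext_alternating b fun v hv => ?_)
    obtain ⟨σ, rfl⟩ : ∃ σ : Equiv.Perm (Fin n), v = σ :=
      ⟨Equiv.ofBijective v (Finite.injective_iff_bijective.1 hv), rfl⟩
    change exteriorPower.alternatingMapLinearEquiv b.det
      (exteriorPower.ιMulti R n (b ∘ σ)) • exteriorPower.ιMulti R n b =
        exteriorPower.ιMulti R n (b ∘ σ)
    rw [exteriorPower.alternatingMapLinearEquiv_apply_ιMulti, AlternatingMap.map_perm,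
      AlternatingMap.map_perm, b.det_self, smul_assoc, one_smul]

namespace AdicSpace

variable {X : AdicSpace.{u}}

/-- The sections `b` form a basis of the presheaf of modules `M` over `U`. -/
def IsBasisOn (M : PMod X) {n : ℕ} (U : Opens X.carrier) (b : Fin n → Sec M U) : Prop :=
  ∀ (W : Opens X.carrier) (h : W ≤ U),
    Function.Bijective fun c : Fin n → O X W => ∑ i, c i • res M h (b i)

theorem IsBasisOn.restrict {M : PMod X} {n : ℕ} {U V : Opens X.carrier} {b : Fin n → Sec M U}
    (hb : IsBasisOn M U b) (h : V ≤ U) : IsBasisOn M V fun i => res M h (b i) := by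
  intro W hW
  simp only [res_res]
  exact hb W (hW.trans h)

/-- A basis of the presheaf over `U` as a basis of the module of sections over `U`. -/
def IsBasisOn.basis {M : PMod X} {n : ℕ} {U : Opens X.carrier} {b : Fin n → Sec M U}
    (hb : IsBasisOn M U b) : Module.Basis (Fin n) (O X U) (Sec M U) :=
  .ofEquivFun (LinearEquiv.ofBijective (Fintype.linearCombination (O X U) b) (by
    have := hb U le_rfl
    simp only [res_self] at this
    exact this)).symm

@[simp]
theorem IsBasisOn.coe_basis {M : PMod X} {n : ℕ} {U : Opens X.carrier} {b : Fin n → Sec M U}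
    (hb : IsBasisOn M U b) : ⇑hb.basis = b := by
  ext i
  rw [IsBasisOn.basis, Module.Basis.coe_ofEquivFun, LinearEquiv.symm_symm]
  change Fintype.linearCombination (O X U) b (Pi.single i 1) = b i
  simp

/-- The exterior product of a basis freely generates the top exterior power. -/
theorem IsBasisOn.isGeneratorOn {M : PMod X} {n : ℕ} {U : Opens X.carrier} {b : Fin n → Sec M U}
    (hb : IsBasisOn M U b) :
    IsGeneratorOn (extPresheaf M n) U (extSec M n U (exteriorPower.ιMulti (O X U) n b)) := by
  intro W h
  rw [res_extSec_ιMulti]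
  have := (extSec M n W).bijective.comp (bijective_smul_ιMulti_basis (hb.restrict h).basis)
  convert this using 2 with c
  simp [map_smul]

/-! ### Invertible modules with a global generator -/

/-- A sheaf of modules which is freely generated by a global section is isomorphic to `𝒪_X`. -/
theorem nonempty_iso_structureModule (M : X.Modules) (e : Sec (Modules.toPresheaf M) ⊤)
    (he : IsGeneratorOn (Modules.toPresheaf M) ⊤ e) : Nonempty (M ≅ X.structureModule) := by
  let s : M.sections := PresheafOfModules.sectionsMk
    (fun U => (res (Modules.toPresheaf M) (le_top : U.unop ≤ ⊤) e : Sec _ U.unop))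
    (fun {U V} i => res_res (Modules.toPresheaf M) le_top i.unop.le e)
  let φ : X.structureModule ⟶ M := M.unitHomEquiv.symm s
  have hφ : ∀ U : (Opens X.carrier)ᵒᵖ, IsIso (φ.val.app U) := fun U => by
    refine (ConcreteCategory.isIso_iff_bijective _).2 ?_
    exact he U.unop le_top
  have : IsIso φ := by
    have : IsIso ((SheafOfModules.forget _).map φ) := by
      have := (PresheafOfModules.isoMk (fun U => asIso (φ.val.app U))
        (fun _ _ i => φ.val.naturality i)).isIso_hom
      exact this
    exact isIso_of_reflects_iso φ (SheafOfModules.forget _)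
  exact ⟨(asIso φ).symm⟩

end AdicSpace

/-! ### The discriminant trivializes the square of the determinant -/

/-- `m₁ ∧ ⋯ ∧ mₙ = det_b(m) • b₁ ∧ ⋯ ∧ bₙ`. -/
theorem ιMulti_eq_det_smul {R M : Type*} [CommRing R] [AddCommGroup M] [Module R M]
    {n : ℕ} (b : Module.Basis (Fin n) R M) (m : Fin n → M) :
    exteriorPower.ιMulti R n m = b.det m • exteriorPower.ιMulti R n b := by
  obtain ⟨c, hc⟩ := (bijective_smul_ιMulti_basis b).2 (exteriorPower.ιMulti R n m)
  have h := congrArg (exteriorPower.alternatingMapLinearEquiv b.det) hc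
  simp only [map_smul, exteriorPower.alternatingMapLinearEquiv_apply_ιMulti, b.det_self,
    smul_eq_mul, mul_one] at h
  rw [← hc, h]

/-- The behaviour of the discriminant under a change of basis. -/
theorem discr_eq_det_sq_mul {R S : Type*} [CommRing R] [CommRing S] [Algebra R S]
    {n : ℕ} (b : Module.Basis (Fin n) R S) (m : Fin n → S) :
    Algebra.discr R m = b.det m ^ 2 * Algebra.discr R b := by
  have : m = Matrix.vecMul b ((b.toMatrix m).map (algebraMap R S)) := by
    ext j
    rw [← b.sum_toMatrix_smul_self m j]
    simp [Matrix.vecMul, dotProduct, Algebra.smul_def, mul_comm]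
  conv_lhs => rw [this]
  rw [Algebra.discr_of_matrix_vecMul, Module.Basis.det_apply]

/-- A pair of compatible bases computes traces compatibly. -/
theorem trace_map_of_basis {R S R' S' : Type*} [CommRing R] [CommRing S] [Algebra R S]
    [CommRing R'] [CommRing S'] [Algebra R' S'] {n : ℕ} (b : Module.Basis (Fin n) R S)
    (b' : Module.Basis (Fin n) R' S') (φ : R →+* R') (ψ : S →+* S')
    (h : ∀ r, ψ (algebraMap R S r) = algebraMap R' S' (φ r)) (hb : ∀ i, ψ (b i) = b' i) (s : S) :
    Algebra.trace R' S' (ψ s) = φ (Algebra.trace R S s) := by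
  classical
  rw [Algebra.trace_eq_matrix_trace b', Algebra.trace_eq_matrix_trace b, Matrix.trace,
    Matrix.trace, map_sum]
  refine Finset.sum_congr rfl fun i _ => ?_
  rw [Matrix.diag_apply, Matrix.diag_apply, Algebra.leftMulMatrix_eq_repr_mul,
    Algebra.leftMulMatrix_eq_repr_mul]
  have : ψ s * b' i = ∑ j, φ (b.repr (s * b i) j) • b' j := by
    rw [← hb, ← map_mul]
    conv_lhs => rw [← b.sum_repr (s * b i)]
    simp [Algebra.smul_def, h, hb]
  rw [this]
  simp [Finsupp.single_apply]

theorem discr_map_of_basis {R S R' S' : Type*} [CommRing R] [CommRing S] [Algebra R S]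
    [CommRing R'] [CommRing S'] [Algebra R' S'] {n : ℕ} (b : Module.Basis (Fin n) R S)
    (b' : Module.Basis (Fin n) R' S') (φ : R →+* R') (ψ : S →+* S')
    (h : ∀ r, ψ (algebraMap R S r) = algebraMap R' S' (φ r)) (hb : ∀ i, ψ (b i) = b' i) :
    Algebra.discr R' b' = φ (Algebra.discr R b) := by
  rw [Algebra.discr_def, Algebra.discr_def, RingHom.map_det]
  congr 1
  ext i j
  simp only [Algebra.traceMatrix_apply, Algebra.traceForm_apply, RingHom.mapMatrix_apply,
    Matrix.map_apply]
  rw [← trace_map_of_basis b b' φ ψ h hb, map_mul ψ, hb, hb]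

namespace AdicSpace

variable {X Y : AdicSpace.{u}} (f : Hom Y X) {d : ℕ}

/-- The presheaf of modules underlying `f_* 𝒪_Y`. -/
def pushF : PMod X := Modules.toPresheaf (pushforwardStructure f)

/-- The ring `𝒪_Y(f⁻¹ U)`. -/
def PreO (U : Opens X.carrier) : Type u := O Y ((Opens.map f.base).obj U)

instance (U : Opens X.carrier) : CommRing (PreO f U) :=
  inferInstanceAs (CommRing (O Y ((Opens.map f.base).obj U)))

/-- `𝒪_Y(f⁻¹ U)` is an algebra over `𝒪_X(U)`. -/
instance (U : Opens X.carrier) : Algebra (O X U) (PreO f U) := (f.appHom U).toAlgebra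

/-- The sections of `f_* 𝒪_Y` over `U` are the functions on `f⁻¹ U` (this is the identity map). -/
def pushEquiv (U : Opens X.carrier) : Sec (pushF f) U ≃ₗ[O X U] PreO f U where
  toFun s := s
  invFun s := s
  map_add' _ _ := rfl
  map_smul' _ _ := rfl
  left_inv _ := rfl
  right_inv _ := rfl

/-- Restriction of functions on preimages. -/
def resPre {V U : Opens X.carrier} (h : V ≤ U) : PreO f U →+* PreO f V :=
  resO Y ((Opens.map f.base).map (homOfLE h)).le

theorem pushEquiv_res {V U : Opens X.carrier} (h : V ≤ U) (s : Sec (pushF f) U) :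
    pushEquiv f V (res (pushF f) h s) = resPre f h (pushEquiv f U s) := rfl

theorem resPre_algebraMap {V U : Opens X.carrier} (h : V ≤ U) (r : O X U) :
    resPre f h (algebraMap (O X U) (PreO f U) r) = algebraMap (O X V) (PreO f V) (resO X h r) :=
  (ConcreteCategory.congr_hom (f.c.naturality (homOfLE h).op) r).symm

variable {f}

/-- A basis of `f_* 𝒪_Y` over `U` as a basis of the algebra `𝒪_Y(f⁻¹ U)`. -/
def IsBasisOn.preBasis {U : Opens X.carrier} {b : Fin d → Sec (pushF f) U}
    (hb : IsBasisOn (pushF f) U b) : Module.Basis (Fin d) (O X U) (PreO f U) :=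
  hb.basis.map (pushEquiv f U)

theorem IsBasisOn.preBasis_apply {U : Opens X.carrier} {b : Fin d → Sec (pushF f) U}
    (hb : IsBasisOn (pushF f) U b) (i : Fin d) : hb.preBasis i = pushEquiv f U (b i) := by
  simp [preBasis]

theorem IsBasisOn.discr_restrict {U V : Opens X.carrier} {b : Fin d → Sec (pushF f) U}
    (hb : IsBasisOn (pushF f) U b) (h : V ≤ U) :
    Algebra.discr (O X V) (hb.restrict h).preBasis = resO X h (Algebra.discr (O X U) hb.preBasis) :=
  discr_map_of_basis _ _ (resO X h) (resPre f h) (resPre_algebraMap f h) fun i => by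
    rw [preBasis_apply, preBasis_apply, pushEquiv_res]

variable (f d) in
/-- The presheaf of modules underlying `⋀ᵈ f_* 𝒪_Y`. -/
def detF : PMod X := sheafified (extPresheaf (pushF f) d)

variable (f d) in
/-- The presheaf of modules underlying `(⋀ᵈ f_* 𝒪_Y)^{⊗ 2}`. -/
def detSq : PMod X := sheafified (tensorPresheaf (detF f d) (detF f d))

open TensorProduct

/-- The section `b₁ ∧ ⋯ ∧ b_d` of `⋀ᵈ f_* 𝒪_Y`. -/
def wedge (U : Opens X.carrier) (b : Fin d → Sec (pushF f) U) : Sec (detF f d) U :=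
  toSheafified _ U (extSec _ d U (exteriorPower.ιMulti (O X U) d b))

/-- The section `(b₁ ∧ ⋯ ∧ b_d) ⊗ (b₁ ∧ ⋯ ∧ b_d)` of `(⋀ᵈ f_* 𝒪_Y)^{⊗ 2}`. -/
def wedgeSq (U : Opens X.carrier) (b : Fin d → Sec (pushF f) U) : Sec (detSq f d) U :=
  toSheafified _ U (tensorSec _ _ U (wedge U b ⊗ₜ[O X U] wedge U b))

theorem res_wedge {U V : Opens X.carrier} (h : V ≤ U) (b : Fin d → Sec (pushF f) U) :
    res (detF f d) h (wedge U b) = wedge V fun i => res (pushF f) h (b i) := by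
  refine (res_toSheafified _ h _).trans ?_
  rw [res_extSec_ιMulti]
  rfl

theorem res_wedgeSq {U V : Opens X.carrier} (h : V ≤ U) (b : Fin d → Sec (pushF f) U) :
    res (detSq f d) h (wedgeSq U b) = wedgeSq V fun i => res (pushF f) h (b i) := by
  refine (res_toSheafified _ h _).trans ?_
  rw [res_tensorSec_tmul, res_wedge]
  rfl

/-- The section `(b₁ ∧ ⋯ ∧ b_d)^{⊗ 2}` of a basis `b` is a generator. -/
theorem IsBasisOn.wedgeSq {U : Opens X.carrier} {b : Fin d → Sec (pushF f) U}
    (hb : IsBasisOn (pushF f) U b) : IsGeneratorOn (detSq f d) U (wedgeSq U b) :=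
  (hb.isGeneratorOn.sheafified.tensor hb.isGeneratorOn.sheafified).sheafified

/-- Under a change of basis `(b₁ ∧ ⋯ ∧ b_d)^{⊗ 2}` is multiplied by the square of the determinant,
just as the discriminant is (`IsBasisOn.discr_eq`). -/
theorem IsBasisOn.wedgeSq_eq {U : Opens X.carrier} {b : Fin d → Sec (pushF f) U}
    (hb : IsBasisOn (pushF f) U b) (b' : Fin d → Sec (pushF f) U) :
    AdicSpace.wedgeSq U b' = hb.basis.det b' ^ 2 • AdicSpace.wedgeSq U b := by
  have h : wedge U b' = hb.basis.det b' • wedge U b := by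
    have := ιMulti_eq_det_smul hb.basis b'
    rw [hb.coe_basis] at this
    rw [wedge, this, (extSec _ d U).map_smul, (toSheafified _ U).map_smul]
    rfl
  rw [AdicSpace.wedgeSq, h, AdicSpace.wedgeSq, TensorProduct.smul_tmul_smul, ← pow_two,
    (tensorSec _ _ U).map_smul, (toSheafified _ U).map_smul]
  rfl

theorem IsBasisOn.discr_eq {U : Opens X.carrier} {b b' : Fin d → Sec (pushF f) U}
    (hb : IsBasisOn (pushF f) U b) (hb' : IsBasisOn (pushF f) U b') :
    Algebra.discr (O X U) hb'.preBasis =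
      hb.basis.det b' ^ 2 * Algebra.discr (O X U) hb.preBasis := by
  rw [discr_eq_det_sq_mul hb.preBasis hb'.preBasis]
  congr 2
  rw [preBasis, Module.Basis.det_map]
  congr 1
  ext i
  simp [preBasis_apply]

variable (f d) in
/-- Locally on `X`, the module `f_* 𝒪_Y` has a basis of length `d` whose discriminant with respect
to the trace form is invertible. -/
def HasLocalEtaleBases : Prop :=
  ∀ x : X.carrier, ∃ (U : Opens X.carrier) (b : Fin d → Sec (pushF f) U)
    (hb : IsBasisOn (pushF f) U b), x ∈ U ∧ IsUnit (Algebra.discr (O X U) hb.preBasis)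

/-- Dividing a generator by a unit gives a generator. -/
theorem IsGeneratorOn.of_smul_eq {M : PMod X} {U : Opens X.carrier} {e e' : Sec M U}
    (he : IsGeneratorOn M U e) {c : O X U} (hc : IsUnit c) (h : c • e' = e) :
    IsGeneratorOn M U e' := by
  intro W hW
  have hu := hc.map (resO X hW)
  have h1 : Function.Bijective fun a : O X W => a * resO X hW c := by
    obtain ⟨v, hv⟩ := hu
    rw [← hv]
    exact v.mulRight.bijective
  have h2 := he W hW
  rw [← h, res_smul] at h2
  rw [← Function.Bijective.of_comp_iff _ h1]
  convert h2 using 2 with a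
  exact mul_smul a _ _

/-- The discriminant of the trace form trivializes `(⋀ᵈ f_* 𝒪_Y)^{⊗ 2}`: the sections
`disc(b)⁻¹ • (b₁ ∧ ⋯ ∧ b_d)^{⊗ 2}` do not depend on the choice of the local basis `b`, hence glue to
a global generator. -/
theorem exists_global_generator (hf : HasLocalEtaleBases f d) :
    ∃ ω : Sec (detSq f d) ⊤, IsGeneratorOn (detSq f d) ⊤ ω := by
  choose U b hb hx hu using hf
  choose D hD using hu
  let ω : ∀ x, Sec (detSq f d) (U x) := fun x =>
    (↑(D x)⁻¹ : O X (U x)) • wedgeSq (U x) (b x)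
  have hω : ∀ x, Algebra.discr (O X (U x)) (hb x).preBasis • ω x = wedgeSq (U x) (b x) := by
    intro x
    rw [← hD, smul_smul, Units.mul_inv, one_smul]
  obtain ⟨t, ht⟩ := (isSheafMod_sheafified _).exists_glue U (fun _ => le_top)
    (fun x _ => ⟨x, hx x⟩) ω (M := detSq f d) fun x y => by
      have h1 : ∀ (z) (h : U x ⊓ U y ≤ U z),
        Algebra.discr (O X (U x ⊓ U y)) ((hb z).restrict h).preBasis • res (detSq f d) h (ω z) =
          wedgeSq (U x ⊓ U y) fun i => res (pushF f) h (b z i) := by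
        intro z h
        rw [(hb z).discr_restrict h, ← res_smul, hω, res_wedgeSq]
      -- On the overlap the two bases differ by a matrix whose squared determinant is cancelled by
      -- the quotient of the discriminants.
      have hx' := h1 x inf_le_left
      have hy' := h1 y inf_le_right
      set bx := (hb x).restrict (inf_le_left : U x ⊓ U y ≤ U x)
      set cy := (hb y).restrict (inf_le_right : U x ⊓ U y ≤ U y)
      have hunit : IsUnit (Algebra.discr (O X (U x ⊓ U y)) cy.preBasis) := by
        rw [(hb y).discr_restrict, ← hD]
        exact (D y).isUnit.map _
      rw [bx.wedgeSq_eq, ← hx', smul_smul, ← bx.discr_eq cy] at hy'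
      obtain ⟨v, hv⟩ := hunit
      rw [← hv] at hy'
      have := congrArg (fun z => (↑v⁻¹ : O X (U x ⊓ U y)) • z) hy'
      simp only [smul_smul, Units.inv_mul, one_smul] at this
      exact this.symm
  refine ⟨t, .of_forall_exists (isSheafMod_sheafified _) fun x _ => ⟨U x, le_top, hx x, ?_⟩⟩
  have h := ht x
  change IsGeneratorOn (detSq f d) (U x) (res (detSq f d) le_top t)
  rw [h]
  exact (hb x).wedgeSq.of_smul_eq ⟨D x, hD x⟩ (hω x)

theorem nonempty_tensor_exteriorPower_iso (hf : HasLocalEtaleBases f d) :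
    Nonempty (tensor (exteriorPower (pushforwardStructure f) d)
      (exteriorPower (pushforwardStructure f) d) ≅ X.structureModule) := by
  obtain ⟨ω, hω⟩ := exists_global_generator hf
  exact nonempty_iso_structureModule _ ω hω

end AdicSpace

/-! ### Local freeness from local bases -/

section Free

variable {C : Type*} [Category C] {J : GrothendieckTopology C} {R : Sheaf J RingCat.{u}}
  (M : SheafOfModules.{u} R) {I : Type u} [Fintype I] (s : I → M.sections)
  (h : ∀ U : Cᵒᵖ, Function.Bijective fun c : I → R.obj.obj U => ∑ i, c i • (s i).eval U)

/-- The isomorphism `R(U)^I ≃ M(U)` given by a family of sections which form a basis. -/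
def basisEquiv (U : Cᵒᵖ) : (I → R.obj.obj U) ≃ₗ[R.obj.obj U] M.val.obj U :=
  LinearEquiv.ofBijective
    { toFun := fun c => ∑ i, c i • (s i).eval U
      map_add' := fun c c' => by simp [add_smul, Finset.sum_add_distrib]
      map_smul' := fun c c' => by simp [mul_smul, Finset.smul_sum] } (h U)

theorem basisEquiv_apply (U : Cᵒᵖ) (c : I → R.obj.obj U) :
    basisEquiv M s h U c = ∑ i, c i • (s i).eval U := rfl

theorem basisEquiv_symm_map {U V : Cᵒᵖ} (g : U ⟶ V) (m : M.val.obj U) (i : I) :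
    (basisEquiv M s h V).symm (M.val.map g m) i =
      R.obj.map g ((basisEquiv M s h U).symm m i) := by
  obtain ⟨c, rfl⟩ := (basisEquiv M s h U).surjective m
  have : M.val.map g (basisEquiv M s h U c) = basisEquiv M s h V fun i => R.obj.map g (c i) := by
    rw [basisEquiv_apply, basisEquiv_apply]
    change M.val.restrictₛₗ g _ = _
    rw [map_sum]
    refine Finset.sum_congr rfl fun i _ => ?_
    rw [map_smulₛₗ]
    congr 1
    exact PresheafOfModules.sections_property (s i) g
  rw [this, LinearEquiv.symm_apply_apply, LinearEquiv.symm_apply_apply]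

/-- The coordinates with respect to a family of sections which form a basis. -/
def coordHom (i : I) : M ⟶ SheafOfModules.unit R where
  val :=
    { app := fun U => ModuleCat.ofHom (Y := R.obj.obj U)
        ((LinearMap.proj i) ∘ₗ (basisEquiv M s h U).symm.toLinearMap)
      naturality := fun {U V} g => by
        ext m
        exact basisEquiv_symm_map M s h g m i }

variable [HasWeakSheafify J AddCommGrpCat.{u}] [J.WEqualsLocallyBijective AddCommGrpCat.{u}]

/-- A family of sections which form a basis over every object gives an isomorphism from the free
sheaf of modules. -/
theorem isIso_freeHomEquiv_symm
    (h : ∀ U : Cᵒᵖ, Function.Bijective fun c : I → R.obj.obj U => ∑ i, c i • (s i).eval U) :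
    IsIso (M.freeHomEquiv.symm s) := by
  classical
  have hι : ∀ i, SheafOfModules.ιFree i ≫ M.freeHomEquiv.symm s = M.unitHomEquiv.symm (s i) := by
    intro i
    rw [← SheafOfModules.unitHomEquiv_symm_freeHomEquiv_apply, Equiv.apply_symm_apply]
  have hs : ∀ k U, (basisEquiv M s h U).symm ((s k).eval U) = Pi.single k 1 := by
    intro k U
    rw [LinearEquiv.symm_apply_eq, basisEquiv_apply, Finset.sum_eq_single k]
    · simp
    · intro b _ hb
      simp [Pi.single_eq_of_ne hb]
    · simp
  -- The inverse is `m ↦ ∑ i, (i-th coordinate of m) • (i-th basis element)`.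
  refine ⟨∑ i, coordHom M s h i ≫ SheafOfModules.ιFree i, ?_, ?_⟩
  · refine Limits.Cofan.IsColimit.hom_ext (SheafOfModules.isColimitFreeCofan I) _ _ fun k => ?_
    rw [SheafOfModules.freeCofan_inj]
    change SheafOfModules.ιFree k ≫ M.freeHomEquiv.symm s ≫ _ =
      SheafOfModules.ιFree k ≫ 𝟙 (SheafOfModules.free I)
    rw [← Category.assoc, hι, Preadditive.comp_sum, Category.comp_id, Finset.sum_eq_single k]
    · have : M.unitHomEquiv.symm (s k) ≫ coordHom M s h k = 𝟙 _ := by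
        rw [SheafOfModules.unitHomEquiv_symm_comp, Equiv.symm_apply_eq]
        refine PresheafOfModules.sections_ext _ _ fun U => ?_
        change (basisEquiv M s h U).symm ((s k).eval U) k = 1
        rw [hs, Pi.single_eq_same]
      rw [← Category.assoc, this, Category.id_comp]
    · intro b _ hb
      have : M.unitHomEquiv.symm (s k) ≫ coordHom M s h b = 0 := by
        rw [SheafOfModules.unitHomEquiv_symm_comp, Equiv.symm_apply_eq]
        refine PresheafOfModules.sections_ext _ _ fun U => ?_
        change (basisEquiv M s h U).symm ((s k).eval U) b = 0
        rw [hs, Pi.single_eq_of_ne hb]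
      rw [← Category.assoc, this, Limits.zero_comp]
    · simp
  · rw [Preadditive.sum_comp]
    simp only [Category.assoc, hι]
    refine SheafOfModules.hom_ext ?_
    have hval : (∑ i, coordHom M s h i ≫ M.unitHomEquiv.symm (s i)).val =
        ∑ i, (coordHom M s h i ≫ M.unitHomEquiv.symm (s i)).val :=
      map_sum ((SheafOfModules.forget R).mapAddHom (X := M) (Y := M)) _ _
    rw [hval]
    refine PresheafOfModules.hom_ext fun U => ?_
    have happ : (∑ i, (coordHom M s h i ≫ M.unitHomEquiv.symm (s i)).val).app U =
        ∑ i, (coordHom M s h i ≫ M.unitHomEquiv.symm (s i)).val.app U :=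
      map_sum ((PresheafOfModules.evaluation R.obj U).mapAddHom (X := M.val) (Y := M.val)) _ _
    rw [happ]
    ext m
    rw [ModuleCat.hom_sum, LinearMap.sum_apply]
    exact (basisEquiv M s h U).apply_symm_apply m

end Free

namespace AdicSpace

variable {X : AdicSpace.{u}} {d : ℕ}

theorem isLocallyFreeOfRank_of_isBasisOn (M : X.Modules)
    (hM : ∀ x : X.carrier, ∃ (U : Opens X.carrier) (b : Fin d → Sec (Modules.toPresheaf M) U),
      x ∈ U ∧ IsBasisOn (Modules.toPresheaf M) U b) : IsLocallyFreeOfRank M d := by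
  choose U b hx hb using hM
  let s : ∀ x : X.carrier, ULift.{u} (Fin d) → (M.over (U x)).sections := fun x i =>
    PresheafOfModules.sectionsMk
      (fun W => (res (Modules.toPresheaf M) W.unop.hom.le (b x i.down) : Sec _ W.unop.left))
      (fun {V W} g => res_res (Modules.toPresheaf M) V.unop.hom.le g.unop.left.le (b x i.down))
  have hs : ∀ x, IsIso ((M.over (U x)).freeHomEquiv.symm (s x)) := fun x => by
    refine isIso_freeHomEquiv_symm _ _ fun W => ?_
    have := (hb x W.unop.left W.unop.hom.le).comp
      (Equiv.arrowCongr (Equiv.ulift.{u} (α := Fin d)) (Equiv.refl (O X W.unop.left))).bijective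
    have key : Function.Bijective fun c : ULift.{u} (Fin d) → O X W.unop.left =>
        ∑ i, c i • res (Modules.toPresheaf M) W.unop.hom.le (b x i.down) := by
      convert this using 2 with c
      exact (Equiv.sum_comp Equiv.ulift.{u}.symm (fun i : ULift.{u} (Fin d) =>
        c i • res (Modules.toPresheaf M) W.unop.hom.le (b x i.down))).symm
    exact key
  let q : SheafOfModules.LocalGeneratorsData.{u} M :=
    { I := X.carrier
      X := U
      coversTop := fun V x hxV => ⟨V ⊓ U x, homOfLE inf_le_left,
        ⟨x, ⟨homOfLE inf_le_right⟩⟩, hxV, hx x⟩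
      generators := fun x =>
        { I := ULift.{u} (Fin d)
          s := s x
          epi := have := hs x; inferInstance } }
  exact ⟨q, { isIso := hs }, fun _ => ⟨Equiv.ulift⟩⟩

end AdicSpace

/-! ### The discriminant of an étale algebra -/

/-- An étale algebra over an algebraically closed field `K` is a power of `K`, whose standard basis
has discriminant `1`. -/
theorem discr_ne_zero_of_isAlgClosed {K A : Type*} [Field K] [IsAlgClosed K] [CommRing A]
    [Algebra K A] [Algebra.Etale K A] {n : ℕ} (b : Module.Basis (Fin n) K A) :
    Algebra.discr K b ≠ 0 := by
  classical
  have : Module.Finite K A := Module.Finite.of_basis b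
  have : IsArtinianRing A := IsArtinianRing.of_finite K A
  let e := Algebra.FormallyEtale.equivPiOfIsSepClosed K A
  have : Fintype (PrimeSpectrum A) := Fintype.ofFinite _
  let c : Module.Basis (PrimeSpectrum A) K A := (Pi.basisFun K _).map e.symm.toLinearEquiv
  let σ : PrimeSpectrum A ≃ Fin n := Fintype.equivFinOfCardEq (by
    rw [← Module.finrank_eq_card_basis c, Module.finrank_eq_card_basis b, Fintype.card_fin])
  have hc : Algebra.discr K c = 1 := by
    have : (c : PrimeSpectrum A → A) = e.symm ∘ (Pi.basisFun K (PrimeSpectrum A)) := by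
      ext i; simp [c]
    rw [this]
    rw [← Algebra.discr_eq_discr_of_algEquiv, Algebra.discr_def]
    refine (congrArg Matrix.det ?_).trans Matrix.det_one
    ext i j
    rw [Algebra.traceMatrix_apply, Algebra.traceForm_apply,
      Algebra.trace_eq_matrix_trace (Pi.basisFun K _), Matrix.trace]
    simp only [Pi.basisFun_apply, Matrix.diag_apply, Algebra.leftMulMatrix_eq_repr_mul,
      Pi.basisFun_repr, Pi.mul_apply, Matrix.one_apply]
    simp [Pi.single_apply, eq_comm]
  rw [discr_eq_det_sq_mul (c.reindex σ) b]
  have h1 : Algebra.discr K (c.reindex σ) = 1 := by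
    rw [Module.Basis.coe_reindex, Algebra.discr_reindex, hc]
  rw [h1, mul_one]
  exact pow_ne_zero _ ((c.reindex σ).isUnit_det b).ne_zero

/-- The discriminant does not vanish at a geometric point, since it commutes with base change. -/
theorem algebraMap_discr_ne_zero {R S K : Type*} [CommRing R] [CommRing S] [Algebra R S]
    [Algebra.Etale R S] [Field K] [IsAlgClosed K] [Algebra R K] {n : ℕ}
    (b : Module.Basis (Fin n) R S) : algebraMap R K (Algebra.discr R b) ≠ 0 := by
  have : Algebra.discr K (b.baseChange K) = algebraMap R K (Algebra.discr R b) :=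
    discr_map_of_basis b (b.baseChange K) (algebraMap R K)
      (Algebra.TensorProduct.includeRight : S →ₐ[R] TensorProduct R K S).toRingHom
      (fun r => by simp [Algebra.algebraMap_eq_smul_one, Algebra.TensorProduct.one_def,
        TensorProduct.smul_tmul']) (fun i => by simp)
  rw [← this]
  exact discr_ne_zero_of_isAlgClosed _

/-- The discriminant of a basis of an étale algebra is a unit, as it lies in no maximal ideal. -/
theorem isUnit_discr_of_etale {R S : Type*} [CommRing R] [CommRing S] [Algebra R S]
    [Algebra.Etale R S] {n : ℕ} (b : Module.Basis (Fin n) R S) : IsUnit (Algebra.discr R b) := by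
  by_contra h
  obtain ⟨m, hm, hbm⟩ := exists_max_ideal_of_mem_nonunits h
  let _ := Ideal.Quotient.field m
  let _ : Algebra R (AlgebraicClosure (R ⧸ m)) :=
    ((algebraMap (R ⧸ m) (AlgebraicClosure (R ⧸ m))).comp (Ideal.Quotient.mk m)).toAlgebra
  refine algebraMap_discr_ne_zero (K := AlgebraicClosure (R ⧸ m)) b ?_
  rw [RingHom.algebraMap_toAlgebra, RingHom.comp_apply, Ideal.Quotient.eq_zero_iff_mem.2 hbm,
    map_zero]

/-! ### Bounded sets and power-bounded elements -/

section Bounded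

variable {L : Type u} [CommRing L] [TopologicalSpace L]

/-- A subset `S` of a topological ring is bounded if for every neighbourhood `U` of zero there is
a neighbourhood `V` of zero with `V · S ⊆ U`. -/
def IsBoundedSet (S : Set L) : Prop :=
  ∀ U ∈ 𝓝 (0 : L), ∃ V ∈ 𝓝 (0 : L), ∀ v ∈ V, ∀ s ∈ S, v * s ∈ U

theorem IsBoundedSet.mono {S S' : Set L} (h : IsBoundedSet S) (hS : S' ⊆ S) : IsBoundedSet S' :=
  fun U hU => let ⟨V, hV, h'⟩ := h U hU; ⟨V, hV, fun v hv s hs => h' v hv s (hS hs)⟩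

theorem IsBoundedSet.isPowerBounded {R : Subring L} (h : IsBoundedSet (R : Set L)) {a : L}
    (ha : a ∈ R) : IsPowerBounded a :=
  fun U hU => let ⟨V, hV, h'⟩ := h U hU; ⟨V, hV, fun v hv n => h' v hv _ (pow_mem ha n)⟩

open Filter in
theorem tendsto_pow_mul {p g : L} (hp : IsPowerBounded p)
    (hg : Tendsto (g ^ · : ℕ → L) atTop (𝓝 0)) :
    Tendsto ((p * g) ^ · : ℕ → L) atTop (𝓝 0) := by
  intro U hU
  obtain ⟨V, hV, h⟩ := hp U hU
  change ∀ᶠ k in atTop, (p * g) ^ k ∈ U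
  filter_upwards [hg hV] with k hk
  rw [mul_pow, mul_comm]
  exact h _ hk k

variable [NonarchimedeanRing L]

/-- The product of two bounded sets generates a bounded subgroup. -/
theorem IsBoundedSet.closure_image2 {S S' : Set L} (h : IsBoundedSet S) (h' : IsBoundedSet S') :
    IsBoundedSet (AddSubgroup.closure (Set.image2 (· * ·) S S') : Set L) := by
  intro U hU
  obtain ⟨U', hU'⟩ := NonarchimedeanRing.is_nonarchimedean U hU
  obtain ⟨V, hV, hVS⟩ := h' U' U'.mem_nhds_zero
  obtain ⟨W, hW, hWS⟩ := h V hV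
  refine ⟨W, hW, fun v hv s hs => hU' ?_⟩
  have : AddSubgroup.closure (Set.image2 (· * ·) S S') ≤
      (U' : AddSubgroup L).comap (AddMonoidHom.mulLeft v) := by
    refine (AddSubgroup.closure_le _).2 ?_
    rintro _ ⟨a, ha, b, hb, rfl⟩
    change v * (a * b) ∈ U'
    rw [← mul_assoc]
    exact hVS _ (hWS v hv a ha) b hb
  exact this hs

theorem isBoundedSet_finite {S : Set L} (hS : S.Finite) : IsBoundedSet S := by
  intro U hU
  refine ⟨⋂ s ∈ S, (· * s) ⁻¹' U, (Filter.biInter_mem hS).2 fun s _ => ?_, fun v hv s hs => ?_⟩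
  · exact (continuous_mul_const s).continuousAt.preimage_mem_nhds (by simpa using hU)
  · exact Set.mem_iInter₂.1 hv s hs

theorem isBoundedSet_bot : IsBoundedSet ((⊥ : Subring L) : Set L) := by
  intro U hU
  obtain ⟨U', hU'⟩ := NonarchimedeanRing.is_nonarchimedean U hU
  refine ⟨U', U'.mem_nhds_zero, fun v hv s hs => hU' ?_⟩
  obtain ⟨n, rfl⟩ := Subring.mem_bot.1 hs
  rw [mul_comm, ← zsmul_eq_mul]
  exact zsmul_mem hv n

/-- Adjoining a power-bounded element `c` to a bounded subring `R` gives a bounded subring, because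
every element of `R[c]` is a sum of products `r cⁿ`. -/
theorem IsBoundedSet.closure_insert {R : Subring L} (hR : IsBoundedSet (R : Set L)) {c : L}
    (hc : IsPowerBounded c) : IsBoundedSet (Subring.closure (insert c (R : Set L)) : Set L) := by
  have hpow : IsBoundedSet (Set.range (c ^ · : ℕ → L)) := fun U hU => by
    obtain ⟨V, hV, h⟩ := hc U hU
    refine ⟨V, hV, ?_⟩
    rintro v hv _ ⟨n, rfl⟩
    exact h v hv n
  refine (hR.closure_image2 hpow).mono ?_
  intro x hx
  have hgen : ∀ r ∈ R, ∀ n : ℕ, r * c ^ n ∈ AddSubgroup.closure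
      (Set.image2 (· * ·) (R : Set L) (Set.range (c ^ · : ℕ → L))) := fun r hr n =>
    AddSubgroup.subset_closure ⟨r, hr, _, ⟨n, rfl⟩, rfl⟩
  have hmul : ∀ x ∈ AddSubgroup.closure
      (Set.image2 (· * ·) (R : Set L) (Set.range (c ^ · : ℕ → L))), ∀ y ∈ AddSubgroup.closure
      (Set.image2 (· * ·) (R : Set L) (Set.range (c ^ · : ℕ → L))), x * y ∈ AddSubgroup.closure
      (Set.image2 (· * ·) (R : Set L) (Set.range (c ^ · : ℕ → L))) := by
    intro x hx y hy
    induction hx, hy using AddSubgroup.closure_induction₂ with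
    | mem x y hx hy =>
      obtain ⟨r, hr, _, ⟨n, rfl⟩, rfl⟩ := hx
      obtain ⟨r', hr', _, ⟨n', rfl⟩, rfl⟩ := hy
      have := hgen _ (mul_mem hr hr') (n + n')
      rwa [pow_add, mul_mul_mul_comm] at this
    | zero_left => simp
    | zero_right => simp
    | add_left x y z _ _ _ h h' => rw [add_mul]; exact add_mem h h'
    | add_right x y z _ _ _ h h' => rw [mul_add]; exact add_mem h h'
    | neg_left x y _ _ h => rw [neg_mul]; exact neg_mem h
    | neg_right x y _ _ h => rw [mul_neg]; exact neg_mem h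
  change x ∈ AddSubgroup.closure _
  induction hx using Subring.closure_induction with
  | mem x hx =>
    rcases hx with rfl | hx
    · simpa using hgen 1 (one_mem R) 1
    · simpa using hgen x hx 0
  | zero => exact zero_mem _
  | one => simpa using hgen 1 (one_mem R) 0
  | add x y _ _ h h' => exact add_mem h h'
  | neg x _ h => exact neg_mem h
  | mul x y _ _ h h' => exact hmul x h y h'

/-- A finite set of power-bounded elements generates a bounded subring. -/
theorem isBoundedSet_closure_finset (F : Finset L) (hF : ∀ a ∈ F, IsPowerBounded a) :
    IsBoundedSet (Subring.closure (F : Set L) : Set L) := by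
  classical
  induction F using Finset.induction_on with
  | empty => simpa using isBoundedSet_bot
  | insert a F _ ih =>
    refine ((ih fun b hb => hF b (Finset.mem_insert_of_mem hb)).closure_insert
      (hF a (Finset.mem_insert_self a F))).mono ?_
    refine Subring.closure_mono ?_
    rw [Finset.coe_insert]
    exact Set.insert_subset_insert Subring.subset_closure

/-- The powers of an element which is integral over a bounded subring lie in a finitely generated
module over it. -/
theorem IsBoundedSet.isPowerBounded_of_isIntegral {R : Subring L}
    (hR : IsBoundedSet (R : Set L)) {c : L} (hc : IsIntegral R c) : IsPowerBounded c := by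
  obtain ⟨S, hS⟩ := hc.fg_adjoin_singleton
  have hb := hR.closure_image2 (isBoundedSet_finite S.finite_toSet)
  intro U hU
  obtain ⟨V, hV, h⟩ := hb U hU
  refine ⟨V, hV, fun v hv n => h v hv _ ?_⟩
  have hn : c ^ n ∈ Submodule.span R (S : Set L) := by
    rw [hS, Subalgebra.mem_toSubmodule]
    exact Subalgebra.pow_mem _ (Algebra.self_mem_adjoin_singleton R c) n
  change c ^ n ∈ AddSubgroup.closure _
  generalize c ^ n = x at hn
  refine Submodule.closure_induction (p := fun x _ => x ∈ AddSubgroup.closure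
    (Set.image2 (· * ·) (R : Set L) (S : Set L))) ?_ ?_ ?_ hn
  · exact zero_mem _
  · exact fun x y _ _ h h' => add_mem h h'
  · intro r x hx
    exact AddSubgroup.subset_closure ⟨r, r.2, x, hx, rfl⟩

variable (L) in
/-- The subring of power-bounded elements. -/
def powerBounded : Subring L where
  carrier := {a | IsPowerBounded a}
  one_mem' := isBoundedSet_bot.isPowerBounded (one_mem _)
  zero_mem' := isBoundedSet_bot.isPowerBounded (zero_mem _)
  neg_mem' {a} ha := (isBoundedSet_closure_finset {a} (by simpa using ha)).isPowerBounded
    (neg_mem (Subring.subset_closure (by simp)))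
  add_mem' {a b} ha hb := by
    classical
    exact (isBoundedSet_closure_finset {a, b} (by simpa using ⟨ha, hb⟩)).isPowerBounded
      (add_mem (Subring.subset_closure (by simp)) (Subring.subset_closure (by simp)))
  mul_mem' {a b} ha hb := by
    classical
    exact (isBoundedSet_closure_finset {a, b} (by simpa using ⟨ha, hb⟩)).isPowerBounded
      (mul_mem (Subring.subset_closure (by simp)) (Subring.subset_closure (by simp)))

/-- The ring of power-bounded elements is integrally closed: the coefficients of an integral
equation generate a bounded subring, over which the given element is still integral. -/
theorem mem_powerBounded_of_isIntegral {c : L} (hc : IsIntegral (powerBounded L) c) :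
    c ∈ powerBounded L := by
  obtain ⟨p, hp, hpc⟩ := hc
  let q : Polynomial L := p.map (powerBounded L).subtype
  let R := Subring.closure (q.coeffs : Set L)
  have hb : IsBoundedSet (R : Set L) := isBoundedSet_closure_finset _ fun a ha => by
    obtain ⟨n, -, rfl⟩ := Polynomial.mem_coeffs_iff.1 ha
    rw [Polynomial.coeff_map]
    exact (p.coeff n).2
  have hq : (q.coeffs : Set L) ⊆ R := Subring.subset_closure
  refine hb.isPowerBounded_of_isIntegral ⟨q.toSubring R hq, ?_, ?_⟩
  · rw [Polynomial.monic_toSubring]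
    exact hp.map _
  · have h : (q.toSubring R hq).map R.subtype = q := Polynomial.map_toSubring _ _ _
    change Polynomial.eval₂ R.subtype c _ = 0
    rw [← Polynomial.eval_map, h, Polynomial.eval_map]
    exact hpc

open Filter in
theorem tendsto_pow_add {x y : L} (hx : IsPowerBounded x) (hy : IsPowerBounded y)
    (hx' : Tendsto (x ^ · : ℕ → L) atTop (𝓝 0)) (hy' : Tendsto (y ^ · : ℕ → L) atTop (𝓝 0)) :
    Tendsto ((x + y) ^ · : ℕ → L) atTop (𝓝 0) := by
  classical
  intro U hU
  obtain ⟨U', hU'⟩ := NonarchimedeanRing.is_nonarchimedean U hU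
  have hb := isBoundedSet_closure_finset {x, y} (by simpa using ⟨hx, hy⟩)
  obtain ⟨V, hV, h⟩ := hb U' U'.mem_nhds_zero
  obtain ⟨k, hk⟩ := eventually_atTop.1 (hx' hV)
  obtain ⟨l, hl⟩ := eventually_atTop.1 (hy' hV)
  have hxm : x ∈ Subring.closure (({x, y} : Finset L) : Set L) := Subring.subset_closure (by simp)
  have hym : y ∈ Subring.closure (({x, y} : Finset L) : Set L) := Subring.subset_closure (by simp)
  change ∀ᶠ m in atTop, (x + y) ^ m ∈ U
  filter_upwards [eventually_ge_atTop (k + l)] with m hm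
  refine hU' ?_
  change (x + y) ^ m ∈ (U' : AddSubgroup L)
  rw [add_pow]
  refine sum_mem fun i hi => ?_
  rw [Finset.mem_range] at hi
  by_cases hik : k ≤ i
  · rw [mul_assoc]
    exact h _ (hk i hik) _ (mul_mem (pow_mem hym _) (natCast_mem _ _))
  · rw [mul_comm (x ^ i), mul_assoc]
    exact h _ (hl (m - i) (by omega)) _ (mul_mem (pow_mem hxm _) (natCast_mem _ _))

end Bounded

/-! ### Valuation rings dominating a given ideal -/

section Field

/-- Let `M` be a `Q`-algebra. If the ideal `𝔞` of `Q` and the preimage of the ideal `𝔟` of `M` do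
not generate the unit ideal, then `M / 𝔟` maps to a field with a valuation subring that contains the
image of `Q` and whose maximal ideal contains the image of `𝔞`. -/
theorem exists_valuationSubring {Q M : Type u} [CommRing Q] [CommRing M] (π : Q →+* M)
    (𝔟 : Ideal M) (𝔞 : Ideal Q) (h : 𝔞 ⊔ 𝔟.comap π ≠ ⊤) :
    ∃ (K : Type u) (_ : Field K) (θ : M →+* K) (O : ValuationSubring K),
      (∀ b ∈ 𝔟, θ b = 0) ∧ (∀ q, θ (π q) ∈ O) ∧ ∀ q ∈ 𝔞, θ (π q) ∈ O.nonunits := by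
  obtain ⟨p, hp, hle⟩ := Ideal.exists_le_maximal _ h
  have hprime := hp.isPrime
  -- A prime of `M` containing `𝔟` whose preimage in `Q` is contained in `p`; the image of `p` in
  -- the residue field is then a proper ideal.
  obtain ⟨𝔔, h𝔔, hb𝔔, hdisj⟩ := Ideal.exists_le_prime_disjoint 𝔟 (p.primeCompl.map π) (by
    rw [Set.disjoint_left]
    rintro _ hx ⟨q, hq, rfl⟩
    exact hq (hle (Ideal.mem_sup_right hx)))
  let θ : M →+* FractionRing (M ⧸ 𝔔) := (algebraMap (M ⧸ 𝔔) _).comp (Ideal.Quotient.mk 𝔔)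
  have hθ : ∀ m, θ m = 0 → m ∈ 𝔔 := fun m hm => by
    rw [← Ideal.Quotient.eq_zero_iff_mem]
    exact (IsFractionRing.injective (M ⧸ 𝔔) (FractionRing (M ⧸ 𝔔))) (hm.trans (map_zero _).symm)
  have hker : ∀ q, θ (π q) = 0 → q ∈ p := fun q hq => by
    by_contra hqp
    exact Set.disjoint_left.1 hdisj (hθ _ hq) ⟨q, hqp, rfl⟩
  let σ := (θ.comp π).rangeRestrict
  have hσ : Function.Surjective σ := (θ.comp π).rangeRestrict_surjective
  have hne : p.map σ ≠ ⊤ := by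
    rw [Ideal.ne_top_iff_one, Ideal.mem_map_iff_of_surjective σ hσ]
    rintro ⟨q, hq, hq1⟩
    have h1 : θ (π q) = 1 := congrArg Subtype.val hq1
    have h2 : q - 1 ∈ p := hker _ (by simp [h1])
    refine hp.ne_top ((Ideal.eq_top_iff_one p).2 ?_)
    have := p.sub_mem hq h2
    simpa using this
  obtain ⟨O, hO, hnon⟩ := Ideal.image_subset_nonunits_valuationSubring (p.map σ) hne
  refine ⟨_, inferInstance, θ, O, fun b hb => ?_, fun q => hO ⟨q, rfl⟩, fun q hq => hnon ?_⟩
  · change algebraMap _ _ (Ideal.Quotient.mk 𝔔 b) = 0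
    rw [Ideal.Quotient.eq_zero_iff_mem.2 (hb𝔔 hb), map_zero]
  · exact ⟨σ q, Ideal.mem_map_of_mem σ (hle (Ideal.mem_sup_left hq)), rfl⟩

end Field

/-! ### Topologically nilpotent generators of an ideal of definition -/

/-- There are generators `G` of an ideal of definition which is contained in `A⁺`. The open
subgroups `V k` are the powers of this ideal (with `V 0` the first power), so that
`V (k + 1) = V k · G`. -/
theorem exists_topNilpotent_generators (A : HuberPair.{u}) :
    ∃ (G : Finset A) (V : ℕ → AddSubgroup A), (∀ g ∈ G, g ∈ A.plus) ∧
      (∀ g ∈ G, Filter.Tendsto (g ^ · : ℕ → A) Filter.atTop (𝓝 0)) ∧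
      (∀ k, IsOpen (V k : Set A)) ∧ (∀ a ∈ V 0, a ∈ A.plus) ∧
      ∀ k, V (k + 1) ≤ AddSubgroup.closure (Set.image2 (· * ·) (V k : Set A) (G : Set A)) := by
  obtain ⟨A₀, I, hA₀, hI, hadic⟩ := IsHuberRing.exists_ringOfDefinition (A := A)
  rw [isAdic_iff] at hadic
  obtain ⟨h1, h2⟩ := hadic
  let J : ℕ → AddSubgroup A := fun n => ((I ^ n).toAddSubgroup).map A₀.subtype.toAddMonoidHom
  have memJ : ∀ n (a : A₀), a ∈ I ^ n → (a : A) ∈ J n := fun n a ha => ⟨a, ha, rfl⟩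
  have hopen : ∀ n, IsOpen (J n : Set A) := fun n => hA₀.isOpenMap_subtype_val _ (h1 n)
  have hsub : ∀ U ∈ 𝓝 (0 : A), ∃ n, (J n : Set A) ⊆ U := fun U hU => by
    have : (A₀.subtype ⁻¹' U) ∈ 𝓝 (0 : A₀) :=
      continuous_subtype_val.continuousAt.preimage_mem_nhds (by simpa using hU)
    obtain ⟨n, hn⟩ := h2 _ this
    refine ⟨n, ?_⟩
    rintro _ ⟨b, hb, rfl⟩
    exact hn hb
  have hanti : ∀ m n, m ≤ n → J n ≤ J m := fun m n hmn => by
    rintro _ ⟨b, hb, rfl⟩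
    exact memJ m b (Ideal.pow_le_pow_right hmn hb)
  obtain ⟨N₀, hN₀⟩ := hsub _ (A.isOpen_plus.mem_nhds (zero_mem A.plus))
  -- The ideal `I ^ N` is contained in `A⁺`; the successor ensures that its exponent is positive.
  let N := N₀ + 1
  have hN : ∀ a ∈ J N, a ∈ A.plus := fun a ha => hN₀ (hanti N₀ N (Nat.le_succ _) ha)
  classical
  obtain ⟨G, hG⟩ : (I ^ N).FG := hI.pow
  have hGJ : ∀ g ∈ G, g ∈ I ^ N := fun g hg => hG ▸ Ideal.subset_span hg
  refine ⟨G.image A₀.subtype, fun k => J (N * (k + 1)), ?_, ?_, fun k => hopen _, ?_, ?_⟩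
  · intro a ha
    obtain ⟨g, hg, rfl⟩ := Finset.mem_image.1 ha
    exact hN _ (memJ N g (hGJ g hg))
  · intro a ha U hU
    obtain ⟨g, hg, rfl⟩ := Finset.mem_image.1 ha
    obtain ⟨n, hn⟩ := hsub U hU
    change ∀ᶠ k in Filter.atTop, (A₀.subtype g) ^ k ∈ U
    filter_upwards [Filter.eventually_ge_atTop n] with k hk
    refine hn (hanti n (N * k) (hk.trans (Nat.le_mul_of_pos_left k (Nat.succ_pos _))) ?_)
    refine memJ (N * k) (g ^ k) ?_
    rw [pow_mul]
    exact Ideal.pow_mem_pow (hGJ g hg) k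
  · intro a ha
    exact hN a (by simpa using ha)
  · rintro k _ ⟨b, hb, rfl⟩
    change b ∈ I ^ (N * (k + 1 + 1)) at hb
    rw [mul_add N (k + 1), mul_one, pow_add] at hb
    refine Submodule.mul_induction_on hb ?_ ?_
    · intro p hp q hq
      rw [← hG] at hq
      change (p * q : A₀).1 ∈ _
      clear hb b
      induction hq using Submodule.span_induction generalizing p with
      | mem x hx =>
        exact AddSubgroup.subset_closure ⟨p, memJ _ p hp, x,
          Finset.mem_coe.2 (Finset.mem_image_of_mem _ hx), rfl⟩
      | zero => simp
      | add x y _ _ hx hy =>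
        rw [mul_add]
        exact add_mem (hx p hp) (hy p hp)
      | smul c x _ hx =>
        have := hx (p * c) (Ideal.mul_mem_right c _ hp)
        rwa [mul_assoc] at this
    · intro x y hx hy
      exact add_mem hx hy

/-! ### The ring of integral elements of a rational localization -/

namespace RatData

variable {A : HuberPair.{u}} (τ : RatData A)

instance : NonarchimedeanRing τ.Loc := τ.ringSubgroupsBasis.nonarchimedean

theorem continuous_algebraMap : Continuous (algebraMap A τ.Loc) := by
  refine continuous_of_continuousAt_zero _ ?_
  rw [ContinuousAt, map_zero, τ.hasBasis_nhds_zero.tendsto_right_iff]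
  intro U _
  filter_upwards [U.mem_nhds_zero] with a ha
  simpa using mul_mem_basicSubgroup (one_mem τ.fracSubring) ha

/-- The subring generated by the fractions `t / s` is bounded, by the definition of the topology. -/
theorem isBoundedSet_fracSubring : IsBoundedSet (τ.fracSubring : Set τ.Loc) := by
  intro W hW
  obtain ⟨U, -, hU⟩ := τ.hasBasis_nhds_zero.mem_iff.1 hW
  refine ⟨_, τ.hasBasis_nhds_zero.mem_of_mem (i := U) trivial, fun v hv d hd => hU ?_⟩
  rw [mul_comm]
  refine mul_mem_of_forall (U := U) d (fun d' hd' a ha => ?_) hv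
  rw [← mul_assoc]
  exact mul_mem_basicSubgroup (mul_mem hd hd') ha

theorem isPowerBounded_algebraMap {a : A} (ha : IsPowerBounded a) :
    IsPowerBounded (algebraMap A τ.Loc a) := by
  intro W hW
  obtain ⟨U, -, hU⟩ := τ.hasBasis_nhds_zero.mem_iff.1 hW
  obtain ⟨V, hV, h⟩ := ha U U.mem_nhds_zero
  obtain ⟨V', hV'⟩ := NonarchimedeanRing.is_nonarchimedean V hV
  refine ⟨_, τ.hasBasis_nhds_zero.mem_of_mem (i := V') trivial, fun v hv n => hU ?_⟩
  rw [mul_comm]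
  refine mul_mem_of_forall (U := V') _ (fun d hd b hb => ?_) hv
  rw [mul_left_comm, ← map_pow, ← map_mul, mul_comm (a ^ n)]
  exact mul_mem_basicSubgroup hd (h b (hV' hb) n)

/-- The ring of integral elements of `A(T/s)`: the integral closure of the subring generated by
the fractions `t / s` and `A⁺`. -/
def plusLoc : Subring τ.Loc :=
  (integralClosure (τ.fracSubring ⊔ A.plus.map (algebraMap A τ.Loc) : Subring τ.Loc)
    τ.Loc).toSubring

theorem mem_plusLoc_of_mem {a : τ.Loc}
    (ha : a ∈ τ.fracSubring ⊔ A.plus.map (algebraMap A τ.Loc)) : a ∈ τ.plusLoc :=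
  isIntegral_algebraMap (R := (τ.fracSubring ⊔ A.plus.map (algebraMap A τ.Loc) : Subring τ.Loc))
    (A := τ.Loc) (x := ⟨a, ha⟩)

theorem fracSubring_le_plusLoc : τ.fracSubring ≤ τ.plusLoc := fun _ ha =>
  τ.mem_plusLoc_of_mem ((le_sup_left : τ.fracSubring ≤ _) ha)

theorem algebraMap_mem_plusLoc {a : A} (ha : a ∈ A.plus) : algebraMap A τ.Loc a ∈ τ.plusLoc :=
  τ.mem_plusLoc_of_mem ((le_sup_right : A.plus.map (algebraMap A τ.Loc) ≤ _) ⟨a, ha, rfl⟩)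

theorem mem_plusLoc_of_isIntegral {a : τ.Loc} (ha : IsIntegral τ.plusLoc a) : a ∈ τ.plusLoc :=
  isIntegral_trans (R := (τ.fracSubring ⊔ A.plus.map (algebraMap A τ.Loc) : Subring τ.Loc))
    (A := integralClosure (τ.fracSubring ⊔ A.plus.map (algebraMap A τ.Loc) : Subring τ.Loc)
    τ.Loc) a ha

theorem isPowerBounded_of_mem_plusLoc {a : τ.Loc} (ha : a ∈ τ.plusLoc) : IsPowerBounded a := by
  have hle : τ.fracSubring ⊔ A.plus.map (algebraMap A τ.Loc) ≤ powerBounded τ.Loc := by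
    refine sup_le (fun d hd => τ.isBoundedSet_fracSubring.isPowerBounded hd) ?_
    rintro _ ⟨a, ha, rfl⟩
    exact τ.isPowerBounded_algebraMap (A.isPowerBounded_of_mem_plus a ha)
  refine mem_powerBounded_of_isIntegral (L := τ.Loc) ?_
  obtain ⟨p, hp, h⟩ := ha
  refine ⟨p.map (Subring.inclusion hle), hp.map _, ?_⟩
  rw [Polynomial.eval₂_map]
  exact h

end RatData

/-! ### Continuous quotients of valuations -/
namespace RatData

variable {A : HuberPair.{u}} (τ : RatData A)

/-- The ideal of `plusLoc` generated by the images of `G`. -/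
def idealOfGens (G : Finset A) : Ideal τ.plusLoc :=
  Ideal.span {p | ∃ g ∈ G, (p : τ.Loc) = algebraMap A τ.Loc g}

theorem fg_idealOfGens (G : Finset A) : (τ.idealOfGens G).FG := by
  refine ⟨Set.Finite.toFinset (s := {p : τ.plusLoc | ∃ g ∈ G, (p : τ.Loc) = algebraMap A τ.Loc g})
    ?_, by rw [Set.Finite.coe_toFinset]; rfl⟩
  refine ((G.finite_toSet.image (algebraMap A τ.Loc)).preimage
    Subtype.val_injective.injOn).subset ?_
  rintro p ⟨g, hg, hp⟩
  exact ⟨g, hg, hp.symm⟩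

/-- The elements of `plusLoc` which multiply `a` into `plusLoc`. -/
def denomIdeal (a : τ.Loc) : Ideal τ.plusLoc where
  carrier := {p | (p : τ.Loc) * a ∈ τ.plusLoc}
  zero_mem' := by simp [zero_mem]
  add_mem' {p q} hp hq := by
    change (p + q : τ.Loc) * a ∈ τ.plusLoc
    rw [add_mul]
    exact add_mem hp hq
  smul_mem' c p hp := by
    change (c * p : τ.Loc) * a ∈ τ.plusLoc
    rw [mul_assoc]
    exact mul_mem c.2 hp

variable {G : Finset A} (hG : ∀ g ∈ G, g ∈ A.plus)
  (hG' : ∀ g ∈ G, Filter.Tendsto (g ^ · : ℕ → A) Filter.atTop (𝓝 0))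

include hG' in
/-- A power of the ideal generated by `G` multiplies `a` into `plusLoc`. It suffices to show this
for `a ∈ A`, where it holds because `A⁺` is open, and for `1 / s`, where it holds because the ideal
generated by `T` is open. -/
theorem exists_pow_le_denomIdeal (a : τ.Loc) : ∃ k, τ.idealOfGens G ^ k ≤ τ.denomIdeal a := by
  have hsuff : ∀ a : τ.Loc, (∀ g ∈ G, ∃ k, algebraMap A τ.Loc g ^ k * a ∈ τ.plusLoc) →
      ∃ k, τ.idealOfGens G ^ k ≤ τ.denomIdeal a := by
    intro a ha
    refine Ideal.exists_pow_le_of_le_radical_of_fg (Ideal.span_le.2 ?_) (τ.fg_idealOfGens G)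
    rintro p ⟨g, hg, hp⟩
    obtain ⟨k, hk⟩ := ha g hg
    refine ⟨k, ?_⟩
    change ((p ^ k : τ.plusLoc) : τ.Loc) * a ∈ τ.plusLoc
    rwa [SubmonoidClass.coe_pow, hp]
  have hmul : ∀ a b : τ.Loc, (∃ k, τ.idealOfGens G ^ k ≤ τ.denomIdeal a) →
      (∃ k, τ.idealOfGens G ^ k ≤ τ.denomIdeal b) →
      ∃ k, τ.idealOfGens G ^ k ≤ τ.denomIdeal (a * b) := by
    rintro a b ⟨k, hk⟩ ⟨l, hl⟩
    refine ⟨k + l, ?_⟩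
    rw [pow_add, Ideal.mul_le]
    intro p hp q hq
    change (p * q : τ.Loc) * (a * b) ∈ τ.plusLoc
    rw [mul_mul_mul_comm]
    exact mul_mem (hk hp) (hl hq)
  have hA : ∀ a : A, ∃ k, τ.idealOfGens G ^ k ≤ τ.denomIdeal (algebraMap A τ.Loc a) := by
    refine fun a => hsuff _ fun g hg => ?_
    have : Filter.Tendsto (fun k => g ^ k * a) Filter.atTop (𝓝 0) := by
      simpa using (hG' g hg).mul_const a
    obtain ⟨k, hk⟩ := (this.eventually_mem (A.isOpen_plus.mem_nhds (zero_mem A.plus))).exists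
    refine ⟨k, ?_⟩
    rw [← map_pow, ← map_mul]
    exact τ.algebraMap_mem_plusLoc hk
  have hs : ∃ k, τ.idealOfGens G ^ k ≤ τ.denomIdeal τ.sInv := by
    refine hsuff _ fun g hg => ?_
    obtain ⟨V, hV⟩ := exists_subset_closure_mul (τ.T : Set A) τ.isOpen_span
      ⟨A.plus.toAddSubgroup, A.isOpen_plus⟩
    obtain ⟨k, hk⟩ := ((hG' g hg).eventually_mem V.mem_nhds_zero).exists
    refine ⟨k, ?_⟩
    have hle : AddSubgroup.closure (Set.image2 (· * ·) (τ.T : Set A) (A.plus : Set A)) ≤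
        (τ.plusLoc.toAddSubgroup).comap
          ((AddMonoidHom.mulRight τ.sInv).comp (algebraMap A τ.Loc).toAddMonoidHom) := by
      refine (AddSubgroup.closure_le _).2 ?_
      rintro _ ⟨t, ht, u, hu, rfl⟩
      change algebraMap A τ.Loc (t * u) * τ.sInv ∈ τ.plusLoc
      rw [map_mul, mul_right_comm]
      exact mul_mem (τ.fracSubring_le_plusLoc (Subring.subset_closure ⟨t, ht, rfl⟩))
        (τ.algebraMap_mem_plusLoc hu)
    have := hle (hV hk)
    change algebraMap A τ.Loc (g ^ k) * τ.sInv ∈ τ.plusLoc at this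
    rwa [map_pow] at this
  obtain ⟨n, b, hb⟩ := IsLocalization.Away.surj τ.s a
  have ha : a = algebraMap A τ.Loc b * τ.sInv ^ n := by
    rw [← hb, mul_assoc, ← mul_pow, s_mul_sInv, one_pow, mul_one]
  rw [ha]
  clear ha hb
  induction n with
  | zero => simpa using hA b
  | succ n ih => rw [pow_succ, ← mul_assoc]; exact hmul _ _ ih hs

include hG in
/-- The powers of the ideal generated by `G` contain the images of a basis of neighbourhoods of zero
of `A`. -/
theorem exists_mem_pow_idealOfGens {V : ℕ → AddSubgroup A} (hV : ∀ a ∈ V 0, a ∈ A.plus)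
    (hV' : ∀ k, V (k + 1) ≤ AddSubgroup.closure (Set.image2 (· * ·) (V k : Set A) (G : Set A)))
    (k : ℕ) {a : A} (ha : a ∈ V k) :
    ∃ p ∈ τ.idealOfGens G ^ k, (p : τ.Loc) = algebraMap A τ.Loc a := by
  suffices V k ≤ ((τ.idealOfGens G ^ k).toAddSubgroup.map
      τ.plusLoc.subtype.toAddMonoidHom).comap (algebraMap A τ.Loc).toAddMonoidHom by
    obtain ⟨p, hp, h⟩ := this ha
    exact ⟨p, hp, h⟩
  clear ha a
  induction k with
  | zero =>
    intro a ha
    exact ⟨⟨_, τ.algebraMap_mem_plusLoc (hV a ha)⟩, by simp, rfl⟩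
  | succ k ih =>
    refine (hV' k).trans ((AddSubgroup.closure_le _).2 ?_)
    rintro _ ⟨a, ha, g, hg, rfl⟩
    obtain ⟨p, hp, h⟩ := ih ha
    refine ⟨p * ⟨_, τ.algebraMap_mem_plusLoc (hG g hg)⟩, ?_, ?_⟩
    · exact pow_succ (τ.idealOfGens G) k ▸ Ideal.mul_mem_mul hp
        (Ideal.subset_span ⟨g, hg, rfl⟩)
    · change (p : τ.Loc) * algebraMap A τ.Loc g = algebraMap A τ.Loc (a * g)
      rw [map_mul]
      exact congrArg (· * algebraMap A τ.Loc g) h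

include hG' in
theorem tendsto_pow_of_mem_idealOfGens {q : τ.plusLoc} (hq : q ∈ τ.idealOfGens G) :
    Filter.Tendsto ((q : τ.Loc) ^ · : ℕ → τ.Loc) Filter.atTop (𝓝 0) := by
  induction hq using Submodule.span_induction with
  | mem q hq =>
    obtain ⟨g, hg, hq⟩ := hq
    rw [hq]
    have := (τ.continuous_algebraMap.tendsto 0).comp (hG' g hg)
    rw [map_zero] at this
    refine this.congr fun k => ?_
    simp
  | zero =>
    refine tendsto_const_nhds.congr' ?_
    filter_upwards [Filter.eventually_ge_atTop 1] with k hk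
    simp [zero_pow (Nat.one_le_iff_ne_zero.1 hk)]
  | add x y _ _ hx hy =>
    exact tendsto_pow_add (τ.isPowerBounded_of_mem_plusLoc x.2)
      (τ.isPowerBounded_of_mem_plusLoc y.2) hx hy
  | smul c x _ hx => exact tendsto_pow_mul (τ.isPowerBounded_of_mem_plusLoc c.2) hx

section Val

variable {Γ : Type u} [LinearOrderedCommGroupWithZero Γ] (v : Valuation τ.Loc Γ)

variable (G) in
/-- `v(a)` bounds `v` on some power of the ideal generated by `G`, so `a`
keeps its value in the continuous quotient `contVal`. -/
def IsCofinal (a : τ.Loc) : Prop := ∃ k, ∀ q ∈ τ.idealOfGens G ^ k, v q ≤ v a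

variable {τ v} in
theorem IsCofinal.mono {a b : τ.Loc} (h : τ.IsCofinal G v a) (hab : v a ≤ v b) :
    τ.IsCofinal G v b :=
  let ⟨k, hk⟩ := h; ⟨k, fun q hq => (hk q hq).trans hab⟩

variable {v} in
theorem IsCofinal.of_one_le (hv : ∀ p ∈ τ.plusLoc, v p ≤ 1) {a : τ.Loc} (ha : 1 ≤ v a) :
    τ.IsCofinal G v a := ⟨0, fun q _ => (hv q q.2).trans ha⟩

variable {τ v} in
theorem IsCofinal.mul {a b : τ.Loc} (ha : τ.IsCofinal G v a) (hb : τ.IsCofinal G v b) :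
    τ.IsCofinal G v (a * b) := by
  obtain ⟨k, hk⟩ := ha
  obtain ⟨l, hl⟩ := hb
  refine ⟨k + l, fun q hq => ?_⟩
  rw [pow_add] at hq
  refine Submodule.mul_induction_on hq (fun p hp q hq => ?_) fun x y hx hy => ?_
  · change v (p * q : τ.Loc) ≤ _
    rw [map_mul, map_mul]
    exact mul_le_mul' (hk p hp) (hl q hq)
  · exact v.map_add_le hx hy

include hG' in
variable {v} in
theorem IsCofinal.exists_mul_le (hv : ∀ p ∈ τ.plusLoc, v p ≤ 1) {a : τ.Loc} (b : τ.Loc)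
    (ha : τ.IsCofinal G v a) : ∃ k, ∀ q ∈ τ.idealOfGens G ^ k, v (q * b) ≤ v a := by
  obtain ⟨k, hk⟩ := ha
  obtain ⟨l, hl⟩ := τ.exists_pow_le_denomIdeal hG' b
  refine ⟨k + l, fun q hq => ?_⟩
  rw [pow_add] at hq
  refine Submodule.mul_induction_on hq (fun p hp q hq => ?_) fun x y hx hy => ?_
  · change v ((p * q : τ.Loc) * b) ≤ _
    rw [mul_assoc, map_mul]
    exact (mul_le_of_le_one_right' (hv _ (hl hq))).trans (hk p hp)
  · change v ((x + y : τ.Loc) * b) ≤ _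
    rw [add_mul]
    exact v.map_add_le hx hy

include hG' in
variable {v} in
/-- Together with `IsCofinal.mul`, this makes `contVal` multiplicative. -/
theorem IsCofinal.of_mul (hv : ∀ p ∈ τ.plusLoc, v p ≤ 1) {a b : τ.Loc} (hb : v b ≠ 0)
    (h : τ.IsCofinal G v (a * b)) : τ.IsCofinal G v a := by
  obtain ⟨k, hk⟩ := IsCofinal.exists_mul_le τ hG' hv b h
  refine ⟨k, fun q hq => ?_⟩
  have := hk q hq
  rw [map_mul, map_mul] at this
  exact le_of_mul_le_mul_right this (zero_lt_iff.2 hb)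

open Classical in
/-- A continuous quotient of a valuation: values smaller than the values of all powers
of the ideal generated by `G` are replaced by zero. -/
def contVal (hv : ∀ p ∈ τ.plusLoc, v p ≤ 1) : Valuation τ.Loc Γ where
  toFun a := if τ.IsCofinal G v a then v a else 0
  map_zero' := by simp
  map_one' := by simp [IsCofinal.of_one_le τ hv (a := 1) (G := G) (by simp)]
  map_mul' a b := by
    by_cases h0 : v a = 0
    · simp [h0]
    by_cases h0' : v b = 0
    · simp [h0']
    by_cases ha : τ.IsCofinal G v a
    · by_cases hb : τ.IsCofinal G v b
      · simp [ha, hb, ha.mul hb]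
      · have : ¬ τ.IsCofinal G v (a * b) := fun h =>
          hb (IsCofinal.of_mul τ hG' hv h0 (mul_comm a b ▸ h))
        simp [hb, this]
    · have : ¬ τ.IsCofinal G v (a * b) := fun h => ha (IsCofinal.of_mul τ hG' hv h0' h)
      simp [ha, this]
  map_add_le_max' a b := by
    by_cases h : τ.IsCofinal G v (a + b)
    · rw [if_pos h]
      rcases le_total (v a) (v b) with hab | hab
      · have hle : v (a + b) ≤ v b := v.map_add_le hab le_rfl
        rw [if_pos (h.mono hle)]
        exact le_max_of_le_right hle
      · have hle : v (a + b) ≤ v a := v.map_add_le le_rfl hab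
        rw [if_pos (h.mono hle)]
        exact le_max_of_le_left hle
    · rw [if_neg h]
      exact zero_le

theorem contVal_le (hv : ∀ p ∈ τ.plusLoc, v p ≤ 1) (a : τ.Loc) :
    τ.contVal hG' v hv a ≤ v a := by
  classical
  change (if τ.IsCofinal G v a then v a else 0) ≤ v a
  split_ifs
  exacts [le_rfl, zero_le]

theorem contVal_of_one_le (hv : ∀ p ∈ τ.plusLoc, v p ≤ 1) {a : τ.Loc} (ha : 1 ≤ v a) :
    τ.contVal hG' v hv a = v a := by
  classical
  exact if_pos (IsCofinal.of_one_le τ hv ha)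

/-- The valuation `contVal` is continuous: it takes arbitrarily small values on high powers of the
ideal generated by `G`. -/
theorem contVal_mul_lt (hv : ∀ p ∈ τ.plusLoc, v p ≤ 1) (hv' : ∀ q ∈ τ.idealOfGens G, v q < 1)
    {a : τ.Loc} (b : τ.Loc) (ha : τ.contVal hG' v hv a ≠ 0) :
    ∃ k, ∀ q ∈ τ.idealOfGens G ^ k, τ.contVal hG' v hv (q * b) < τ.contVal hG' v hv a := by
  classical
  have hcof : τ.IsCofinal G v a := by
    by_contra h
    exact ha (if_neg h)
  have hva : τ.contVal hG' v hv a = v a := if_pos hcof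
  rw [hva] at ha ⊢
  obtain ⟨k, hk⟩ := IsCofinal.exists_mul_le τ hG' hv b hcof
  refine ⟨k + 1, fun q hq => (τ.contVal_le hG' v hv _).trans_lt ?_⟩
  rw [pow_succ] at hq
  refine Submodule.mul_induction_on hq (fun p hp q hq => ?_) fun x y hx hy => ?_
  · change v ((p * q : τ.Loc) * b) < _
    rw [mul_right_comm, map_mul]
    exact (mul_le_mul_left (hk p hp) _).trans_lt
      (mul_lt_of_lt_one_right (zero_lt_iff.2 ha) (hv' q hq))
  · change v ((x + y : τ.Loc) * b) < _
    rw [add_mul]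
    exact v.map_add_lt hx hy

end Val

end RatData

/-! ### Units and bounded functions on a rational subset -/

open Polynomial in
/-- Reversing a relation for `1 / f` with constant coefficient `1 - i` gives an equation for `f`
with leading coefficient `1 - i`, which may be made monic if powers of `i` absorb powers of `f`. -/
theorem isIntegral_of_eval₂_invSelf {L : Type u} [CommRing L] {P : Subring L} {f : L} {i : P}
    (hi : ∀ n : ℕ, ∃ k : ℕ, (i : L) ^ k * f ^ n ∈ P) (H : P[X]) (hH : H.coeff 0 = 1 - i)
    (h : eval₂ ((algebraMap L (Localization.Away f)).comp P.subtype)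
      (IsLocalization.Away.invSelf f) H = 0) : IsIntegral P f := by
  let y : Localization.Away f := IsLocalization.Away.invSelf f
  have hy : algebraMap L (Localization.Away f) f * y = 1 := IsLocalization.Away.mul_invSelf f
  let _ : Invertible y := ⟨algebraMap L _ f, hy, by rw [mul_comm]; exact hy⟩
  -- Reversing `H` turns the relation for `1 / f` into one for `f`, up to a power of `f`.
  let N := H.natDegree
  have h1 := (eval₂_reflect_eq_zero_iff ((algebraMap L (Localization.Away f)).comp P.subtype) y N H
    le_rfl).2 h
  change eval₂ _ (algebraMap L (Localization.Away f) f) _ = 0 at h1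
  rw [← hom_eval₂, IsLocalization.map_eq_zero_iff (Submonoid.powers f)] at h1
  obtain ⟨⟨_, m, rfl⟩, hm⟩ := h1
  change f ^ m * _ = 0 at hm
  let D := N + (m + 1)
  obtain ⟨k, hk⟩ := hi D
  let E : P[X] := reflect N H * X ^ (m + 1)
  have hE : E.natDegree ≤ D := by
    refine natDegree_mul_le.trans (add_le_add ?_ (natDegree_X_pow_le _))
    exact natDegree_reflect_le.trans (max_le le_rfl le_rfl)
  have hED : E.coeff D = 1 - i := by
    rw [coeff_mul_X_pow, coeff_reflect, revAt_le le_rfl, Nat.sub_self, hH]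
  have hEf : eval₂ P.subtype f E = 0 := by
    rw [eval₂_mul, eval₂_X_pow, pow_succ, ← mul_assoc, mul_comm _ (f ^ m), hm, zero_mul]
  -- `E` has leading coefficient `1 - i`, so multiplying it by `1 + i + ⋯ + i ^ (k - 1)` gives
  -- `1 - i ^ k`; the missing `i ^ k f ^ D` is a constant in `P`.
  let W : P[X] := C (∑ j ∈ Finset.range k, i ^ j) * E + C (i ^ k) * X ^ D - C ⟨_, hk⟩
  refine ⟨W, monic_of_natDegree_le_of_coeff_eq_one D ?_ ?_, ?_⟩
  · refine (natDegree_sub_le _ _).trans (max_le ?_ (by simp))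
    refine (natDegree_add_le _ _).trans (max_le ((natDegree_C_mul_le _ _).trans hE) ?_)
    exact natDegree_C_mul_X_pow_le _ _
  · rw [coeff_sub, coeff_add, coeff_C_mul, hED, coeff_C_mul, coeff_X_pow_self, mul_one,
      coeff_C_of_ne_zero (n := D) (Nat.succ_ne_zero _), geom_sum_mul_neg]
    ring
  · change eval₂ P.subtype f W = 0
    rw [eval₂_sub, eval₂_add, eval₂_mul, hEf, eval₂_mul, eval₂_C, eval₂_C, eval₂_X_pow]
    simp

namespace RatData

variable {A : HuberPair.{u}} (τ : RatData A) {G : Finset A} (hG : ∀ g ∈ G, g ∈ A.plus)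
  (hG' : ∀ g ∈ G, Filter.Tendsto (g ^ · : ℕ → A) Filter.atTop (𝓝 0))

include hG in
/-- A valuation on `A(T/s)` which is at most `1` on `plusLoc` and less than `1` on `G` gives a point
of the rational subset. -/
theorem exists_spa_of_valuation {Γ : Type u} [LinearOrderedCommGroupWithZero Γ]
    (v : Valuation τ.Loc Γ) (hv : ∀ p ∈ τ.plusLoc, v p ≤ 1) (hv' : ∀ q ∈ τ.idealOfGens G, v q < 1)
    {V : ℕ → AddSubgroup A} (hV : ∀ a ∈ V 0, a ∈ A.plus)
    (hV' : ∀ k, V (k + 1) ≤ AddSubgroup.closure (Set.image2 (· * ·) (V k : Set A) (G : Set A)))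
    (hVo : ∀ k, IsOpen (V k : Set A)) :
    ∃ x ∈ τ.subset, ∀ a b, x.rel.vle a b ↔
      τ.contVal hG' v hv (algebraMap A τ.Loc a) ≤ τ.contVal hG' v hv (algebraMap A τ.Loc b) := by
  let w := τ.contVal hG' v hv
  let wA : Valuation A Γ := w.comap (algebraMap A τ.Loc)
  have hw1 : ∀ p ∈ τ.plusLoc, w p ≤ 1 := fun p hp => (τ.contVal_le hG' v hv p).trans (hv p hp)
  have hcont : IsContinuousVal (ValuativeRel.ofValuation wA) := by
    let r := ValuativeRel.ofValuation wA
    intro γ hγ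
    obtain ⟨a, b, rfl⟩ := ValuativeRel.exists_valuation_div_valuation_eq γ
    have hcomp : wA.Compatible := Valuation.Compatible.ofValuation wA
    have hb : ValuativeRel.valuation A (b : A) ≠ 0 := ValuativeRel.valuation_posSubmonoid_ne_zero b
    have ha : wA a ≠ 0 := by
      intro h
      refine hγ ?_
      have : ValuativeRel.valuation A a = 0 := by
        rw [ValuativeRel.valuation_eq_zero_iff, Valuation.Compatible.vle_iff_le (v := wA), h]
        exact zero_le
      rw [this, zero_div]
    obtain ⟨k, hk⟩ := τ.contVal_mul_lt hG' v hv hv' (algebraMap A τ.Loc b) ha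
    refine AddSubgroup.isOpen_mono (H₁ := V k)
      (H₂ := (ValuativeRel.valuation A).ltAddSubgroup (Units.mk0 _ hγ)) ?_ (hVo k)
    intro c hc
    obtain ⟨q, hq, hqc⟩ := τ.exists_mem_pow_idealOfGens hG hV hV' k hc
    change ValuativeRel.valuation A c < _
    rw [Units.val_mk0, lt_div_iff₀ (zero_lt_iff.2 hb), ← map_mul, ← not_le,
      ← Valuation.Compatible.vle_iff_le (v := ValuativeRel.valuation A),
      Valuation.Compatible.vle_iff_le (v := wA), not_le]
    have := hk q hq
    rw [hqc, ← map_mul] at this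
    exact this
  have hrel : ∀ a b, (ValuativeRel.ofValuation wA).vle a b ↔ wA a ≤ wA b := fun a b => Iff.rfl
  refine ⟨⟨ValuativeRel.ofValuation wA, hcont, fun a ha => ?_⟩, ⟨fun t ht => ?_, fun h => ?_⟩,
    fun a b => Iff.rfl⟩
  · rw [hrel, map_one]
    exact hw1 _ (τ.algebraMap_mem_plusLoc ha)
  · rw [hrel]
    have h1 : algebraMap A τ.Loc t =
        (algebraMap A τ.Loc t * τ.sInv) * algebraMap A τ.Loc τ.s := by
      rw [mul_assoc, mul_comm τ.sInv, s_mul_sInv, mul_one]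
    change w (algebraMap A τ.Loc t) ≤ w (algebraMap A τ.Loc τ.s)
    rw [h1, map_mul]
    exact mul_le_of_le_one_left' (hw1 _ (τ.fracSubring_le_plusLoc
      (Subring.subset_closure ⟨t, ht, rfl⟩)))
  · rw [hrel, map_zero] at h
    change w (algebraMap A τ.Loc τ.s) ≤ 0 at h
    have h1 := congrArg w τ.s_mul_sInv
    rw [map_mul, le_zero_iff.1 h, zero_mul, map_one] at h1
    exact zero_ne_one h1

/-- The image of an element which vanishes nowhere on a rational subset is a unit up to a
topologically nilpotent element. -/
theorem exists_mul_eq_one_sub (hG' : ∀ g ∈ G, Filter.Tendsto (g ^ · : ℕ → A) Filter.atTop (𝓝 0))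
    (hG : ∀ g ∈ G, g ∈ A.plus) {V : ℕ → AddSubgroup A} (hV : ∀ a ∈ V 0, a ∈ A.plus)
    (hV' : ∀ k, V (k + 1) ≤ AddSubgroup.closure (Set.image2 (· * ·) (V k : Set A) (G : Set A)))
    (hVo : ∀ k, IsOpen (V k : Set A)) {s : A} (hs : ∀ x ∈ τ.subset, ¬ x.rel.vle s 0) :
    ∃ l : τ.Loc, ∃ n ∈ τ.idealOfGens G, algebraMap A τ.Loc s * l = 1 - n := by
  by_cases h : τ.idealOfGens G ⊔
      (Ideal.span {algebraMap A τ.Loc s}).comap τ.plusLoc.subtype = ⊤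
  · rw [Ideal.eq_top_iff_one, Submodule.mem_sup] at h
    obtain ⟨n, hn, p, hp, hnp⟩ := h
    obtain ⟨l, hl⟩ := Ideal.mem_span_singleton.1 (Ideal.mem_comap.1 hp)
    refine ⟨l, n, hn, ?_⟩
    have h1 : (n : τ.Loc) + p = 1 := congrArg Subtype.val hnp
    rw [← hl, ← h1]
    exact (add_sub_cancel_left _ _).symm
  · exfalso
    -- Otherwise there is a point of the rational subset at which `s` vanishes.
    obtain ⟨K, _, θ, O, h0, hle, hlt⟩ := exists_valuationSubring _ _ _ h
    have hv : ∀ p ∈ τ.plusLoc, O.valuation.comap θ p ≤ 1 := fun p hp =>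
      (O.valuation_le_one_iff _).2 (hle ⟨p, hp⟩)
    obtain ⟨x, hx, hrel⟩ := τ.exists_spa_of_valuation hG hG' (O.valuation.comap θ) hv
      (fun q hq => O.mem_nonunits_iff.1 (hlt q hq)) hV hV' hVo
    refine hs x hx ((hrel _ _).2 ((τ.contVal_le hG' _ hv _).trans ?_))
    rw [Valuation.comap_apply, h0 _ (Ideal.mem_span_singleton_self _), map_zero]
    exact zero_le

open Polynomial in
/-- If `|t| ≤ |s|` on a rational subset and `s l = 1 - n`, then the approximation `t l` of `t / s`
is integral. -/
theorem mul_mem_plusLoc (hG' : ∀ g ∈ G, Filter.Tendsto (g ^ · : ℕ → A) Filter.atTop (𝓝 0))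
    (hG : ∀ g ∈ G, g ∈ A.plus) {V : ℕ → AddSubgroup A} (hV : ∀ a ∈ V 0, a ∈ A.plus)
    (hV' : ∀ k, V (k + 1) ≤ AddSubgroup.closure (Set.image2 (· * ·) (V k : Set A) (G : Set A)))
    (hVo : ∀ k, IsOpen (V k : Set A)) {s t : A} (hst : ∀ x ∈ τ.subset, x.rel.vle t s)
    {l : τ.Loc} {n : τ.plusLoc} (hl : algebraMap A τ.Loc s * l = 1 - n) :
    algebraMap A τ.Loc t * l ∈ τ.plusLoc := by
  set f := algebraMap A τ.Loc t * l with hf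
  let j := (algebraMap τ.Loc (Localization.Away f)).comp τ.plusLoc.subtype
  let π : τ.plusLoc[X] →+* Localization.Away f := eval₂RingHom j (IsLocalization.Away.invSelf f)
  by_cases h : (τ.idealOfGens G).comap constantCoeff ⊔ (⊥ : Ideal _).comap π = ⊤
  · rw [Ideal.eq_top_iff_one, Submodule.mem_sup] at h
    obtain ⟨F, hF, H, hH, hFH⟩ := h
    -- `H` is a relation for `1 / f` with constant coefficient `1 - F(0)`, where `F(0)` lies in the
    -- ideal generated by `G`.
    have hF' : F.coeff 0 ∈ τ.idealOfGens G := hF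
    refine τ.mem_plusLoc_of_isIntegral
      (isIntegral_of_eval₂_invSelf (i := F.coeff 0) (fun m => ?_) H ?_ hH)
    · obtain ⟨k, hk⟩ := τ.exists_pow_le_denomIdeal hG' (f ^ m)
      exact ⟨k, hk (Ideal.pow_mem_pow hF' k)⟩
    · rw [eq_sub_iff_add_eq', ← coeff_add, hFH, coeff_one_zero]
  · exfalso
    -- Otherwise there is a point of the rational subset at which `|t l| > 1`.
    obtain ⟨K, _, θ, O, -, hle, hlt⟩ := exists_valuationSubring _ _ _ h
    let v := O.valuation.comap (θ.comp (algebraMap τ.Loc (Localization.Away f)))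
    have hC : ∀ p, π (C p) = algebraMap τ.Loc (Localization.Away f) p := fun p => eval₂_C _ _
    have hv : ∀ p ∈ τ.plusLoc, v p ≤ 1 := fun p hp => by
      have := (O.valuation_le_one_iff _).2 (hle (C ⟨p, hp⟩))
      rwa [hC] at this
    have hv' : ∀ q ∈ τ.idealOfGens G, v q < 1 := fun q hq => by
      have := O.mem_nonunits_iff.1 (hlt (C q) (by simpa [Ideal.mem_comap] using hq))
      rwa [hC] at this
    have hvf : 1 < v f := by
      have h1 : O.valuation (θ (π X)) < 1 :=
        O.mem_nonunits_iff.1 (hlt X (by simp [Ideal.mem_comap]))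
      have h2 : v f * O.valuation (θ (π X)) = 1 := by
        change O.valuation (θ (algebraMap τ.Loc (Localization.Away f) f)) * _ = 1
        have : π X = IsLocalization.Away.invSelf f := eval₂_X _ _
        rw [← map_mul, ← map_mul, this, IsLocalization.Away.mul_invSelf, map_one, map_one]
      by_contra h3
      exact ((mul_le_of_le_one_left' (not_lt.1 h3)).trans_lt h1).ne h2
    obtain ⟨x, hx, hrel⟩ := τ.exists_spa_of_valuation hG hG' v hv hv' hV hV' hVo
    have h1 := (hrel _ _).1 (hst x hx)
    have h2 : τ.contVal hG' v hv f ≤ τ.contVal hG' v hv (1 - n) := by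
      rw [← hl, hf, map_mul, map_mul]
      exact mul_le_mul_left h1 _
    have h3 : v (1 - n) ≤ 1 := hv _ (sub_mem (one_mem _) n.2)
    rw [τ.contVal_of_one_le hG' v hv hvf.le] at h2
    exact (hvf.trans_le (h2.trans ((τ.contVal_le hG' v hv _).trans h3))).false

end RatData

/-! ### Functoriality of rational localizations -/
namespace RatData

variable {A : HuberPair.{u}} (τ : RatData A)

open UniformSpace Filter in
/-- The geometric series of a topologically nilpotent element converges in the completion. -/
theorem exists_inverse_one_sub {n : τ.Loc} (hn : Tendsto (n ^ · : ℕ → τ.Loc) atTop (𝓝 0)) :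
    ∃ u : τ.Compl, ((1 - n : τ.Loc) : τ.Compl) * u = 1 ∧
      ∀ R : Subring τ.Loc, n ∈ R → u ∈ closure ((↑) '' (R : Set τ.Loc) : Set τ.Compl) := by
  let S : ℕ → τ.Loc := fun k => ∑ j ∈ Finset.range k, n ^ j
  have hS : CauchySeq S := by
    refine NonarchimedeanAddGroup.cauchySeq_of_tendsto_sub_nhds_zero ?_
    refine hn.congr fun k => ?_
    simp [S, Finset.sum_range_succ]
  have hS' : CauchySeq fun k => (S k : τ.Compl) := hS.map (Completion.uniformContinuous_coe τ.Loc)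
  obtain ⟨u, hu⟩ := cauchySeq_tendsto_of_complete hS'
  refine ⟨u, ?_, fun R hR => ?_⟩
  · have h1 : Tendsto (fun k => ((1 - n : τ.Loc) : τ.Compl) * (S k : τ.Compl)) atTop
        (𝓝 (((1 - n : τ.Loc) : τ.Compl) * u)) := hu.const_mul _
    have h2 : Tendsto (fun k => ((1 - n ^ k : τ.Loc) : τ.Compl)) atTop
        (𝓝 ((1 - 0 : τ.Loc) : τ.Compl)) :=
      ((Completion.continuous_coe τ.Loc).tendsto _).comp (hn.const_sub 1)
    rw [sub_zero, Completion.coe_one] at h2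
    refine tendsto_nhds_unique (h1.congr fun k => ?_) h2
    rw [← Completion.coe_mul, mul_neg_geom_sum]
  · exact mem_closure_of_tendsto hu (Eventually.of_forall fun k =>
      ⟨S k, sum_mem fun j _ => pow_mem hR j, rfl⟩)

/-- An element which vanishes nowhere on a rational subset is invertible there. -/
theorem isUnit_toCompl {s : A} (hs : ∀ x ∈ τ.subset, ¬ x.rel.vle s 0) : IsUnit (τ.toCompl s) := by
  obtain ⟨G, V, hG, hG', hVo, hV, hV'⟩ := exists_topNilpotent_generators A
  obtain ⟨l, n, hn, hl⟩ := τ.exists_mul_eq_one_sub hG' hG hV hV' hVo hs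
  obtain ⟨u, hu, -⟩ := τ.exists_inverse_one_sub (τ.tendsto_pow_of_mem_idealOfGens hG' hn)
  refine IsUnit.of_mul_eq_one ((l : τ.Compl) * u) ?_
  change (algebraMap A τ.Loc s : τ.Compl) * _ = 1
  rw [← mul_assoc, ← UniformSpace.Completion.coe_mul, hl, hu]

variable {τ} {ρ : RatData A}

open UniformSpace in
/-- The universal property of `A⟨T/s⟩`: an inclusion of rational subsets induces a continuous
homomorphism over `A`. -/
theorem exists_hom_of_subset (h : τ.subset ⊆ ρ.subset) :
    ∃ φ : ρ.Compl →+* τ.Compl, Continuous φ ∧ φ.comp ρ.toCompl = τ.toCompl := by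
  classical
  obtain ⟨G, V, hG, hG', hVo, hV, hV'⟩ := exists_topNilpotent_generators A
  obtain ⟨l, n, hn, hl⟩ := τ.exists_mul_eq_one_sub hG' hG hV hV' hVo fun x hx => (h hx).2
  obtain ⟨u, hu, hu'⟩ := τ.exists_inverse_one_sub (τ.tendsto_pow_of_mem_idealOfGens hG' hn)
  have hsu : τ.toCompl ρ.s * ((l : τ.Compl) * u) = 1 := by
    change (algebraMap A τ.Loc ρ.s : τ.Compl) * _ = 1
    rw [← mul_assoc, ← UniformSpace.Completion.coe_mul, hl, hu]
  have hint : ∀ t ∈ ρ.T, algebraMap A τ.Loc t * l ∈ τ.plusLoc := fun t ht =>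
    τ.mul_mem_plusLoc hG' hG hV hV' hVo (fun x hx => (h hx).1 t ht) hl
  -- The approximations `t l` of the fractions `t / s`, together with `n`, generate a bounded
  -- subring. Its closure in the completion contains the fractions themselves, as
  -- `t / s = t l (1 - n)⁻¹`.
  let F : Finset τ.Loc := insert (n : τ.Loc) (ρ.T.image fun t => algebraMap A τ.Loc t * l)
  let R : Subring τ.Loc := Subring.closure F
  have hR : IsBoundedSet (R : Set τ.Loc) := isBoundedSet_closure_finset F fun a ha => by
    rcases Finset.mem_insert.1 ha with rfl | ha
    · exact τ.isPowerBounded_of_mem_plusLoc n.2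
    · obtain ⟨t, ht, rfl⟩ := Finset.mem_image.1 ha
      exact τ.isPowerBounded_of_mem_plusLoc (hint t ht)
  let R' : Subring τ.Compl := (R.map Completion.coeRingHom).topologicalClosure
  have huR : u ∈ R' := hu' R (Subring.subset_closure (Finset.mem_insert_self _ _))
  let ψ : ρ.Loc →+* τ.Compl :=
    IsLocalization.Away.lift ρ.s (g := τ.toCompl) (IsUnit.of_mul_eq_one _ hsu)
  have hψ : ∀ a, ψ (algebraMap A ρ.Loc a) = τ.toCompl a := fun a =>
    IsLocalization.Away.lift_eq _ _ _
  have hψs : ψ ρ.sInv = (l : τ.Compl) * u := by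
    have h1 : τ.toCompl ρ.s * ψ ρ.sInv = 1 := by
      rw [← hψ, ← map_mul, s_mul_sInv, map_one]
    calc ψ ρ.sInv = ψ ρ.sInv * (τ.toCompl ρ.s * ((l : τ.Compl) * u)) := by rw [hsu, mul_one]
      _ = (τ.toCompl ρ.s * ψ ρ.sInv) * ((l : τ.Compl) * u) := by ring
      _ = _ := by rw [h1, one_mul]
  have hD : ρ.fracSubring ≤ R'.comap ψ := by
    refine Subring.closure_le.2 ?_
    rintro _ ⟨t, ht, rfl⟩
    change ψ (algebraMap A ρ.Loc t * ρ.sInv) ∈ R'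
    rw [map_mul, hψ, hψs, ← mul_assoc]
    refine mul_mem (Subring.le_topologicalClosure _ ?_) huR
    refine ⟨algebraMap A τ.Loc t * l, Subring.subset_closure (Finset.mem_insert_of_mem
      (Finset.mem_image_of_mem _ ht)), ?_⟩
    exact Completion.coe_mul _ _
  have hcont : Continuous ψ := by
    refine continuous_of_forall ψ fun W hW => ?_
    obtain ⟨W', ⟨hW', hW'c⟩, hW'W⟩ := (closed_nhds_basis (0 : τ.Compl)).mem_iff.1 hW
    have hpre : ((↑) : τ.Loc → τ.Compl) ⁻¹' W' ∈ 𝓝 (0 : τ.Loc) :=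
      (Completion.continuous_coe τ.Loc).continuousAt.preimage_mem_nhds
        (by rw [Completion.coe_zero]; exact hW')
    obtain ⟨U₀, -, hU₀⟩ := τ.hasBasis_nhds_zero.mem_iff.1 hpre
    obtain ⟨N, hN, hNR⟩ := hR _ (τ.hasBasis_nhds_zero.mem_of_mem (i := U₀) trivial)
    obtain ⟨U, hU⟩ := NonarchimedeanRing.is_nonarchimedean (algebraMap A τ.Loc ⁻¹' N)
      (τ.continuous_algebraMap.continuousAt.preimage_mem_nhds (by rw [map_zero]; exact hN))
    let K : AddSubgroup τ.Compl := ((τ.basicSubgroup U₀).map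
      (Completion.coeRingHom (α := τ.Loc)).toAddMonoidHom).topologicalClosure
    have hKW : (K : Set τ.Compl) ⊆ W := by
      refine (closure_minimal ?_ hW'c).trans hW'W
      rintro _ ⟨y, hy, rfl⟩
      exact hU₀ hy
    refine ⟨K, hKW, U, fun d hd a ha => ?_⟩
    rw [hψ]
    have hclosed : IsClosed {c : τ.Compl | c * τ.toCompl a ∈ K} :=
      (AddSubgroup.isClosed_topologicalClosure _).preimage (continuous_mul_const _)
    refine (closure_minimal ?_ hclosed) (hD hd)
    rintro _ ⟨r, hr, rfl⟩
    refine AddSubgroup.le_topologicalClosure _ ⟨algebraMap A τ.Loc a * r, hNR _ (hU ha) r hr, ?_⟩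
    rw [mul_comm]
    exact Completion.coe_mul _ _
  refine ⟨Completion.extensionHom ψ hcont, Completion.continuous_extension, ?_⟩
  ext a
  change Completion.extensionHom ψ hcont (algebraMap A ρ.Loc a : ρ.Compl) = _
  rw [Completion.extensionHom_coe, hψ]

end RatData

/-! ### Functions on open subsets defined by elements of the Huber ring -/

namespace RatData

variable {A : HuberPair.{u}} (ρ : RatData A)

theorem continuous_toCompl : Continuous ρ.toCompl :=
  (UniformSpace.Completion.continuous_coe _).comp ρ.continuous_algebraMap

/-- The rational datum `univ A` is `(1, 1)`, so its localization is `A`. -/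
theorem bijective_algebraMap_univ : Function.Bijective (algebraMap A (univ A).Loc) := by
  constructor
  · exact IsLocalization.injective _ (M := Submonoid.powers (univ A).s)
      (Submonoid.powers_le.2 (one_mem (nonZeroDivisors A)))
  · intro x
    obtain ⟨n, a, ha⟩ := IsLocalization.Away.surj (univ A).s x
    refine ⟨a, ?_⟩
    rw [← ha]
    change x * algebraMap A _ 1 ^ n = x
    simp

theorem isInducing_algebraMap_univ : IsInducing (algebraMap A (univ A).Loc) := by
  rw [IsTopologicalAddGroup.isInducing_iff_nhds_zero]
  refine le_antisymm ?_ ?_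
  · have := (univ A).continuous_algebraMap.tendsto 0
    rw [map_zero] at this
    exact this.le_comap
  · intro W hW
    obtain ⟨U, hU⟩ := NonarchimedeanRing.is_nonarchimedean W hW
    refine ⟨_, (univ A).hasBasis_nhds_zero.mem_of_mem (i := U) trivial, fun a ha => hU ?_⟩
    have hfrac : (univ A).fracSubring ≤ ⊥ := by
      refine Subring.closure_le.2 ?_
      rintro _ ⟨t, ht, rfl⟩
      have h1 : t = (univ A).s := Finset.mem_singleton.1 ht
      change algebraMap A (univ A).Loc t * _ ∈ (⊥ : Subring _)
      rw [h1, s_mul_sInv]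
      exact one_mem _
    have hle : (univ A).basicSubgroup U ≤
        (U : AddSubgroup A).map (algebraMap A (univ A).Loc).toAddMonoidHom := by
      refine basicSubgroup_le fun d hd b hb => ?_
      obtain ⟨n, rfl⟩ := Subring.mem_bot.1 (hfrac hd)
      exact ⟨n • b, zsmul_mem hb n, by simp⟩
    obtain ⟨b, hb, hba⟩ := hle ha
    rwa [← bijective_algebraMap_univ.1 hba]

/-- A complete Huber pair agrees with its completion. -/
theorem isHomeomorph_toCompl_univ (hA : A.IsComplete) : IsHomeomorph (univ A).toCompl := by
  obtain ⟨hT2, hc⟩ := hA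
  let _ : UniformSpace A := IsTopologicalAddGroup.rightUniformSpace A
  have _ : IsUniformAddGroup A := isUniformAddGroup_of_addCommGroup
  have hui : IsUniformInducing (univ A).toCompl :=
    (UniformSpace.Completion.isUniformInducing_coe (univ A).Loc).comp
      (AddMonoidHom.isUniformInducing_of_isInducing (f := (algebraMap A (univ A).Loc))
        isInducing_algebraMap_univ)
  have hdense : DenseRange (univ A).toCompl :=
    UniformSpace.Completion.denseRange_coe.comp bijective_algebraMap_univ.2.denseRange
      (UniformSpace.Completion.continuous_coe _)
  rw [isHomeomorph_iff_isEmbedding_surjective]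
  refine ⟨⟨hui.isInducing, hui.injective⟩, ?_⟩
  rw [← Set.range_eq_univ, ← hui.isComplete_range.isClosed.closure_eq]
  exact hdense.closure_range

end RatData

namespace Spa

variable {A : HuberPair.{u}}

/-- The functions on an open subset of `Spa(A, A⁺)` defined by elements of `A`. -/
def ofRing (W : Opens (Spa A)) : A →+* sections W where
  toFun a := ⟨fun ρ => ρ.1.toCompl a, fun _ _ _ _ _ h => RingHom.congr_fun h a⟩
  map_one' := Subtype.ext (funext fun _ => map_one _)
  map_zero' := Subtype.ext (funext fun _ => map_zero _)
  map_add' _ _ := Subtype.ext (funext fun _ => map_add _ _ _)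
  map_mul' _ _ := Subtype.ext (funext fun _ => map_mul _ _ _)

theorem continuous_ofRing (W : Opens (Spa A)) : Continuous (ofRing W) :=
  Continuous.subtype_mk (p := (· ∈ sections W))
    (f := fun a => fun ρ : RatIn W => ρ.1.toCompl a)
    (continuous_pi fun ρ => ρ.1.continuous_toCompl) _

theorem continuous_eval {W : Opens (Spa A)} (ρ : RatIn W) :
    Continuous fun f : sections W => f.1 ρ :=
  (continuous_apply ρ).comp continuous_subtype_val

/-- A section is determined on a rational subset by its component there. -/
theorem sections_ext {W : Opens (Spa A)} (ρ : RatIn W) (hW : W ≤ ρ.1.opens) {f g : sections W}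
    (h : f.1 ρ = g.1 ρ) : f = g := by
  refine Subtype.ext (funext fun σ => ?_)
  have hσ : σ.1.opens ≤ ρ.1.opens := σ.2.trans hW
  obtain ⟨φ, hφ, hφ'⟩ := RatData.exists_hom_of_subset hσ
  rw [← f.2 ρ σ φ hσ hφ hφ', ← g.2 ρ σ φ hσ hφ hφ', h]

/-- The homomorphism from `A⟨T/s⟩` to the sections over the rational subset. -/
theorem exists_ofCompl (ρ : RatData A) :
    ∃ Φ : ρ.Compl →+* sections ρ.opens, Continuous Φ ∧
      Φ.comp ρ.toCompl = ofRing ρ.opens ∧ ∀ c, (Φ c).1 ⟨ρ, le_rfl⟩ = c := by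
  choose φ hφ hφ' using fun σ : RatIn ρ.opens =>
    RatData.exists_hom_of_subset (show σ.1.subset ⊆ ρ.subset from σ.2)
  refine ⟨(RingHom.pi φ).codRestrict (sections ρ.opens) fun c σ σ' ψ h hψ hψ' => ?_, ?_, ?_, ?_⟩
  · refine RingHom.congr_fun (RatData.hom_ext ρ (f := ψ.comp (φ σ)) (hψ.comp (hφ σ)) (hφ σ') ?_) c
    rw [RingHom.comp_assoc, hφ', hψ', hφ']
  · exact Continuous.subtype_mk (p := (· ∈ sections ρ.opens)) (continuous_pi hφ) _
  · refine RingHom.ext fun a => ?_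
    exact Subtype.ext (funext fun σ => RingHom.congr_fun (hφ' σ) a)
  · intro c
    refine RingHom.congr_fun (RatData.hom_ext ρ (f := φ ⟨ρ, le_rfl⟩) (g := RingHom.id _) (hφ _)
      continuous_id ?_) c
    rw [hφ']
    rfl

/-- For a complete Huber pair, `A` is the ring of global sections, as a topological ring. -/
theorem isHomeomorph_ofRing (hA : A.IsComplete) {W : Opens (Spa A)} (hW : ⊤ ≤ W) :
    IsHomeomorph (ofRing W) := by
  let ρ : RatIn W := ⟨RatData.univ A, le_top.trans hW⟩
  have hWρ : W ≤ ρ.1.opens := fun x _ => RatData.subset_univ.superset (Set.mem_univ x)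
  have h := RatData.isHomeomorph_toCompl_univ hA
  rw [isHomeomorph_iff_isEmbedding_surjective]
  refine ⟨⟨IsInducing.of_comp (continuous_ofRing W) (continuous_eval ρ) h.isInducing,
    fun a b hab => ?_⟩, fun f => ?_⟩
  · exact h.injective (congrArg (fun f : sections W => f.1 ρ) hab)
  · obtain ⟨a, ha⟩ := h.surjective (f.1 ρ)
    exact ⟨a, sections_ext ρ hWρ ha⟩

/-- Elements of `A` which vanish nowhere on a rational subset are invertible there. -/
theorem isUnit_ofRing {ρ : RatData A} {s : A} (hs : ∀ x ∈ ρ.subset, ¬ x.rel.vle s 0) :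
    IsUnit (ofRing ρ.opens s) := by
  obtain ⟨Φ, -, hΦ, -⟩ := exists_ofCompl ρ
  rw [← hΦ]
  exact (ρ.isUnit_toCompl hs).map Φ

theorem evalSections_ofRing {W : Opens (Spa A)} {x : Spa A} (hx : x ∈ W) (a : A) :
    evalSections hx (ofRing W a) = (x.toResidue a : x.ComplResidue) :=
  RatData.eval_toCompl _ _ a

theorem vle_germ_ofRing {W : Opens (TopCat.of (Spa A))} {x : TopCat.of (Spa A)} (hx : x ∈ W)
    (a b : A) :
    ((PreAdicSpace.ofHuberPair A).val x).vle
      ((structurePresheaf A).germ W x hx (ofRing W a))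
      ((structurePresheaf A).germ W x hx (ofRing W b)) ↔ (show Spa A from x).rel.vle a b := by
  have h : ∀ a, stalkVal x ((structurePresheaf A).germ W x hx (ofRing W a)) = Spa.v x a := by
    intro a
    change complVal x (evalStalk x _) = _
    rw [evalStalk_germ]
    refine (congrArg (complVal (A := A) x) (evalSections_ofRing (A := A) hx a)).trans ?_
    rw [complVal_coe, v_toResidue]
  change stalkVal x _ ≤ stalkVal x _ ↔ _
  rw [h, h]
  exact Spa.v_le_iff x

end Spa

/-! ### Dual bases and rational localizations -/

/-- A dual basis of a finite projective algebra `φ : R → S`: elements `e i` of `S` and `R`-linear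
coordinates `c i : S → R` with `x = ∑ i, φ (c i x) * e i`. The elements need not be linearly
independent. The coordinates are additive maps with an explicit linearity condition, so that no
algebra instances are needed on completions and rings of sections. -/
structure DualBasis {R S : Type*} [CommRing R] [CommRing S] (φ : R →+* S) (n : ℕ) where
  elt : Fin n → S
  coord : Fin n → S →+ R
  coord_mul : ∀ i r s, coord i (φ r * s) = r * coord i s
  sum_eq : ∀ s, ∑ i, φ (coord i s) * elt i = s

/-- Localization of an additive map which is linear along a ring homomorphism. -/
theorem exists_localization_addMonoidHom {A B L L' : Type u} [CommRing A] [CommRing B] [CommRing L]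
    [CommRing L'] [Algebra A L] [Algebra B L'] (φ : A →+* B) (s : A) [IsLocalization.Away s L]
    [IsLocalization.Away (φ s) L'] (c : B →+ A) (hc : ∀ a b, c (φ a * b) = a * c b) :
    ∃ Λ : L' →+ L, ∀ x b, Λ (IsLocalization.Away.map L L' φ s x * algebraMap B L' b) =
      x * algebraMap A L (c b) := by
  let _ : Algebra A B := φ.toAlgebra
  let _ : Algebra A L' := ((algebraMap B L').comp φ).toAlgebra
  have : IsScalarTower A B L' := IsScalarTower.of_algebraMap_eq fun _ => rfl
  have : IsLocalization (Algebra.algebraMapSubmonoid B (Submonoid.powers s)) L' := by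
    rw [Algebra.algebraMapSubmonoid_powers]
    exact inferInstanceAs (IsLocalization.Away (φ s) L')
  have hloc : IsLocalizedModule (Submonoid.powers s) (IsScalarTower.toAlgHom A B L').toLinearMap :=
    isLocalizedModule_iff_isLocalization.2 this
  let cl : B →ₗ[A] A :=
    { toFun := c
      map_add' := map_add c
      map_smul' := fun a b => by
        rw [Algebra.smul_def]
        exact hc a b }
  let Λ : L' →ₗ[A] L := IsLocalizedModule.lift (Submonoid.powers s)
    (IsScalarTower.toAlgHom A B L').toLinearMap ((Algebra.linearMap A L).comp cl) fun x => by
      have h := IsLocalization.map_units L x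
      obtain ⟨u, hu⟩ := h
      refine ⟨⟨algebraMap A (Module.End A L) x, (LinearMap.mulLeft A (↑u⁻¹ : L)), ?_, ?_⟩, rfl⟩
      · ext y
        change (x : A) • ((↑u⁻¹ : L) * y) = y
        rw [Algebra.smul_def, ← hu, Units.mul_inv_cancel_left]
      · ext y
        change (↑u⁻¹ : L) * ((x : A) • y) = y
        rw [Algebra.smul_def, ← hu, Units.inv_mul_cancel_left]
  have hΛ : ∀ b, Λ (algebraMap B L' b) = algebraMap A L (c b) := fun b =>
    IsLocalizedModule.lift_apply (Submonoid.powers s) (IsScalarTower.toAlgHom A B L').toLinearMap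
      _ _ b
  have hmap : ∀ a, IsLocalization.Away.map L L' φ s (algebraMap A L a) = algebraMap B L' (φ a) :=
    fun a => IsLocalization.map_eq _ a
  have hsm : ∀ (a : A) (y : L'), algebraMap B L' (φ a) * y = a • y := fun a y =>
    (Algebra.smul_def a y).symm
  refine ⟨Λ.toAddMonoidHom, fun x b => ?_⟩
  change Λ _ = _
  obtain ⟨n, a, ha⟩ := IsLocalization.Away.surj s x
  have hu : IsUnit (algebraMap A L s ^ n) := (IsLocalization.Away.algebraMap_isUnit s).pow n
  refine hu.mul_left_cancel ?_
  rw [← map_pow, ← Algebra.smul_def, ← map_smul, ← hsm, ← hmap, ← mul_assoc, ← map_mul,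
    mul_comm _ x, map_pow, ha, hmap, hsm, map_smul, hΛ, Algebra.smul_def, ← ha]
  ring

namespace RatData

variable {A B : HuberPair.{u}} {φ : A →+* B} {n : ℕ} (D : DualBasis φ n)
  (hD : ∀ i, Continuous (D.coord i)) (ρ : RatData A)

open Classical in
/-- The rational datum `(φ(T), φ(s))` of `B`. The ideal generated by `φ(T)` is open because `B` has
a dual basis with continuous coordinates. -/
def map : RatData B where
  T := ρ.T.image φ
  s := φ ρ.s
  isOpen_span := by
    -- The elements of `B` with coordinates in the open ideal generated by `T` form an open
    -- subgroup.
    let H : AddSubgroup B := ⨅ i, (Ideal.span (ρ.T : Set A)).toAddSubgroup.comap (D.coord i)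
    have hH : IsOpen (H : Set B) := by
      rw [AddSubgroup.coe_iInf]
      exact isOpen_iInter_of_finite fun i => ρ.isOpen_span.preimage (hD i)
    refine isOpen_ideal_of_subset hH fun b hb => ?_
    have hb' : ∀ i, D.coord i b ∈ Ideal.span (ρ.T : Set A) := AddSubgroup.mem_iInf.1 hb
    change b ∈ Ideal.span _
    rw [← D.sum_eq b]
    refine sum_mem fun i _ => Ideal.mul_mem_right _ _ ?_
    have := Ideal.mem_map_of_mem φ (hb' i)
    rwa [Ideal.map_span, ← Finset.coe_image] at this

/-- A dual basis of `B` over `A` induces one of `B⟨φ(T)/φ(s)⟩` over `A⟨T/s⟩`, with the same elements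
and with coordinates that extend the given ones. The last statement says that `A⟨T/s⟩` and `B`
together generate a dense subring. -/
theorem exists_dualBasis_compl (hφ : Continuous φ) :
    ∃ (φ' : ρ.Compl →+* (ρ.map D hD).Compl) (D' : DualBasis φ' n), Continuous φ' ∧
      φ'.comp ρ.toCompl = (ρ.map D hD).toCompl.comp φ ∧ (∀ i, Continuous (D'.coord i)) ∧
      (∀ i, D'.elt i = (ρ.map D hD).toCompl (D.elt i)) ∧
      (∀ i b, D'.coord i ((ρ.map D hD).toCompl b) = ρ.toCompl (D.coord i b)) ∧
      ∀ x : (ρ.map D hD).Loc, ∃ y b, (x : (ρ.map D hD).Compl) = φ' y * (ρ.map D hD).toCompl b := by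
  classical
  set σ := ρ.map D hD with hσ
  have hloc : IsLocalization.Away (φ ρ.s) σ.Loc := inferInstanceAs (IsLocalization.Away σ.s σ.Loc)
  let ψ : ρ.Loc →+* σ.Loc := IsLocalization.Away.map ρ.Loc σ.Loc φ ρ.s
  have hψ : ∀ a, ψ (algebraMap A ρ.Loc a) = algebraMap B σ.Loc (φ a) := fun a =>
    IsLocalization.map_eq _ a
  have hψs : ψ ρ.sInv = σ.sInv := by
    have h1 : algebraMap B σ.Loc σ.s * ψ ρ.sInv = 1 := by
      change algebraMap B σ.Loc (φ ρ.s) * _ = 1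
      rw [← hψ, ← map_mul, s_mul_sInv, map_one]
    calc ψ ρ.sInv = ψ ρ.sInv * (algebraMap B σ.Loc σ.s * σ.sInv) := by rw [s_mul_sInv, mul_one]
      _ = (algebraMap B σ.Loc σ.s * ψ ρ.sInv) * σ.sInv := by ring
      _ = _ := by rw [h1, one_mul]
  have hfrac : σ.fracSubring ≤ ρ.fracSubring.map ψ := by
    refine Subring.closure_le.2 ?_
    rintro _ ⟨t, ht, rfl⟩
    obtain ⟨t, ht', rfl⟩ := Finset.mem_image.1 (Finset.mem_coe.1 ht)
    refine ⟨algebraMap A ρ.Loc t * ρ.sInv, Subring.subset_closure ⟨t, ht', rfl⟩, ?_⟩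
    rw [map_mul, hψ, hψs]
  have hfrac' : ρ.fracSubring ≤ σ.fracSubring.comap ψ := by
    refine Subring.closure_le.2 ?_
    rintro _ ⟨t, ht, rfl⟩
    change ψ (algebraMap A ρ.Loc t * ρ.sInv) ∈ σ.fracSubring
    rw [map_mul, hψ, hψs]
    exact Subring.subset_closure ⟨φ t, Finset.mem_coe.2 (Finset.mem_image_of_mem φ ht), rfl⟩
  have hψc : Continuous ψ := by
    refine continuous_of_forall ψ fun W hW => ?_
    obtain ⟨U, -, hU⟩ := σ.hasBasis_nhds_zero.mem_iff.1 hW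
    refine ⟨σ.basicSubgroup U, hU, U.comap φ.toAddMonoidHom hφ, fun d hd a ha => ?_⟩
    rw [hψ]
    exact mul_mem_basicSubgroup (hfrac' hd) ha
  choose Λ hΛ using fun i => exists_localization_addMonoidHom (L := ρ.Loc) (L' := σ.Loc) φ ρ.s
    (D.coord i) (D.coord_mul i)
  have hΛ : ∀ i x b, Λ i (ψ x * algebraMap B σ.Loc b) = x * algebraMap A ρ.Loc (D.coord i b) := hΛ
  have hΛc : ∀ i, Continuous (Λ i) := fun i => by
    refine continuous_of_continuousAt_zero (Λ i) ?_
    rw [ContinuousAt, map_zero, σ.hasBasis_nhds_zero.tendsto_left_iff]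
    intro W hW
    obtain ⟨U, -, hU⟩ := ρ.hasBasis_nhds_zero.mem_iff.1 hW
    refine ⟨U.comap (D.coord i) (hD i), trivial, fun y hy => hU ?_⟩
    refine basicSubgroup_le (K := (ρ.basicSubgroup U).comap (Λ i)) (fun d hd b hb => ?_) hy
    obtain ⟨d, hd', rfl⟩ := hfrac hd
    change Λ i (ψ d * algebraMap B σ.Loc b) ∈ ρ.basicSubgroup U
    rw [hΛ]
    exact mul_mem_basicSubgroup hd' hb
  -- Since `1 / φ(s)` comes from `A(T/s)`, every element is a single product.
  have hform : ∀ x : σ.Loc, ∃ y b, x = ψ y * algebraMap B σ.Loc b := fun x => by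
    obtain ⟨k, b, hb⟩ := IsLocalization.Away.surj σ.s x
    refine ⟨ρ.sInv ^ k, b, ?_⟩
    rw [map_pow, hψs, ← hb, mul_left_comm, ← mul_pow, mul_comm σ.sInv, s_mul_sInv, one_pow, mul_one]
  let φ' : ρ.Compl →+* σ.Compl := UniformSpace.Completion.mapRingHom ψ hψc
  have hφ' : ∀ x : ρ.Loc, φ' x = (ψ x : σ.Compl) := UniformSpace.Completion.mapRingHom_coe hψc
  have hφ'c : Continuous φ' := UniformSpace.Completion.continuous_map
  let Λ' : Fin n → σ.Compl →+ ρ.Compl := fun i => (Λ i).completion (hΛc i)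
  have hΛ' : ∀ i (x : σ.Loc), Λ' i x = (Λ i x : ρ.Compl) := fun i x =>
    AddMonoidHom.completion_coe _ (hΛc i) x
  have hΛ'c : ∀ i, Continuous (Λ' i) := fun i => AddMonoidHom.continuous_completion _ (hΛc i)
  refine ⟨φ', ⟨fun i => σ.toCompl (D.elt i), Λ', fun i r s => ?_, fun x => ?_⟩, hφ'c, ?_, hΛ'c,
    fun i => rfl, fun i b => ?_, fun x => ?_⟩
  · induction r, s using UniformSpace.Completion.induction_on₂ with
    | hp =>
      have h1 : Continuous fun x : ρ.Compl × σ.Compl => Λ' i (φ' x.1 * x.2) :=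
        (hΛ'c i).comp ((hφ'c.comp continuous_fst).mul continuous_snd)
      have h2 : Continuous fun x : ρ.Compl × σ.Compl => x.1 * Λ' i x.2 :=
        continuous_fst.mul ((hΛ'c i).comp continuous_snd)
      exact isClosed_eq h1 h2
    | ih r s =>
      obtain ⟨y, b, rfl⟩ := hform s
      rw [hφ', ← UniformSpace.Completion.coe_mul, hΛ', hΛ', ← mul_assoc, ← map_mul, hΛ, hΛ,
        ← UniformSpace.Completion.coe_mul, mul_assoc]
  · induction x using UniformSpace.Completion.induction_on with
    | hp => exact isClosed_eq (continuous_finsetSum _ fun i _ =>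
        (hφ'c.comp (hΛ'c i)).mul continuous_const) continuous_id
    | ih x =>
      obtain ⟨y, b, rfl⟩ := hform x
      have h1 : ∀ i, φ' (Λ' i ((ψ y * algebraMap B σ.Loc b : σ.Loc) : σ.Compl)) *
          σ.toCompl (D.elt i) =
            ((ψ y * algebraMap B σ.Loc (φ (D.coord i b) * D.elt i) : σ.Loc) : σ.Compl) := by
        intro i
        rw [hΛ', hΛ, hφ', map_mul ψ, hψ, map_mul, ← mul_assoc,
          UniformSpace.Completion.coe_mul (_ * _)]
        rfl
      rw [Finset.sum_congr rfl fun i _ => h1 i]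
      have h2 := map_sum (UniformSpace.Completion.coeRingHom (α := σ.Loc))
        (fun i => ψ y * algebraMap B σ.Loc (φ (D.coord i b) * D.elt i)) Finset.univ
      refine h2.symm.trans ?_
      rw [← Finset.mul_sum, ← map_sum, D.sum_eq]
      rfl
  · refine RingHom.ext fun a => ?_
    change φ' (algebraMap A ρ.Loc a : ρ.Compl) = (algebraMap B σ.Loc (φ a) : σ.Compl)
    rw [hφ', hψ]
  · change Λ' i (algebraMap B σ.Loc b : σ.Compl) = (algebraMap A ρ.Loc (D.coord i b) : ρ.Compl)
    have := hΛ i 1 b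
    rw [map_one, one_mul, one_mul] at this
    rw [hΛ', this]
  · obtain ⟨y, b, rfl⟩ := hform x
    refine ⟨y, b, ?_⟩
    rw [hφ', UniformSpace.Completion.coe_mul]
    rfl

end RatData

/-! ### Dual bases and sections of the structure presheaf -/

namespace PreAdicSpace

theorem Hom.vle_germ_iff {P Q : PreAdicSpace.{u}} (p : Hom P Q) (y : P) (W : Opens Q)
    (hy : p.base y ∈ W) (s t : Q.presheaf.obj (op W)) :
    (Q.val (p.base y)).vle (Q.presheaf.germ W (p.base y) hy s) (Q.presheaf.germ W (p.base y) hy t) ↔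
      (P.val y).vle (P.presheaf.germ ((Opens.map p.base).obj W) y hy (p.c.app (op W) s))
        (P.presheaf.germ ((Opens.map p.base).obj W) y hy (p.c.app (op W) t)) := by
  have h : ∀ s, (p.toHom.stalkMap y).hom (Q.presheaf.germ W (p.base y) hy s) =
      P.presheaf.germ ((Opens.map p.base).obj W) y hy (p.c.app (op W) s) := fun s =>
    ConcreteCategory.congr_hom
      (AlgebraicGeometry.PresheafedSpace.stalkMap_germ p.toHom W y hy) s
  rw [← p.comap_val y, ← h, ← h]
  exact Iff.rfl

end PreAdicSpace

namespace Spa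

variable {A B : HuberPair.{u}}
  (g : PreAdicSpace.Hom (PreAdicSpace.ofHuberPair B) (PreAdicSpace.ofHuberPair A))

/-- The map of points underlying a morphism. -/
def mapPt (y : Spa B) : Spa A := g.base y

/-- The inverse image of an open subset. -/
def preimage (W : Opens (Spa A)) : Opens (Spa B) := (Opens.map g.base).obj W

theorem preimage_mono {V W : Opens (Spa A)} (h : V ≤ W) : preimage g V ≤ preimage g W :=
  fun _ hy => h hy

/-- The pullback of functions. -/
def pull (W : Opens (Spa A)) : sections W →+* sections (preimage g W) := (g.c.app (op W)).hom

theorem continuous_pull (W : Opens (Spa A)) : Continuous (pull g W) := g.continuous_app W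

theorem pull_restrict {V W : Opens (Spa A)} (h : V ≤ W) (c : sections W) :
    pull g V (restrictSections h c) = restrictSections (preimage_mono g h) (pull g W c) :=
  ConcreteCategory.congr_hom (g.c.naturality (homOfLE h).op) c

variable {φ : A →+* B} (hφ : ∀ a, pull g ⊤ (ofRing ⊤ a) = ofRing (preimage g ⊤) (φ a))

include hφ in
theorem pull_ofRing (W : Opens (Spa A)) (a : A) :
    pull g W (ofRing W a) = ofRing (preimage g W) (φ a) := by
  have h := pull_restrict g (le_top : W ≤ ⊤) (ofRing ⊤ a)
  rw [hφ] at h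
  exact h

include hφ in
theorem vle_mapPt_iff (y : Spa B) (a b : A) :
    (mapPt g y).rel.vle a b ↔ y.rel.vle (φ a) (φ b) := by
  have h := g.vle_germ_iff y ⊤ trivial (ofRing ⊤ a) (ofRing ⊤ b)
  have h1 := vle_germ_ofRing (W := ⊤) (x := g.base y) trivial a b
  have h2 := vle_germ_ofRing (W := preimage g ⊤) (x := y) trivial (φ a) (φ b)
  rw [← hφ, ← hφ] at h2
  exact h1.symm.trans (h.trans h2)

variable {n : ℕ} (D : DualBasis φ n) (hD : ∀ i, Continuous (D.coord i)) (hφc : Continuous φ)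

include hφ in
/-- The inverse image of the rational subset given by `(T, s)` is the rational subset given by
`(φ(T), φ(s))`. -/
theorem opens_map (ρ : RatData A) : (ρ.map D hD).opens = preimage g ρ.opens := by
  classical
  ext y
  change y ∈ (ρ.map D hD).subset ↔ mapPt g y ∈ ρ.subset
  have h0 : (mapPt g y).rel.vle ρ.s 0 ↔ y.rel.vle (φ ρ.s) 0 := by
    rw [vle_mapPt_iff g hφ, map_zero]
  refine and_congr ⟨fun h t ht => ?_, fun h t ht => ?_⟩ (not_congr h0.symm)
  · exact (vle_mapPt_iff g hφ _ _ _).2 (h _ (Finset.mem_image_of_mem φ ht))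
  · obtain ⟨t, ht', rfl⟩ := Finset.mem_image.1 ht
    exact (vle_mapPt_iff g hφ _ _ _).1 (h t ht')

/-- The rational subset of `Spa(B, B⁺)` defined by a rational datum of `A`. -/
def mapRat {W : Opens (Spa A)} (ρ : RatIn W) : RatIn (preimage g W) :=
  ⟨ρ.1.map D hD, (opens_map g hφ D hD ρ.1).le.trans (preimage_mono g ρ.2)⟩

/-- On rational subsets, the pullback of functions is the completion of `φ`. -/
theorem pull_val {ρ : RatData A} {φ' : ρ.Compl →+* (ρ.map D hD).Compl} (hφ' : Continuous φ')
    (hφ'' : φ'.comp ρ.toCompl = (ρ.map D hD).toCompl.comp φ) {W : Opens (Spa A)}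
    (hρ : ρ.opens ≤ W) (c : sections W) :
    (pull g W c).1 (mapRat g hφ D hD ⟨ρ, hρ⟩) = φ' (c.1 ⟨ρ, hρ⟩) := by
  obtain ⟨Φ, hΦ, hΦ', hΦ''⟩ := exists_ofCompl ρ
  have h1 : restrictSections hρ c = Φ (c.1 ⟨ρ, hρ⟩) :=
    sections_ext ⟨ρ, le_rfl⟩ le_rfl (hΦ'' _).symm
  have h2 := congrArg (fun f => f.1 (mapRat g hφ D hD ⟨ρ, le_rfl⟩)) (pull_restrict g hρ c)
  refine h2.symm.trans ?_
  rw [h1]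
  let ev : sections (preimage g ρ.opens) →+* (ρ.map D hD).Compl :=
    (Pi.evalRingHom _ (mapRat g hφ D hD ⟨ρ, le_rfl⟩)).comp (sections (preimage g ρ.opens)).subtype
  have hev : Continuous ev := continuous_eval (mapRat g hφ D hD ⟨ρ, le_rfl⟩)
  have hev' : Continuous ((ev.comp (pull g ρ.opens)).comp Φ) := by
    rw [RingHom.coe_comp, RingHom.coe_comp]
    exact (hev.comp (continuous_pull g ρ.opens)).comp hΦ
  have h3 : (ev.comp (pull g ρ.opens)).comp Φ = φ' := by
    refine RatData.hom_ext ρ hev' hφ' ?_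
    rw [RingHom.comp_assoc, hΦ', hφ'']
    refine RingHom.ext fun a => ?_
    change (pull g ρ.opens (ofRing ρ.opens a)).1 _ = _
    rw [pull_ofRing g hφ]
    rfl
  exact RingHom.congr_fun h3 _

include hφ hD hφc in
/-- The coordinates of a dual basis of `B` over `A` extend to linear maps from the functions on the
inverse image of `W` to the functions on `W`, for all open subsets `W` of `Spa(A, A⁺)`, and they are
compatible with restrictions. Over rational subsets, they form a dual basis. -/
theorem exists_coord_sections :
    ∃ Λ : Fin n → ∀ W : Opens (Spa A), sections (preimage g W) →+ sections W,
      (∀ i V W (h : V ≤ W) x, Λ i V (restrictSections (preimage_mono g h) x) =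
        restrictSections h (Λ i W x)) ∧
      (∀ i W c x, Λ i W (pull g W c * x) = c * Λ i W x) ∧
      ∀ (ρ : RatData A) (W : Opens (Spa A)), W = ρ.opens → ∀ x : sections (preimage g W),
        ∑ i, pull g W (Λ i W x) * ofRing _ (D.elt i) = x := by
  choose φ' D' h1 h2 h3 h4 h5 h6 using fun ρ : RatData A => ρ.exists_dualBasis_compl D hD hφc
  have hpull : ∀ (W : Opens (Spa A)) (ρ : RatIn W) (c : sections W),
      (pull g W c).1 (mapRat g hφ D hD ρ) = φ' ρ.1 (c.1 ρ) := fun W ρ c =>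
    pull_val g hφ D hD (h1 ρ.1) (h2 ρ.1) ρ.2 c
  -- The coordinates commute with the transition maps between rational subsets, by density.
  have htrans : ∀ (i) (ρ ρ' : RatData A) (ψ : ρ.Compl →+* ρ'.Compl)
      (χ : (ρ.map D hD).Compl →+* (ρ'.map D hD).Compl), Continuous ψ →
      ψ.comp ρ.toCompl = ρ'.toCompl → Continuous χ →
      χ.comp (ρ.map D hD).toCompl = (ρ'.map D hD).toCompl → ∀ x,
      (D' ρ').coord i (χ x) = ψ ((D' ρ).coord i x) := by
    intro i ρ ρ' ψ χ hψ hψ' hχ hχ' x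
    have hcomm : χ.comp (φ' ρ) = (φ' ρ').comp ψ := by
      refine RatData.hom_ext ρ (hχ.comp (h1 ρ)) ((h1 ρ').comp hψ) ?_
      rw [RingHom.comp_assoc, h2, ← RingHom.comp_assoc, hχ', RingHom.comp_assoc, hψ', h2]
    induction x using UniformSpace.Completion.induction_on with
    | hp => exact isClosed_eq ((h3 ρ' i).comp hχ) (hψ.comp (h3 ρ i))
    | ih x =>
      obtain ⟨y, b, hx⟩ := h6 ρ x
      have e1 : χ (φ' ρ y) = φ' ρ' (ψ y) := RingHom.congr_fun hcomm y
      have e2 : χ ((ρ.map D hD).toCompl b) = (ρ'.map D hD).toCompl b := RingHom.congr_fun hχ' b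
      have e3 : ψ (ρ.toCompl (D.coord i b)) = ρ'.toCompl (D.coord i b) :=
        RingHom.congr_fun hψ' _
      rw [hx, map_mul, e1, e2, (D' ρ').coord_mul, (D' ρ).coord_mul, h5, h5, map_mul, e3]
  let Λ : Fin n → ∀ W : Opens (Spa A), sections (preimage g W) →+ sections W := fun i W =>
    { toFun := fun x => ⟨fun ρ => (D' ρ.1).coord i (x.1 (mapRat g hφ D hD ρ)),
        fun ρ ρ' ψ h hψ hψ' => by
          have hle : (mapRat g hφ D hD ρ').1.opens ≤ (mapRat g hφ D hD ρ).1.opens := by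
            change (ρ'.1.map D hD).opens ≤ (ρ.1.map D hD).opens
            rw [opens_map g hφ, opens_map g hφ]
            exact preimage_mono g h
          obtain ⟨χ, hχ, hχ'⟩ := RatData.exists_hom_of_subset hle
          change ψ ((D' ρ.1).coord i (x.1 (mapRat g hφ D hD ρ))) =
            (D' ρ'.1).coord i (x.1 (mapRat g hφ D hD ρ'))
          rw [← x.2 _ _ χ hle hχ hχ']
          exact (htrans i ρ.1 ρ'.1 ψ χ hψ hψ' hχ hχ' _).symm⟩
      map_zero' := Subtype.ext (funext fun ρ => map_zero _)
      map_add' := fun x y => Subtype.ext (funext fun ρ => map_add _ _ _) }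
  have hΛ : ∀ i W x ρ, (Λ i W x).1 ρ = (D' ρ.1).coord i (x.1 (mapRat g hφ D hD ρ)) :=
    fun i W x ρ => rfl
  refine ⟨Λ, fun i V W h x => rfl, fun i W c x => Subtype.ext (funext fun ρ => ?_), ?_⟩
  · let y : (ρ.1.map D hD).Compl := x.1 (mapRat g hφ D hD ρ)
    have e1 : (pull g W c * x).1 (mapRat g hφ D hD ρ) = φ' ρ.1 (c.1 ρ) * y :=
      congrArg (· * y) (hpull W ρ c)
    have e2 : (c * Λ i W x).1 ρ = c.1 ρ * (Λ i W x).1 ρ := rfl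
    rw [e2, hΛ, hΛ, e1]
    exact (D' ρ.1).coord_mul i _ _
  · rintro ρ _ rfl x
    refine sections_ext (mapRat g hφ D hD ⟨ρ, le_rfl⟩) (opens_map g hφ D hD ρ).ge ?_
    let ev : sections (preimage g ρ.opens) →+* (ρ.map D hD).Compl :=
      (Pi.evalRingHom _ (mapRat g hφ D hD ⟨ρ, le_rfl⟩)).comp
        (sections (preimage g ρ.opens)).subtype
    change ev _ = ev x
    rw [map_sum]
    have hi : ∀ i, ev (pull g ρ.opens (Λ i ρ.opens x) * ofRing _ (D.elt i)) =
        φ' ρ ((D' ρ).coord i (ev x)) * (D' ρ).elt i := fun i => by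
      have e1 : ev (pull g ρ.opens (Λ i ρ.opens x)) = φ' ρ ((D' ρ).coord i (ev x)) :=
        hpull ρ.opens ⟨ρ, le_rfl⟩ (Λ i ρ.opens x)
      have e2 : ev (ofRing _ (D.elt i)) = (D' ρ).elt i := (h4 ρ i).symm
      rw [map_mul, e1, e2]
    rw [Finset.sum_congr rfl fun i _ => hi i]
    exact (D' ρ).sum_eq (ev x)

end Spa

/-! ### Morphisms to open subsets -/

theorem presheaf_map_map {Z : TopCat.{u}} (F : TopCat.Presheaf CommRingCat.{u} Z) {U V W : Opens Z}
    (i : U ⟶ V) (j : V ⟶ W) (k : U ⟶ W) (s : F.obj (op W)) :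
    F.map i.op (F.map j.op s) = F.map k.op s := by
  rw [← ConcreteCategory.comp_apply, ← F.map_comp]
  rfl

theorem presheaf_map_map' {Z : TopCat.{u}} (F : TopCat.Presheaf CommRingCat.{u} Z)
    {U V V' W : (Opens Z)ᵒᵖ} (f : U ⟶ V) (g : V ⟶ W) (f' : U ⟶ V') (g' : V' ⟶ W) (s : F.obj U) :
    F.map g (F.map f s) = F.map g' (F.map f' s) := by
  rw [← ConcreteCategory.comp_apply, ← F.map_comp, ← ConcreteCategory.comp_apply, ← F.map_comp]
  rfl

theorem presheaf_map_self {Z : TopCat.{u}} (F : TopCat.Presheaf CommRingCat.{u} Z) {U : Opens Z}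
    (i : U ⟶ U) (s : F.obj (op U)) : F.map i.op s = s := by
  have : i.op = 𝟙 (op U) := rfl
  rw [this, F.map_id]
  rfl

namespace PreAdicSpace

/-- The inclusion of an open subset. -/
def ofRestrict (X : PreAdicSpace.{u}) (V : Opens X) : Hom (X.restrictOpen V) X where
  toHom := X.toPresheafedSpace.ofRestrict V.isOpenEmbedding
  continuous_app W := X.continuous_map _
  comap_val := fun (x : V) => by
    have h := AlgebraicGeometry.PresheafedSpace.restrictStalkIso_inv_eq_ofRestrict
      X.toPresheafedSpace V.isOpenEmbedding x
    have h2 : ∀ s, (X.toPresheafedSpace.restrictStalkIso V.isOpenEmbedding x).hom.hom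
        (((X.toPresheafedSpace.ofRestrict V.isOpenEmbedding).stalkMap x).hom s) = s := fun s => by
      rw [← h]
      exact ConcreteCategory.congr_hom
        (X.toPresheafedSpace.restrictStalkIso V.isOpenEmbedding x).inv_hom_id s
    exact ValuativeRel.ext (funext fun a => funext fun b =>
      congrArg₂ (X.val x.1).vle (h2 a) (h2 b))

variable {R X : PreAdicSpace.{u}} (h : Hom R X) (V : Opens X) (hV : ∀ y, h.base y ∈ V)

/-- The morphism of presheafed spaces underlying a lift to an open subset. -/
def liftAux : R.toPresheafedSpace ⟶ (X.restrictOpen V).toPresheafedSpace where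
  base := TopCat.ofHom ⟨fun y => (⟨h.base y, hV y⟩ : V), by fun_prop⟩
  c :=
    { app := fun W => h.c.app (op (V.isOpenEmbedding.isOpenMap.functor.obj W.unop)) ≫
        R.presheaf.map (homOfLE (by
          intro y hy
          exact ⟨⟨h.base y, hV y⟩, hy, rfl⟩)).op
      naturality := fun W W' i => by
        ext s
        have h1 := ConcreteCategory.congr_hom
          (h.c.naturality (V.isOpenEmbedding.isOpenMap.functor.op.map i)) s
        refine (congrArg (R.presheaf.map _) h1).trans ?_
        change R.presheaf.map _ (R.presheaf.map _ _) = R.presheaf.map ((Opens.map (TopCat.ofHom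
          ⟨fun y => (⟨h.base y, hV y⟩ : V), by fun_prop⟩)).op.map i) (R.presheaf.map _ _)
        exact presheaf_map_map' R.presheaf _ _ _ _ _ }

theorem liftAux_comp :
    liftAux h V hV ≫ X.toPresheafedSpace.ofRestrict V.isOpenEmbedding = h.toHom := by
  refine AlgebraicGeometry.PresheafedSpace.hext _ _ rfl
    (heq_of_eq (NatTrans.ext (funext fun W => ?_)))
  ext s
  have h1 := ConcreteCategory.congr_hom (h.c.naturality
    (V.isOpenEmbedding.isOpenMap.adjunction.counit.app W.unop).op) s
  refine (congrArg (R.presheaf.map _) h1).trans ?_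
  refine (presheaf_map_map R.presheaf _ _ (𝟙 _) _).trans ?_
  exact presheaf_map_self R.presheaf _ _

/-- A morphism with image in an open subset factors through it. -/
def lift : Hom R (X.restrictOpen V) where
  toHom := liftAux h V hV
  continuous_app W := (R.continuous_map _).comp (h.continuous_app _)
  comap_val y := by
    have h1 : ∀ k : R.toPresheafedSpace ⟶ X.toPresheafedSpace, k = h.toHom →
        comapRel (k.stalkMap y).hom (R.val y) = X.val (k.base y) := by
      rintro _ rfl
      exact h.comap_val y
    have h2 := h1 _ (liftAux_comp h V hV)
    let x : V := ⟨h.base y, hV y⟩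
    have h5 := AlgebraicGeometry.PresheafedSpace.stalkMap.comp (liftAux h V hV)
      (X.toPresheafedSpace.ofRestrict V.isOpenEmbedding) y
    have h3 := AlgebraicGeometry.PresheafedSpace.restrictStalkIso_inv_eq_ofRestrict
      X.toPresheafedSpace V.isOpenEmbedding x
    have h4 : ∀ s, ((X.toPresheafedSpace.ofRestrict V.isOpenEmbedding).stalkMap x).hom
        ((X.toPresheafedSpace.restrictStalkIso V.isOpenEmbedding x).hom.hom s) = s := fun s => by
      rw [← h3]
      exact ConcreteCategory.congr_hom
        (X.toPresheafedSpace.restrictStalkIso V.isOpenEmbedding x).hom_inv_id s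
    refine Eq.trans ?_ (congrArg (comapRel
      (X.toPresheafedSpace.restrictStalkIso V.isOpenEmbedding x).hom.hom) h2)
    have h6 : ∀ a, ((liftAux h V hV).stalkMap y).hom a = ((liftAux h V hV ≫
        X.toPresheafedSpace.ofRestrict V.isOpenEmbedding).stalkMap y).hom
          ((X.toPresheafedSpace.restrictStalkIso V.isOpenEmbedding x).hom.hom a) := fun a =>
      (congrArg ((liftAux h V hV).stalkMap y).hom (h4 a)).symm.trans
        (ConcreteCategory.congr_hom h5 _).symm
    exact ValuativeRel.ext (funext fun a => funext fun b => congrArg₂ (R.val y).vle (h6 a) (h6 b))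

theorem lift_comp : (lift h V hV).comp (ofRestrict X V) = h := Hom.ext (liftAux_comp h V hV)

end PreAdicSpace

/-! ### Isomorphisms onto open subsets -/
namespace PreAdicSpace

variable {P Q R X : PreAdicSpace.{u}}

/-- Restriction of functions. -/
def rest (X : PreAdicSpace.{u}) {U V : Opens X} (h : U ≤ V) :
    X.presheaf.obj (op V) →+* X.presheaf.obj (op U) := (X.presheaf.map (homOfLE h).op).hom

theorem continuous_rest {U V : Opens X} (h : U ≤ V) : Continuous (X.rest h) :=
  X.continuous_map (homOfLE h)

theorem rest_rest {U V W : Opens X} (h : U ≤ V) (h' : V ≤ W) (s : X.presheaf.obj (op W)) :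
    X.rest h (X.rest h' s) = X.rest (h.trans h') s := presheaf_map_map X.presheaf _ _ _ s

theorem rest_self {U : Opens X} (h : U ≤ U) (s : X.presheaf.obj (op U)) : X.rest h s = s :=
  presheaf_map_self X.presheaf _ s

/-- The inverse image of an open subset. -/
abbrev Hom.inv (p : Hom P Q) (W : Opens Q) : Opens P := (Opens.map p.base).obj W

theorem Hom.inv_mono (p : Hom P Q) {V W : Opens Q} (h : V ≤ W) : p.inv V ≤ p.inv W :=
  fun _ hy => h hy

/-- The pullback of functions. -/
def Hom.pullback (p : Hom P Q) (W : Opens Q) :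
    Q.presheaf.obj (op W) →+* P.presheaf.obj (op (p.inv W)) := (p.c.app (op W)).hom

theorem Hom.continuous_pullback (p : Hom P Q) (W : Opens Q) : Continuous (p.pullback W) :=
  p.continuous_app W

theorem Hom.pullback_rest (p : Hom P Q) {V W : Opens Q} (h : V ≤ W) (s : Q.presheaf.obj (op W)) :
    p.pullback V (Q.rest h s) = P.rest (p.inv_mono h) (p.pullback W s) :=
  ConcreteCategory.congr_hom (p.c.naturality (homOfLE h).op) s

theorem Hom.rest_pullback_congr {p q : Hom P Q} (h : p = q) {W : Opens Q} {U : Opens P}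
    (hp : U ≤ p.inv W) (hq : U ≤ q.inv W) (s : Q.presheaf.obj (op W)) :
    P.rest hp (p.pullback W s) = P.rest hq (q.pullback W s) := by
  subst h
  rfl

theorem Hom.rest_pullback_id {p : Hom P P} (h : p = 𝟙 P) {W : Opens P}
    (hp : W ≤ p.inv W) (s : P.presheaf.obj (op W)) : P.rest hp (p.pullback W s) = s := by
  refine (Hom.rest_pullback_congr h hp le_rfl s).trans ?_
  refine (rest_self (U := W) le_rfl _).trans ?_
  have h1 : ((𝟙 P.toPresheafedSpace :) : P.toPresheafedSpace ⟶ P.toPresheafedSpace).c.app (op W) =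
      P.presheaf.map (𝟙 W).op := by
    simp
    rfl
  exact (ConcreteCategory.congr_hom h1 s).trans (presheaf_map_self P.presheaf (𝟙 W) s)

theorem isHomeomorph_pullback_of_iso (e : P ≅ Q) (W : Opens Q) :
    IsHomeomorph (Hom.pullback e.hom W) := by
  have h1 : Hom.comp e.hom e.inv = 𝟙 P := e.hom_inv_id
  have h2 : Hom.comp e.inv e.hom = 𝟙 Q := e.inv_hom_id
  have hb1 : ∀ y, e.inv.base (e.hom.base y) = y := fun y =>
    congrArg (fun k : Hom P P => k.base y) h1
  have hb2 : ∀ y, e.hom.base (e.inv.base y) = y := fun y =>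
    congrArg (fun k : Hom Q Q => k.base y) h2
  have hW : W ≤ Hom.inv e.inv (Hom.inv e.hom W) := fun y hy => by
    change e.hom.base (e.inv.base y) ∈ W
    rwa [hb2]
  have hW' : Hom.inv e.hom W ≤ Hom.inv (Hom.comp e.hom e.inv) (Hom.inv e.hom W) :=
    fun y (hy : e.hom.base y ∈ W) => by
      change e.hom.base (e.inv.base (e.hom.base y)) ∈ W
      rwa [hb1]
  rw [isHomeomorph_iff_exists_inverse]
  refine ⟨Hom.continuous_pullback _ _,
    fun t => Q.rest hW (Hom.pullback e.inv (Hom.inv e.hom W) t), fun s => ?_, fun t => ?_,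
    (continuous_rest hW).comp (Hom.continuous_pullback _ _)⟩
  · exact Hom.rest_pullback_id h2 hW s
  · rw [Hom.pullback_rest]
    exact Hom.rest_pullback_id h1 hW' t

/-- The properties of an isomorphism `i` of `P` onto the open subset `V` of `X` that are used: `i`
identifies the points and the open subsets of `P` with those of `V`, induces isomorphisms of
topological rings of functions on the open subsets of `V`, and every morphism with image in `V`
factors through it. -/
structure IsOpenImmersionOnto (i : Hom P X) (V : Opens X) : Prop where
  mem : ∀ y, i.base y ∈ V
  surj : ∀ x ∈ V, ∃ y, i.base y = x
  exists_opens : ∀ W : Opens P, ∃ U ≤ V, i.inv U = W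
  isHomeomorph : ∀ W ≤ V, IsHomeomorph (i.pullback W)
  exists_lift : ∀ (R : PreAdicSpace.{u}) (h : Hom R X), (∀ y, h.base y ∈ V) →
    ∃ γ : Hom R P, γ.comp i = h

theorem isHomeomorph_pullback_ofRestrict {V W : Opens X} (h : W ≤ V) :
    IsHomeomorph ((ofRestrict X V).pullback W) := by
  have h1 : V.isOpenEmbedding.isOpenMap.functor.obj ((ofRestrict X V).inv W) ≤ W := by
    rintro _ ⟨y, hy, rfl⟩
    exact hy
  have h2 : W ≤ V.isOpenEmbedding.isOpenMap.functor.obj ((ofRestrict X V).inv W) :=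
    fun y hy => ⟨⟨y, h hy⟩, hy, rfl⟩
  rw [isHomeomorph_iff_exists_inverse]
  refine ⟨Hom.continuous_pullback _ _, fun t => X.rest h2 t, fun s => ?_, fun t => ?_,
    continuous_rest h2⟩
  · exact (rest_rest h2 h1 s).trans (rest_self _ s)
  · exact (rest_rest h1 h2 t).trans (rest_self (X := X) le_rfl t)

theorem exists_isOpenImmersionOnto {V : Opens X} (e : X.restrictOpen V ≅ P) :
    ∃ i : Hom P X, IsOpenImmersionOnto i V := by
  have h1 : Hom.comp e.hom e.inv = 𝟙 (X.restrictOpen V) := e.hom_inv_id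
  have h2 : Hom.comp e.inv e.hom = 𝟙 P := e.inv_hom_id
  have hb1 : ∀ y, e.inv.base (e.hom.base y) = y := fun y =>
    congrArg (fun k : Hom (X.restrictOpen V) (X.restrictOpen V) => k.base y) h1
  have hb2 : ∀ y, e.hom.base (e.inv.base y) = y := fun y =>
    congrArg (fun k : Hom P P => k.base y) h2
  refine ⟨Hom.comp e.inv (ofRestrict X V), fun y => ?_, fun x hx => ?_, fun W => ?_, fun W hW => ?_,
    fun R h hV => ?_⟩
  · exact (e.inv.base y : V).2
  · exact ⟨e.hom.base (⟨x, hx⟩ : V), congrArg Subtype.val (hb1 (⟨x, hx⟩ : V))⟩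
  · refine ⟨V.isOpenEmbedding.isOpenMap.functor.obj (Hom.inv e.hom W), ?_, ?_⟩
    · rintro _ ⟨y, -, rfl⟩
      exact y.2
    · ext y
      change (∃ x : V, e.hom.base x ∈ W ∧ x.1 = (e.inv.base y : V).1) ↔ y ∈ W
      constructor
      · rintro ⟨x, hx, hxy⟩
        have : x = e.inv.base y := Subtype.ext hxy
        rwa [this, hb2] at hx
      · intro hy
        exact ⟨e.inv.base y, by rwa [hb2], rfl⟩
  · exact (isHomeomorph_pullback_of_iso e.symm _).comp (isHomeomorph_pullback_ofRestrict hW)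
  · refine ⟨Hom.comp (lift h V hV) e.hom, ?_⟩
    have h3 : (lift h V hV ≫ e.hom) ≫ (e.inv ≫ ofRestrict X V) = lift h V hV ≫ ofRestrict X V := by
      rw [Category.assoc, e.hom_inv_id_assoc]
    exact h3.trans (lift_comp h V hV)

end PreAdicSpace

/-! ### Finite étale algebras and dual bases -/

section

open TensorProduct

/-- A finite étale algebra is a finite projective module, so it has a dual basis. -/
theorem exists_dualBasis_of_etale (R S : Type*) [CommRing R] [CommRing S] [Algebra R S]
    [Module.Finite R S] [Algebra.Etale R S] :
    ∃ (n : ℕ) (D : DualBasis (algebraMap R S) n) (l : Fin n → S →ₗ[R] R),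
      ∀ i s, D.coord i s = l i s := by
  have : Module.FinitePresentation R S :=
    Module.FinitePresentation.of_finite_of_finitePresentation R S
  have : Module.Projective R S := Module.Flat.projective_of_finitePresentation
  obtain ⟨n, f, g, -, -, hfg⟩ := Module.Finite.exists_comp_eq_id_of_projective R S
  -- `f` is a surjection from a free module and `g` is a section of it.
  refine ⟨n, ⟨fun i => f (Pi.single i 1), fun i => ((LinearMap.proj i).comp g).toAddMonoidHom,
    fun i r s => ?_, fun s => ?_⟩, fun i => (LinearMap.proj i).comp g, fun i s => rfl⟩
  · rw [← Algebra.smul_def]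
    exact map_smul ((LinearMap.proj i).comp g) r s
  · have h : f (g s) = s := LinearMap.congr_fun hfg s
    conv_rhs => rw [← h, pi_eq_sum_univ' (g s), map_sum]
    refine Finset.sum_congr rfl fun i _ => ?_
    rw [map_smul, Algebra.smul_def]
    congr 2

/-- A finite étale algebra of rank `d` becomes free of rank `d` after inverting an element outside
a given prime ideal. -/
theorem exists_basis_baseChange_of_etale {R S : Type*} [CommRing R] [CommRing S] [Algebra R S]
    [Module.Finite R S] [Algebra.Etale R S] {d : ℕ}
    (hd : ∀ p : PrimeSpectrum R, Module.rankAtStalk S p = d) (p : Ideal R) [p.IsPrime] :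
    ∃ r ∉ p, ∀ (R' : Type u) [CommRing R'] [Algebra R R'] [Nontrivial R'],
      IsUnit (algebraMap R R' r) → Nonempty (Module.Basis (Fin d) R' (R' ⊗[R] S)) := by
  have : Module.FinitePresentation R S :=
    Module.FinitePresentation.of_finite_of_finitePresentation R S
  have : Module.Free (Localization.AtPrime p) (LocalizedModule p.primeCompl S) :=
    Module.free_of_flat_of_isLocalRing
  obtain ⟨r, hr, hfree, -⟩ := Module.FinitePresentation.exists_free_localizedModule_powers
    p.primeCompl (LocalizedModule.mkLinearMap p.primeCompl S) (Localization.AtPrime p)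
  refine ⟨r, hr, fun R' _ _ _ hu => ?_⟩
  let _ : Algebra (Localization (Submonoid.powers r)) R' :=
    (IsLocalization.Away.lift r hu).toAlgebra
  have : IsScalarTower R (Localization (Submonoid.powers r)) R' :=
    IsScalarTower.of_algebraMap_eq fun x => (IsLocalization.Away.lift_eq r hu x).symm
  have : Module.Free (Localization (Submonoid.powers r))
      (Localization (Submonoid.powers r) ⊗[R] S) :=
    Module.Free.of_equiv (IsLocalizedModule.isBaseChange (Submonoid.powers r)
      (Localization (Submonoid.powers r))
      (LocalizedModule.mkLinearMap (Submonoid.powers r) S)).equiv.symm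
  have : Module.Free R' (R' ⊗[R] S) :=
    Module.Free.of_equiv (TensorProduct.AlgebraTensorModule.cancelBaseChange R
      (Localization (Submonoid.powers r)) R' R' S)
  obtain ⟨q⟩ : Nonempty (PrimeSpectrum R') := inferInstance
  refine ⟨Module.finBasisOfFinrankEq R' _ ?_⟩
  have h := congrFun (Module.rankAtStalk_eq_finrank_of_free (R := R') (M := R' ⊗[R] S)) q
  rw [Module.rankAtStalk_baseChange, hd] at h
  exact h.symm

namespace DualBasis

variable {R S R' S' : Type*} [CommRing R] [CommRing S] [Algebra R S] [CommRing R'] [CommRing S']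
  [Algebra R' S'] {n : ℕ}

theorem sum_smul (D : DualBasis (algebraMap R S) n) (s : S) :
    ∑ i, D.coord i s • D.elt i = s := by
  simpa only [Algebra.smul_def] using D.sum_eq s

theorem coord_smul (D : DualBasis (algebraMap R S) n) (i : Fin n) (r : R) (s : S) :
    D.coord i (r • s) = r * D.coord i s := by
  rw [Algebra.smul_def, D.coord_mul]

/-- Compatible dual bases exhibit `S'` as the base change of `S`, so bases of `S` give bases of
`S'`. -/
theorem bijective_sum_smul (D : DualBasis (algebraMap R S) n) (D' : DualBasis (algebraMap R' S') n)
    (φ : R →+* R') (ψ : S →+* S') (h : ∀ r, ψ (algebraMap R S r) = algebraMap R' S' (φ r))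
    (helt : ∀ i, D'.elt i = ψ (D.elt i)) (hcoord : ∀ i s, D'.coord i (ψ s) = φ (D.coord i s))
    {d : ℕ} (e : Module.Basis (Fin d) R S) :
    Function.Bijective fun a : Fin d → R' => ∑ j, a j • ψ (e j) := by
  have hψ : ∀ r s, ψ (r • s) = φ r • ψ s := fun r s => by
    rw [Algebra.smul_def, map_mul, h, ← Algebra.smul_def]
  -- The coordinates with respect to `ψ e₁, …, ψ e_d`.
  let L : S' → Fin d → R' := fun x k => ∑ i, D'.coord i x * φ (e.repr (D.elt i) k)
  refine Function.bijective_iff_has_inverse.2 ⟨L, fun a => funext fun k => ?_, fun x => ?_⟩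
  · have hL : ∀ s, L (ψ s) k = φ (e.repr s k) := fun s => by
      conv_rhs => rw [← D.sum_smul s]
      simp [L, hcoord]
    have hlin : L (∑ j, a j • ψ (e j)) k = ∑ j, a j * L (ψ (e j)) k := by
      simp only [L, map_sum, coord_smul, Finset.sum_mul, Finset.mul_sum, mul_assoc]
      exact Finset.sum_comm
    rw [hlin]
    simp [hL, Finsupp.single_apply]
  · change ∑ j, (∑ i, D'.coord i x * φ (e.repr (D.elt i) j)) • ψ (e j) = x
    simp only [Finset.sum_smul]
    rw [Finset.sum_comm]
    conv_rhs => rw [← D'.sum_smul x]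
    refine Finset.sum_congr rfl fun i _ => ?_
    rw [helt]
    conv_rhs => rw [← e.sum_repr (D.elt i), map_sum, Finset.smul_sum]
    refine Finset.sum_congr rfl fun j _ => ?_
    rw [hψ, mul_smul]

/-- Compatible dual bases exhibit `S'` as the base change of `S`. -/
theorem nonempty_baseChange_algEquiv [Algebra R R'] [Algebra R S'] [IsScalarTower R R' S']
    (D : DualBasis (algebraMap R S) n) (D' : DualBasis (algebraMap R' S') n) (ψ : S →ₐ[R] S')
    (helt : ∀ i, D'.elt i = ψ (D.elt i))
    (hcoord : ∀ i s, D'.coord i (ψ s) = algebraMap R R' (D.coord i s)) :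
    Nonempty (R' ⊗[R] S ≃ₐ[R'] S') := by
  let F : R' ⊗[R] S →ₐ[R'] S' :=
    Algebra.TensorProduct.lift (Algebra.ofId R' S') ψ fun _ _ => Commute.all _ _
  have hF : ∀ a s, F (a ⊗ₜ s) = a • ψ s := fun a s => by
    rw [Algebra.smul_def]
    exact Algebra.TensorProduct.lift_tmul _ _ _ a s
  let G : S' →+ R' ⊗[R] S :=
    ∑ i, ((TensorProduct.mk R R' S).flip (D.elt i)).toAddMonoidHom.comp (D'.coord i)
  have hG : ∀ x, G x = ∑ i, D'.coord i x ⊗ₜ D.elt i := fun x => by simp [G]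
  refine ⟨AlgEquiv.ofBijective F (Function.bijective_iff_has_inverse.2
    ⟨G, fun z => ?_, fun x => ?_⟩)⟩
  · induction z with
    | zero => simp
    | add x y hx hy => rw [map_add, map_add, hx, hy]
    | tmul a s =>
      rw [hF, hG]
      conv_rhs => rw [← D.sum_smul s, TensorProduct.tmul_sum]
      refine Finset.sum_congr rfl fun i _ => ?_
      rw [coord_smul, hcoord, mul_comm, ← Algebra.smul_def, TensorProduct.smul_tmul]
  · rw [hG, map_sum]
    conv_rhs => rw [← D'.sum_smul x]
    refine Finset.sum_congr rfl fun i _ => ?_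
    rw [hF, helt]

/-- In the situation of `nonempty_baseChange_algEquiv`, the base change of an étale algebra is
étale, and a basis of the base change gives a basis of `S'`. -/
theorem etale_and_nonempty_basis [Module.Finite R S] [Algebra.Etale R S]
    (D : DualBasis (algebraMap R S) n) (D' : DualBasis (algebraMap R' S') n)
    (φ : R →+* R') (ψ : S →+* S') (h : ∀ r, ψ (algebraMap R S r) = algebraMap R' S' (φ r))
    (helt : ∀ i, D'.elt i = ψ (D.elt i)) (hcoord : ∀ i s, D'.coord i (ψ s) = φ (D.coord i s))
    {d : ℕ} (hb : letI := φ.toAlgebra; Nonempty (Module.Basis (Fin d) R' (R' ⊗[R] S))) :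
    Algebra.Etale R' S' ∧ Nonempty (Module.Basis (Fin d) R' S') := by
  let _ : Algebra R R' := φ.toAlgebra
  let _ : Algebra R S' := ((algebraMap R' S').comp φ).toAlgebra
  have : IsScalarTower R R' S' := IsScalarTower.of_algebraMap_eq fun _ => rfl
  obtain ⟨e⟩ := nonempty_baseChange_algEquiv D D' { ψ with commutes' := h } helt hcoord
  obtain ⟨b⟩ := hb
  exact ⟨Algebra.Etale.of_equiv e, ⟨b.map e.toLinearEquiv⟩⟩

end DualBasis

end

/-! ### Coordinates on the direct image of the structure sheaf -/

/-- An affinoid open subset is `Spa(A, A⁺)` for the complete Huber ring `A = 𝒪(V)`. -/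
theorem PreAdicSpace.IsOpenImmersionOnto.exists_ringEquiv {X : PreAdicSpace.{u}} {V : Opens X}
    {A : HuberPair.{u}} (hA : A.IsComplete) {i : PreAdicSpace.Hom (ofHuberPair A) X}
    (hi : IsOpenImmersionOnto i V) :
    ∃ e : A ≃+* X.presheaf.obj (op V), Continuous e ∧ Continuous e.symm ∧
      ∀ a, i.pullback V (e a) = Spa.ofRing (i.inv V) a := by
  have h1 : IsHomeomorph (Spa.ofRing (A := A) (i.inv V)) :=
    Spa.isHomeomorph_ofRing hA fun y _ => hi.mem y
  have h2 := hi.isHomeomorph V le_rfl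
  let e1 := RingEquiv.ofBijective (Spa.ofRing (A := A) (i.inv V)) h1.bijective
  let e2 := RingEquiv.ofBijective (i.pullback V) h2.bijective
  have h3 : ∀ a, i.pullback V (e2.symm (e1 a)) = Spa.ofRing (i.inv V) a := fun a =>
    e2.apply_symm_apply _
  refine ⟨e1.trans e2.symm, ?_, ?_, h3⟩
  · exact (h2.homeomorph _).symm.continuous.comp h1.continuous |>.congr fun a =>
      h2.injective (((h2.homeomorph _).apply_symm_apply _).trans (h3 a).symm)
  · exact (h1.homeomorph _).symm.continuous.comp h2.continuous |>.congr fun a =>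
      h1.injective (((h1.homeomorph _).apply_symm_apply _).trans (e1.apply_symm_apply _).symm)

namespace AdicSpace

variable {X Y : AdicSpace.{u}} (f : Hom Y X)

instance (U : Opens X.carrier) : TopologicalSpace (PreO f U) :=
  inferInstanceAs (TopologicalSpace (O Y ((Opens.map f.base).obj U)))

open PreAdicSpace in
/-- Over an affinoid open subset `V`, a dual basis of `𝒪_Y(f⁻¹ V)` restricts to dual bases of
`𝒪_Y(f⁻¹ W)` over `𝒪_X(W)` for all open subsets `W` of `V`, affinoid or not. The coordinates are
transported from `Spa(A, A⁺)`, and the identity `x = ∑ i, c i x * e i` can be checked locally on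
rational subsets of `V`. -/
theorem exists_dualBasis_of_isOpenImmersionOnto {V : Opens X.carrier} {A B : HuberPair.{u}}
    (hA : A.IsComplete) (hB : B.IsComplete)
    {iA : PreAdicSpace.Hom (ofHuberPair A) X.toPreAdicSpace} (hiA : IsOpenImmersionOnto iA V)
    {iB : PreAdicSpace.Hom (ofHuberPair B) Y.toPreAdicSpace}
    (hiB : IsOpenImmersionOnto iB ((Opens.map f.base).obj V))
    [Module.Finite (O X V) (PreO f V)] [Algebra.Etale (O X V) (PreO f V)]
    [IsModuleTopology (O X V) (PreO f V)] :
    ∃ (n : ℕ) (D : ∀ W ≤ V, DualBasis (algebraMap (O X W) (PreO f W)) n),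
      ∀ (U W : Opens X.carrier) (h : U ≤ W) (hW : W ≤ V) (i : Fin n),
        (D U (h.trans hW)).elt i = resPre f h ((D W hW).elt i) ∧
        ∀ x, (D U (h.trans hW)).coord i (resPre f h x) = resO X h ((D W hW).coord i x) := by
  obtain ⟨eA, heA, heA', heA''⟩ := hiA.exists_ringEquiv hA
  obtain ⟨eB, heB, heB', heB''⟩ : ∃ e : B ≃+* PreO f V, Continuous e ∧ Continuous e.symm ∧
      ∀ b, iB.pullback _ (e b) = Spa.ofRing (iB.inv _) b := hiB.exists_ringEquiv hB
  obtain ⟨γ, hγ⟩ := hiA.exists_lift _ (iB.comp f) hiB.mem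
  obtain ⟨n, D₀, l, hl⟩ := exists_dualBasis_of_etale (O X V) (PreO f V)
  have hl' : ∀ i, Continuous (l i) := fun i => IsModuleTopology.continuous_of_linearMap (l i)
  -- The map `𝒪_X(V) → 𝒪_Y(f⁻¹ V)` and its dual basis, in terms of the rings `A` and `B`.
  let φ : A →+* B := (eB.symm : PreO f V →+* B).comp ((f.appHom V).comp (eA : A →+* _))
  have hφc : Continuous φ := heB'.comp ((f.continuous_pullback V).comp heA)
  have heφ : ∀ a, eB (φ a) = algebraMap (O X V) (PreO f V) (eA a) := fun a => eB.apply_symm_apply _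
  let D : DualBasis φ n :=
    { elt := fun i => eB.symm (D₀.elt i)
      coord := fun i => (eA.symm : O X V →+ A).comp ((D₀.coord i).comp (eB : B →+ PreO f V))
      coord_mul := fun i a b => by
        change eA.symm (D₀.coord i (eB (φ a * b))) = a * eA.symm (D₀.coord i (eB b))
        have h : D₀.coord i (eB (φ a * b)) = eA a * D₀.coord i (eB b) := by
          rw [map_mul, heφ]
          exact D₀.coord_mul i (eA a) (eB b)
        rw [h, map_mul, eA.symm_apply_apply]
      sum_eq := fun b => by
        refine eB.injective ?_
        conv_rhs => rw [← D₀.sum_eq (eB b)]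
        rw [map_sum]
        refine Finset.sum_congr rfl fun i _ => ?_
        rw [map_mul, heφ]
        change algebraMap (O X V) (PreO f V) (eA (eA.symm _)) * eB (eB.symm _) = _
        rw [eA.apply_symm_apply, eB.apply_symm_apply]
        rfl }
  have hD : ∀ i, Continuous (D.coord i) := fun i => by
    have h : Continuous fun b => eA.symm (l i (eB b)) := heA'.comp ((hl' i).comp heB)
    exact h.congr fun b => congrArg eA.symm (hl i _).symm
  have hinv : ∀ W, γ.inv (iA.inv W) ≤ iB.inv (f.inv W) := fun W y hy => by
    have h := congrArg (fun k : PreAdicSpace.Hom (ofHuberPair B) X.toPreAdicSpace => k.base y) hγ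
    change f.base (iB.base y) ∈ W
    exact (show iA.base (γ.base y) = f.base (iB.base y) from h) ▸ hy
  have hinv' : ∀ W, iB.inv (f.inv W) ≤ γ.inv (iA.inv W) := fun W y hy => by
    have h := congrArg (fun k : PreAdicSpace.Hom (ofHuberPair B) X.toPreAdicSpace => k.base y) hγ
    change iA.base (γ.base y) ∈ W
    exact (show iA.base (γ.base y) = f.base (iB.base y) from h) ▸ hy
  -- Functions on `f⁻¹ W`, viewed on `Spa(B, B⁺)`.
  let T : ∀ W, PreO f W →+* Spa.sections (Spa.preimage γ (iA.inv W)) := fun W =>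
    ((ofHuberPair B).rest (hinv W)).comp (iB.pullback (f.inv W))
  have hTinj : ∀ W ≤ V, Function.Injective (T W) := fun W hW x y hxy => by
    refine (hiB.isHomeomorph (f.inv W) (f.inv_mono hW)).injective ?_
    have h := congrArg ((ofHuberPair B).rest (hinv' W)) hxy
    have h' : ∀ z, (ofHuberPair B).rest (hinv' W) ((ofHuberPair B).rest (hinv W)
        (iB.pullback (f.inv W) z)) = iB.pullback (f.inv W) z := fun z =>
      (rest_rest (X := ofHuberPair B) (hinv' W) (hinv W) _).trans
        (rest_self (X := ofHuberPair B) ((hinv' W).trans (hinv W)) _)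
    exact (h' x).symm.trans (h.trans (h' y))
  have hTalg : ∀ W (r : O X W), T W (algebraMap (O X W) (PreO f W) r) =
      Spa.pull γ (iA.inv W) (iA.pullback W r) := fun W r =>
    (Hom.rest_pullback_congr hγ.symm (hinv W) le_rfl r).trans (rest_self (X := ofHuberPair B) _ _)
  have hTres : ∀ U W (h : U ≤ W) (x : PreO f W), T U (resPre f h x) =
      Spa.restrictSections (Spa.preimage_mono γ (iA.inv_mono h)) (T W x) := fun U W h x =>
    (congrArg ((ofHuberPair B).rest (hinv U)) (iB.pullback_rest (f.inv_mono h) x)).trans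
      ((rest_rest (X := ofHuberPair B) (hinv U) (iB.inv_mono (f.inv_mono h)) _).trans
        (rest_rest (X := ofHuberPair B) (γ.inv_mono (iA.inv_mono h)) (hinv W) _).symm)
  have hφ : ∀ a, Spa.pull γ ⊤ (Spa.ofRing ⊤ a) = Spa.ofRing (Spa.preimage γ ⊤) (φ a) := by
    intro a
    have hle : (⊤ : Opens (Spa A)) ≤ iA.inv V := fun y _ => hiA.mem y
    have h1 : Spa.ofRing ⊤ a = Spa.restrictSections hle (iA.pullback V (eA a)) := by
      rw [heA'']
      rfl
    rw [h1]
    refine (Spa.pull_restrict γ hle (iA.pullback V (eA a))).trans ?_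
    rw [← hTalg]
    have h2 : T V (algebraMap (O X V) (PreO f V) (eA a)) =
        Spa.restrictSections (hinv V) (Spa.ofRing _ (φ a)) := by
      rw [← heB'', heφ]
      rfl
    rw [h2]
    rfl
  obtain ⟨Λ, hΛ1, hΛ2, hΛ3⟩ := Spa.exists_coord_sections γ hφ D hD hφc
  have hc : ∀ i W, W ≤ V → ∃ c : PreO f W →+ O X W,
      ∀ x, iA.pullback W (c x) = Λ i (iA.inv W) (T W x) := fun i W hW => by
    let e : O X W ≃+* Spa.sections (iA.inv W) :=
      RingEquiv.ofBijective (iA.pullback W) (hiA.isHomeomorph W hW).bijective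
    exact ⟨(e.symm : Spa.sections (iA.inv W) →+ O X W).comp
      ((Λ i (iA.inv W)).comp (T W : PreO f W →+ _)),
      fun x => e.apply_symm_apply (Λ i (iA.inv W) (T W x))⟩
  choose c hc using hc
  have hnat : ∀ i U W (h : U ≤ W) (hW : W ≤ V) x,
      c i U (h.trans hW) (resPre f h x) = resO X h (c i W hW x) := fun i U W h hW x => by
    refine (hiA.isHomeomorph U (h.trans hW)).injective ?_
    rw [hc, hTres]
    refine (hΛ1 i _ _ (iA.inv_mono h) _).trans ?_
    rw [← hc i W hW]
    exact (iA.pullback_rest h _).symm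
  have hlin : ∀ i W hW r x, c i W hW (algebraMap (O X W) (PreO f W) r * x) = r * c i W hW x :=
    fun i W hW r x => by
    refine (hiA.isHomeomorph W hW).injective ?_
    rw [hc, map_mul, hTalg, map_mul (iA.pullback W), hc]
    exact hΛ2 i _ _ _
  have hTelt : ∀ W hW i, T W (resPre f hW (D₀.elt i)) = Spa.ofRing _ (D.elt i) :=
    fun W hW i => by
    have h : T V (D₀.elt i) = Spa.restrictSections (hinv V) (Spa.ofRing _ (D.elt i)) := by
      rw [← heB'']
      change _ = (ofHuberPair B).rest (hinv V) (iB.pullback (f.inv V) (eB (eB.symm (D₀.elt i))))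
      rw [eB.apply_symm_apply]
      rfl
    rw [hTres, h]
    rfl
  have hsum : ∀ W (hW : W ≤ V) (ρ : RatData A), iA.inv W = ρ.opens → ∀ x,
      ∑ i, algebraMap (O X W) (PreO f W) (c i W hW x) * resPre f hW (D₀.elt i) = x :=
    fun W hW ρ hρ x => by
    refine hTinj W hW ?_
    rw [map_sum]
    refine Eq.trans (Finset.sum_congr rfl fun i _ => ?_) (hΛ3 ρ _ hρ (T W x))
    rw [map_mul, hTalg, hTelt, hc]
  have hsum' : ∀ W (hW : W ≤ V) x,
      ∑ i, algebraMap (O X W) (PreO f W) (c i W hW x) * resPre f hW (D₀.elt i) = x := by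
    intro W hW x
    refine O_eq_of_locally_eq (X := Y) fun y hy => ?_
    obtain ⟨z, hz⟩ := hiA.surj (f.base y) (hW hy)
    have hzW : z ∈ iA.inv W := by
      change iA.base z ∈ W
      rw [hz]
      exact hy
    obtain ⟨ρ, hzρ, hρ⟩ := RatData.exists_mem_subset (A := A) (iA.inv W).isOpen hzW
    obtain ⟨U, hU, hUρ⟩ := hiA.exists_opens ρ.opens
    have hUW : U ≤ W := fun u hu => by
      obtain ⟨t, rfl⟩ := hiA.surj u (hU hu)
      have ht : t ∈ ρ.opens := by
        rw [← hUρ]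
        exact hu
      exact hρ ht
    have hyU : f.base y ∈ U := by
      rw [← hz]
      have : z ∈ iA.inv U := by
        rw [hUρ]
        exact hzρ
      exact this
    refine ⟨f.inv U, f.inv_mono hUW, hyU, ?_⟩
    refine Eq.trans ?_ (hsum U hU ρ hUρ (resPre f hUW x))
    change resPre f hUW _ = _
    rw [map_sum]
    refine Finset.sum_congr rfl fun i _ => ?_
    rw [map_mul, resPre_algebraMap, ← hnat]
    congr 1
    exact resO_resO (X := Y) _ _ _
  refine ⟨n, fun W hW => ⟨fun i => resPre f hW (D₀.elt i), fun i => c i W hW, fun i => hlin i W hW,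
    hsum' W hW⟩, fun U W h hW i => ⟨(resO_resO (X := Y) _ _ _).symm, hnat i U W h hW⟩⟩

end AdicSpace

/-! ### Local bases of the direct image -/

theorem Spa.nontrivial_sections {A : HuberPair.{u}} {W : Opens (Spa A)} {x : Spa A} (hx : x ∈ W) :
    Nontrivial (sections W) := by
  have : Nontrivial x.ComplResidue := ⟨0, 1, fun h => by
    have h := congrArg x.complVal h
    rw [map_zero, map_one] at h
    exact zero_ne_one h⟩
  exact (evalSections hx).domain_nontrivial

namespace AdicSpace

variable {X Y : AdicSpace.{u}} {f : Hom Y X} {d : ℕ}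

open PreAdicSpace in
/-- Near a point of `V`, some function `s` which does not vanish there becomes invertible, and the
finite étale algebra `𝒪_Y(f⁻¹ V)` is free after inverting `s`. -/
theorem IsFiniteEtaleOver.hasLocalEtaleBases {V : Opens X.carrier} (hV : IsFiniteEtaleOver f V d)
    {x : X.carrier} (hx : x ∈ V) :
    ∃ (U : Opens X.carrier) (b : Fin d → Sec (pushF f) U) (hb : IsBasisOn (pushF f) U b),
      x ∈ U ∧ IsUnit (Algebra.discr (O X U) hb.preBasis) := by
  obtain ⟨A, hA, ⟨e⟩⟩ := hV.isAffinoidOpen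
  obtain ⟨B, hB, ⟨e'⟩⟩ := hV.isAffinoidOpen_preimage
  obtain ⟨iA, hiA⟩ := exists_isOpenImmersionOnto e
  obtain ⟨iB, hiB⟩ := exists_isOpenImmersionOnto e'
  have : Module.Finite (O X V) (PreO f V) := hV.finite
  have : Algebra.Etale (O X V) (PreO f V) := hV.etale
  have : IsModuleTopology (O X V) (PreO f V) := hV.isModuleTopology
  have hrank : ∀ p : PrimeSpectrum (O X V), Module.rankAtStalk (PreO f V) p = d := hV.rank
  obtain ⟨n, D, hD⟩ := exists_dualBasis_of_isOpenImmersionOnto f hA hB hiA hiB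
  obtain ⟨eA, -, -, heA⟩ := hiA.exists_ringEquiv hA
  obtain ⟨z, rfl⟩ := hiA.surj x hx
  -- The support of the point, as a prime ideal of `𝒪(V)`.
  let p : Ideal (O X V) := (Spa.v (A := A) z).supp.comap eA.symm
  have : p.IsPrime := inferInstanceAs ((Spa.v (A := A) z).supp.comap eA.symm).IsPrime
  obtain ⟨s, hs, hs'⟩ := exists_basis_baseChange_of_etale.{u} hrank p
  have hzs : ¬ (Spa.rel (A := A) z).vle (eA.symm s) 0 := fun h =>
    hs ((Spa.v_eq_zero_iff (A := A) z).2 h)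
  obtain ⟨ρ, hzρ, hρ⟩ := RatData.exists_mem_subset (A := A)
    (Spa.isOpen_setOf_vle 0 (eA.symm s)) (x := z) ⟨@ValuativeRel.zero_vle A _ (Spa.rel z) _, hzs⟩
  obtain ⟨U, hU, hUρ⟩ := hiA.exists_opens ρ.opens
  have hzU : z ∈ iA.inv U := by
    rw [hUρ]
    exact hzρ
  -- `s` does not vanish on `U`.
  have hsU : IsUnit (resO X hU s) := by
    let q := RingEquiv.ofBijective (iA.pullback U) (hiA.isHomeomorph U hU).bijective
    have h : IsUnit (Spa.ofRing (A := A) (iA.inv U) (eA.symm s)) := by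
      rw [hUρ]
      exact Spa.isUnit_ofRing fun y hy => (hρ hy).2
    have h2 : q (resO X hU s) = Spa.ofRing (A := A) (iA.inv U) (eA.symm s) := by
      refine (iA.pullback_rest hU s).trans ?_
      conv_lhs => rw [← eA.apply_symm_apply s]
      rw [heA]
      rfl
    rw [← h2] at h
    exact (isUnit_map_iff q _).1 h
  have : Nontrivial (Spa.sections (A := A) (iA.inv U)) := Spa.nontrivial_sections hzU
  have : Nontrivial (O X U) :=
    (show O X U →+* Spa.sections (A := A) (iA.inv U) from iA.pullback U).domain_nontrivial
  have hb : letI := (resO X hU).toAlgebra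
      Nonempty (Module.Basis (Fin d) (O X U) (TensorProduct (O X V) (O X U) (PreO f V))) :=
    letI := (resO X hU).toAlgebra
    hs' (O X U) hsU
  obtain ⟨hU', ⟨b⟩⟩ := DualBasis.etale_and_nonempty_basis (D V le_rfl) (D U hU) (resO X hU)
    (resPre f hU) (resPre_algebraMap f hU) (fun i => (hD U V hU le_rfl i).1)
    (fun i => (hD U V hU le_rfl i).2) hb
  have hbU : IsBasisOn (pushF f) U fun i => (pushEquiv f U).symm (b i) := fun W hW =>
    DualBasis.bijective_sum_smul (D U hU) (D W (hW.trans hU)) (resO X hW)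
      (resPre f hW) (resPre_algebraMap f hW) (fun i => (hD W U hW hU i).1)
      (fun i => (hD W U hW hU i).2) b
  exact ⟨U, _, hbU, hzU, isUnit_discr_of_etale _⟩

theorem IsFiniteEtaleOfDegree.hasLocalEtaleBases (hf : IsFiniteEtaleOfDegree f d) :
    HasLocalEtaleBases f d := fun x =>
  let ⟨_, hx, hV⟩ := hf x
  hV.hasLocalEtaleBases hx

end AdicSpace

end Adic

end

theorem mainTheorem9 {X Y : Adic.AdicSpace.{u}} (f : Adic.AdicSpace.Hom Y X) (d : ℕ)
    (hf : Adic.AdicSpace.IsFiniteEtaleOfDegree f d) :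
    Adic.AdicSpace.IsLocallyFreeOfRank (Adic.AdicSpace.pushforwardStructure f) d ∧
      Nonempty (Adic.AdicSpace.tensor
          (Adic.AdicSpace.exteriorPower (Adic.AdicSpace.pushforwardStructure f) d)
          (Adic.AdicSpace.exteriorPower (Adic.AdicSpace.pushforwardStructure f) d) ≅
        X.structureModule) := by
  have h := hf.hasLocalEtaleBases
  refine ⟨Adic.AdicSpace.isLocallyFreeOfRank_of_isBasisOn _ fun x => ?_,
    Adic.AdicSpace.nonempty_tensor_exteriorPower_iso h⟩
  obtain ⟨U, b, hb, hx, -⟩ := h x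
  exact ⟨U, b, hx, hb⟩
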